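/- For $a=(a_{ijk})\in\mathbb C^{3\times4\times5}$ let $M_a$ be the $3\times4$ matrix of linear forms in $x=(x_1,\dots,x_5)$ with entries $(M_a)_{ij}=\sum_{k}a_{ijk}x_k$, and let $X_a\subset\mathbb C^5$ be the scheme defined by the $3$-minors of $M_a$. Let $W\subset \mathrm{Mat}_{3,4}(\mathbb C)\times\mathbb P^2$ be the Zariski closure of the set of pairs $(B,[s])$ with $\operatorname{rank}B=2$ and $s^{T}B=0$ (the graph of the map sending a matrix of rank $2$ to the hyperplane spanned by its columns). The Tjurina transform of $X_a$ is the fibre product $Y_a\subset\mathbb C^5\times\mathbb P^2$ of $X_a$ and $W$ over the variety of $3\times 4$ matrices of rank $<3$. A finite set of points of $\mathbb P^2$ is said to be in general position if for every $d$ no $\binom{d+2}{2}$ of its points lie on a curve of degree $d$ (no three on a line, no six on a conic, no ten on a cubic, and so on). Corollary (10 points). There is a non-empty Zariski open set of coefficients $a\in\mathbb C^{3\times4\times5}$ such that for every $a$ in it, $(X_a,0)\subset(\mathbb C^5,0)$ is an ICMC2 singularity of type $(3,4,3)$, that is, $X_a$ has the expected codimension $2$ in $\mathbb C^5$ and an isolated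 singularity at $0$, and the singular locus of the Tjurina transform $Y_a$ (the set of points at which its local ring is not regular) is $\{0\}\times\Sigma$, where $\Sigma\subset\mathbb P^2$ consists of exactly $10$ points in general position. -/

import Mathlib

open MvPolynomial

noncomputable section

namespace Determinantal

/-! ### Points of affine schemes over `ℂ` -/

/-- The local ring at the point `p` of the affine scheme `V(I) ⊆ ℂ^σ`
(the zero ring if `p` does not lie on `V(I)`). -/
abbrev LocalRingAt {σ : Type} (I : Ideal (MvPolynomial σ ℂ)) (p : σ → ℂ) : Type :=
  Localization.AtPrime (vanishingIdeal ℂ ({p} : Set (σ → ℂ))) ⧸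
    I.map (algebraMap (MvPolynomial σ ℂ)
      (Localization.AtPrime (vanishingIdeal ℂ ({p} : Set (σ → ℂ)))))

/-- The set of singular points of the affine scheme `V(I) ⊆ ℂ^σ`: the points of `V(I)` at which
the local ring is not regular. -/
def singularPoints {σ : Type} (I : Ideal (MvPolynomial σ ℂ)) : Set (σ → ℂ) :=
  {p | p ∈ zeroLocus ℂ I ∧ ¬ IsRegularLocalRing (LocalRingAt I p)}

/-! ### Determinantal varieties -/

/-- The ideal of `t`-minors of a matrix. -/
def minorIdeal {R : Type} [CommRing R] {m n : ℕ} (t : ℕ) (M : Matrix (Fin m) (Fin n) R) :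
    Ideal R :=
  Ideal.span {d | ∃ (r : Fin t ↪o Fin m) (c : Fin t ↪o Fin n), d = (M.submatrix r c).det}

/-- For a polynomial map `M` from `ℂ^N` to the space of `m × n` matrices, `X = V(t`-minors of `M)`
is a determinantal variety of type `(m, n, t)`, i.e. `X` has the expected codimension
`(m - t + 1)(n - t + 1)` in `ℂ^N`. -/
def IsDeterminantalVariety {N m n : ℕ} (t : ℕ)
    (M : Matrix (Fin m) (Fin n) (MvPolynomial (Fin N) ℂ)) : Prop :=
  1 ≤ t ∧ t ≤ m ∧ t ≤ n ∧
    ringKrullDim (MvPolynomial (Fin N) ℂ ⧸ minorIdeal t M) +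
      (((m - t + 1) * (n - t + 1) : ℕ) : WithBot ℕ∞) = ((N : ℕ) : WithBot ℕ∞)

/-- The scheme `V(I)` in `ℂ^N` has an isolated singularity at the origin. -/
def HasIsolatedSingularityAtZero {N : ℕ} (I : Ideal (MvPolynomial (Fin N) ℂ)) : Prop :=
  0 ∈ singularPoints I ∧ ∃ U : Set (Fin N → ℂ), IsOpen U ∧ 0 ∈ U ∧ U ∩ singularPoints I = {0}

/-- The `t × (t+1)` matrix `M` defines an isolated Cohen-Macaulay codimension 2 singularity at the
origin: its `t`-minors define a determinantal variety of type `(t, t+1, t)` (so of codimension 2)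
with an isolated singularity at the origin. -/
def IsICMC2 {N t : ℕ} (M : Matrix (Fin t) (Fin (t + 1)) (MvPolynomial (Fin N) ℂ)) : Prop :=
  IsDeterminantalVariety t M ∧ HasIsolatedSingularityAtZero (minorIdeal t M)

/-- The matrix of linear forms `∑ₖ a (i, j, k) xₖ` with coefficients `a`. -/
def linearMatrix {N m n : ℕ} (a : Fin m × Fin n × Fin N → ℂ) :
    Matrix (Fin m) (Fin n) (MvPolynomial (Fin N) ℂ) :=
  Matrix.of fun i j => ∑ k, C (a (i, j, k)) * X k

/-! ### The Tjurina transform, for maximal minors (`t = m ≤ n`)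

The columns of an `m × n` matrix `B` of rank `m - 1` span a hyperplane of `ℂ^m`, i.e. a point
`[s]` of the Grassmannian of hyperplanes `≅ ℙ^{m-1}`, where `s ≠ 0` and `sᵀ B = 0`. `W` is the
closure in `Mat(m, n) × ℙ^{m-1}` of the graph of `B ↦ [s]`, and the Tjurina transform of
`X = M⁻¹(matrices of rank < m)` is the fibre product `Y ⊆ ℂ^N × ℙ^{m-1}` of `X` and `W` over
the space of matrices of rank `< m`, i.e. the preimage of `W` under `M × id`.

We describe the chart `s_i ≠ 0` of `ℙ^{m-1}` as the affine space `{s | s_i = 1} ⊆ ℂ^m`. -/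

/-- The graph of `B ↦ [s]` on matrices of rank exactly `m - 1`, in the chart `s_i = 1`.
A point of the ambient space `ℂ^{m × n} × ℂ^m` is a function on `(Fin m × Fin n) ⊕ Fin m`. -/
def graphChart (m n : ℕ) (i : Fin m) : Set ((Fin m × Fin n) ⊕ Fin m → ℂ) :=
  {q | (Matrix.of fun j k => q (Sum.inl (j, k)) : Matrix (Fin m) (Fin n) ℂ).rank + 1 = m ∧
    q (Sum.inr i) = 1 ∧
    Matrix.vecMul (fun j => q (Sum.inr j))
      (Matrix.of fun j k => q (Sum.inl (j, k)) : Matrix (Fin m) (Fin n) ℂ) = 0}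

/-- The comorphism of `M × id : ℂ^N × ℂ^m → ℂ^{m × n} × ℂ^m`. -/
def pullback {N m n : ℕ} (M : Matrix (Fin m) (Fin n) (MvPolynomial (Fin N) ℂ)) :
    MvPolynomial ((Fin m × Fin n) ⊕ Fin m) ℂ →ₐ[ℂ] MvPolynomial (Fin N ⊕ Fin m) ℂ :=
  aeval (Sum.elim (fun jk => rename Sum.inl (M jk.1 jk.2)) (fun j => X (Sum.inr j)))

/-- The ideal of the Tjurina transform of `M` in the chart `s_i = 1`: the extension along `M × id`
of the ideal of the closure of the graph. -/
def tjurinaIdeal {N m n : ℕ} (M : Matrix (Fin m) (Fin n) (MvPolynomial (Fin N) ℂ)) (i : Fin m) :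
    Ideal (MvPolynomial (Fin N ⊕ Fin m) ℂ) :=
  (vanishingIdeal ℂ (graphChart m n i)).map (pullback M)

/-- The singular locus, in `ℂ^N × ℙ^{m-1}`, of the Tjurina transform of `M`. -/
def tjurinaSingularLocus {N m n : ℕ} (M : Matrix (Fin m) (Fin n) (MvPolynomial (Fin N) ℂ)) :
    Set ((Fin N → ℂ) × Projectivization ℂ (Fin m → ℂ)) :=
  {q | ∃ i, q.2.rep i ≠ 0 ∧
    Sum.elim q.1 ((q.2.rep i)⁻¹ • q.2.rep) ∈ singularPoints (tjurinaIdeal M i)}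

/-! ### General position -/

/-- A finite set of points of `ℙ²` is in general position if, for every `d`, no
`(d + 2 choose 2) = dim ℂ[x, y, z]_d` of them lie on a curve of degree `d`
(no three on a line, no six on a conic, no ten on a cubic, ...). -/
def InGeneralPosition (S : Finset (Projectivization ℂ (Fin 3 → ℂ))) : Prop :=
  ∀ (d : ℕ) (T : Finset (Projectivization ℂ (Fin 3 → ℂ))), T ⊆ S → T.card = (d + 2).choose 2 →
    ∀ f : MvPolynomial (Fin 3) ℂ, f.IsHomogeneous d → (∀ p ∈ T, eval p.rep f = 0) → f = 0

end Determinantal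

end

/-! Contracting `a` with s gives a 4×5 matrix N(s) (`contractRows`) of linear forms on ℙ², and
sᵀM_a(x) = N(s)x. In each chart Y_a is therefore N(s)x = 0, with fibre ker N(s) over [s]: a line
where N(s) has rank 4, and more where its five maximal minors, quartics in s, all vanish. This
degeneracy locus has expected codimension 2 and degree C(5,2) = 10. It is Σ, and Y_a is singular
exactly at the points (0,[s]) with [s] in Σ.

The ten points come from linear algebra. When `spanDet a ≠ 0`, multiplication by X₀ identifies the
ten-dimensional space of cubics with quartics modulo the minors. Multiplication by Xᵢ/X₀ then gives
commuting 10×10 matrices (`mulMatrix`, `mulMatrix_comm`) whose common left eigenvectors are the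
evaluations at the points. Distinctness and general position become conditions on the eigenvalues,
which `exists_resolvent` turns into polynomial conditions on `a`; the polynomial g of the theorem is
the product of these (`exists_isGeneral`). That g is nonzero is checked on one explicit form
degenerating at (1,t,t⁴), t = 1,…,10 (`isBase_baseForm`), where general position is the nonvanishing
of generalised Vandermonde determinants at positive reals.

The geometry of X_a and Y_a rests on two consequences for a general form. Reducedness of Σ implies
that the trilinear form has no critical point (`IsGeneral.nondegenerate`). Since no three points of
Σ are collinear, M_a(x) has rank at least 2 for x ≠ 0 (`IsGeneral.not_mulVec_eq_zero`). With these
the Jacobian criterion gives regularity and dimension 3 away from the claimed singular points. At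
those points the tangent space is too large for dimension 3. -/

/-! ### Resolvents: symmetric conditions on the roots of a polynomial -/

/-- The product over all injections is symmetric in the roots, hence a polynomial in the elementary
symmetric functions, which by Vieta are signed coefficients of χ. The element `c` is chosen before
`f`, so a single `c` serves all specialisations of the parameters. -/
theorem MvPolynomial.exists_resolvent {A : Type*} [CommRing A] (χ : Polynomial A) (n : ℕ)
    {ι : Type*} [Fintype ι] (G : MvPolynomial ι A) :
    ∃ c : A, ∀ {B : Type} [CommRing B] (f : A →+* B) (t : Fin n → B),
      χ.map f = ∏ i, (Polynomial.X - Polynomial.C (t i)) →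
        f c = ∏ e : ι ↪ Fin n, eval₂ f (fun i => t (e i)) G := by
  classical
  have hsym : (∏ e : ι ↪ Fin n, rename e G).IsSymmetric := by
    intro σ
    rw [map_prod]
    simp_rw [rename_rename]
    exact Fintype.prod_equiv (Equiv.embeddingCongr (Equiv.refl ι) σ) _ _
      (fun e => congrArg (fun h => rename h G) (by ext; simp))
  obtain ⟨Q, hQ⟩ := (esymmAlgHom_fin_bijective A n).2 ⟨_, hsym⟩
  have hQ' : aeval (fun i : Fin n => esymm (Fin n) A (i + 1)) Q = ∏ e : ι ↪ Fin n, rename e G := by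
    rw [← esymmAlgHom_apply, hQ]
  refine ⟨eval (fun i : Fin n => (-1) ^ (i + 1 : ℕ) * χ.coeff (n - (i + 1))) Q, ?_⟩
  intro B _ f t ht
  have h1 : ∏ e : ι ↪ Fin n, eval₂ f (fun i => t (e i)) G =
      eval₂ f t (∏ e : ι ↪ Fin n, rename e G) := by
    rw [← coe_eval₂Hom, map_prod]
    simp [eval₂_rename, Function.comp_def]
  rw [h1, ← hQ', aeval_def, ← coe_eval₂Hom, hom_eval₂, eval, coe_eval₂Hom, hom_eval₂]
  congr 1
  · ext; simp
  · funext i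
    have hs : (eval₂Hom f t) (esymm (Fin n) A (i + 1)) =
        (Finset.univ.val.map t).esymm (i + 1) := by
      rw [Finset.esymm_map_val]
      simp [esymm]
    have hv := Multiset.prod_X_sub_C_coeff (Finset.univ.val.map t) (k := n - (i + 1)) (by simp)
    rw [Multiset.map_map] at hv
    have hc : f (χ.coeff (n - (i + 1))) = (-1) ^ (i + 1 : ℕ) *
        (Finset.univ.val.map t).esymm (i + 1) := by
      rw [← Polynomial.coeff_map, ht]
      have hi : n - (n - (i + 1)) = (i + 1 : ℕ) := by omega
      simpa [hi, Finset.prod, Function.comp_def] using hv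
    rw [hs, map_mul, hc, map_pow, map_neg, map_one, ← mul_assoc, ← mul_pow]
    simp

namespace Determinantal

/-! ### The matrix of quartics attached to a trilinear form -/

/-- The exponents of the monomials of degree `d` in three variables. -/
structure Exps (d : ℕ) : Type where
  val : Fin 3 →₀ ℕ
  degree_eq : val.degree = d

theorem mem_antidiag {d : ℕ} {m : Fin 3 →₀ ℕ} :
    m ∈ Finset.finsuppAntidiag (Finset.univ : Finset (Fin 3)) d ↔ m.degree = d := by
  simp [Finset.mem_finsuppAntidiag, Finsupp.degree_eq_sum]

noncomputable def expsEquivAntidiag (d : ℕ) :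
    {m // m ∈ Finset.finsuppAntidiag (Finset.univ : Finset (Fin 3)) d} ≃ Exps d where
  toFun m := ⟨m.1, mem_antidiag.1 m.2⟩
  invFun m := ⟨m.1, mem_antidiag.2 m.2⟩

noncomputable instance (d : ℕ) : Fintype (Exps d) := Fintype.ofEquiv _ (expsEquivAntidiag d)

noncomputable instance (d : ℕ) : DecidableEq (Exps d) := Classical.decEq _

@[ext] theorem Exps.ext' {d : ℕ} {m m' : Exps d} (h : m.1 = m'.1) : m = m' := by
  cases m; cases m'; simpa using h

theorem card_exps (d : ℕ) : Fintype.card (Exps d) = (d + 2).choose 2 := by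
  rw [← Fintype.card_congr (expsEquivAntidiag d), Fintype.card_coe, Finset.card_finsuppAntidiag_nat_eq_choose]
  simp only [Finset.card_univ, Fintype.card_fin]
  rw [show d + 2 = 2 + d by omega, show 3 + d - 1 = 2 + d by omega, Nat.choose_symm_add]

section Ring

variable {R : Type*} [CommRing R]

/-- The form of degree `d` with the given coefficients. -/
noncomputable def formOf (d : ℕ) (w : Exps d → R) : MvPolynomial (Fin 3) R :=
  ∑ m, monomial m.1 (w m)

theorem coeff_formOf {d : ℕ} (w : Exps d → R) (m : Exps d) : coeff m.1 (formOf d w) = w m := by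
  simp only [formOf, coeff_sum, coeff_monomial]
  rw [Finset.sum_eq_single m]
  · simp
  · exact fun b _ hb => if_neg fun h => hb (Exps.ext' h)
  · simp

theorem isHomogeneous_formOf {d : ℕ} (w : Exps d → R) : (formOf d w).IsHomogeneous d :=
  IsHomogeneous.sum _ _ _ fun m _ => isHomogeneous_monomial _ (m.2)

theorem formOf_coeff {d : ℕ} {f : MvPolynomial (Fin 3) R} (hf : f.IsHomogeneous d) :
    formOf d (fun m => coeff m.1 f) = f := by
  ext m
  by_cases hm : m.degree = d
  · exact coeff_formOf _ ⟨m, hm⟩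
  · rw [hf.coeff_eq_zero hm, (isHomogeneous_formOf _).coeff_eq_zero hm]

theorem formOf_single {d : ℕ} (m : Exps d) (c : R) :
    formOf d (Pi.single m c) = monomial m.1 c := by
  rw [formOf, Finset.sum_eq_single m] <;> simp +contextual

theorem eval_formOf {d : ℕ} (w : Exps d → R) (p : Fin 3 → R) :
    eval p (formOf d w) = ∑ m, w m * eval p (monomial m.1 1) := by
  simp [formOf, eval_monomial]

/-- The linear map in the last two arguments obtained by contracting the trilinear form `a`
with `s`. -/
def contractRows (a : Fin 3 × Fin 4 × Fin 5 → R) (s : Fin 3 → R) : Matrix (Fin 4) (Fin 5) R :=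
  Matrix.of fun j k => ∑ i, a (i, j, k) * s i

/-- The maximal minors of `contractRows`. -/
def rowMinor (a : Fin 3 × Fin 4 × Fin 5 → R) (s : Fin 3 → R) (k : Fin 5) : R :=
  ((contractRows a s).submatrix id k.succAbove).det

/-- The maximal minors of `contractRows` as quartic forms. -/
noncomputable def quartic (a : Fin 3 × Fin 4 × Fin 5 → R) (k : Fin 5) : MvPolynomial (Fin 3) R :=
  rowMinor (fun t => C (a t)) X k

theorem map_contractRows {S : Type*} [CommRing S] (f : R →+* S) (a : Fin 3 × Fin 4 × Fin 5 → R)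
    (s : Fin 3 → R) :
    (contractRows a s).map f = contractRows (fun t => f (a t)) (fun i => f (s i)) := by
  ext j k
  simp [contractRows]

theorem map_rowMinor {S : Type*} [CommRing S] (f : R →+* S) (a : Fin 3 × Fin 4 × Fin 5 → R)
    (s : Fin 3 → R) (k : Fin 5) :
    f (rowMinor a s k) = rowMinor (fun t => f (a t)) (fun i => f (s i)) k := by
  rw [rowMinor, rowMinor, RingHom.map_det, ← map_contractRows]
  rfl

theorem eval_quartic (a : Fin 3 × Fin 4 × Fin 5 → R) (s : Fin 3 → R) (k : Fin 5) :
    eval s (quartic a k) = rowMinor a s k := by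
  rw [quartic, map_rowMinor]
  simp

theorem map_quartic {S : Type*} [CommRing S] (f : R →+* S) (a : Fin 3 × Fin 4 × Fin 5 → R)
    (k : Fin 5) : map f (quartic a k) = quartic (fun t => f (a t)) k := by
  rw [quartic, map_rowMinor, quartic]
  simp

theorem isHomogeneous_quartic (a : Fin 3 × Fin 4 × Fin 5 → R) (k : Fin 5) :
    (quartic a k).IsHomogeneous 4 := by
  rw [quartic, rowMinor, Matrix.det_apply]
  refine IsHomogeneous.sum _ _ _ fun σ _ => ?_
  have h : (∏ i, ((contractRows (fun t => C (a t)) X).submatrix id k.succAbove) (σ i) i :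
      MvPolynomial (Fin 3) R).IsHomogeneous (∑ _i : Fin 4, 1) := by
    refine IsHomogeneous.prod _ _ _ fun i _ => ?_
    refine IsHomogeneous.sum Finset.univ (fun l => C (a (l, σ i, k.succAbove i)) * X l) 1
      fun l _ => ?_
    simpa using (isHomogeneous_C (Fin 3) (a (l, σ i, k.succAbove i))).mul (isHomogeneous_X R l)
  rw [Units.smul_def]
  exact zsmul_mem (K := homogeneousSubmodule (Fin 3) R 4) h _

/-- Laplace expansion of the 5×5 determinant with row `j` repeated. These are the Hilbert–Burch
syzygies of the five quartics. -/
theorem sum_contractRows_mul_rowMinor (a : Fin 3 × Fin 4 × Fin 5 → R) (s : Fin 3 → R)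
    (j : Fin 4) : ∑ k : Fin 5, (-1) ^ (k : ℕ) * contractRows a s j k * rowMinor a s k = 0 := by
  have h : (Matrix.of (Fin.cons (contractRows a s j) (contractRows a s)) :
      Matrix (Fin 5) (Fin 5) R).det = 0 :=
    Matrix.det_zero_of_row_eq (i := 0) (j := j.succ) (Fin.succ_ne_zero j).symm (by
      rfl)
  rw [Matrix.det_succ_row_zero] at h
  exact h

/-! ### The multiplication matrices -/

/-- The matrix of `(f, c) ↦ X₀ f + ∑ cₖ Δₖ` from cubics and constants to quartics. -/
noncomputable def spanMatrix (a : Fin 3 × Fin 4 × Fin 5 → R) :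
    Matrix (Exps 4) (Exps 3 ⊕ Fin 5) R :=
  Matrix.of fun r => Sum.elim (fun m => coeff r.1 (X 0 * monomial m.1 1))
    (fun k => coeff r.1 (quartic a k))

/-- Since 10 + 5 = 15, `spanMatrix` is square up to reindexing. Another choice of bijection changes
`spanDet` only by a sign. -/
noncomputable def expsEquiv : Exps 3 ⊕ Fin 5 ≃ Exps 4 :=
  Fintype.equivOfCardEq (by rw [Fintype.card_sum, card_exps, card_exps]; rfl)

noncomputable def spanMatrixSq (a : Fin 3 × Fin 4 × Fin 5 → R) : Matrix (Exps 4) (Exps 4) R :=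
  (spanMatrix a).submatrix id expsEquiv.symm

noncomputable def spanDet (a : Fin 3 × Fin 4 × Fin 5 → R) : R := (spanMatrixSq a).det

/-- Cramer's rule without the division: the entries stay polynomial in `a` and commute with base
change. -/
noncomputable def spanSolve (a : Fin 3 × Fin 4 × Fin 5 → R) (v : Exps 4 → R) :
    Exps 3 ⊕ Fin 5 → R :=
  ((spanMatrixSq a).adjugate.mulVec v) ∘ expsEquiv

theorem spanMatrix_mulVec (a : Fin 3 × Fin 4 × Fin 5 → R) (w : Exps 3 → R) (c : Fin 5 → R) :
    formOf 4 ((spanMatrix a).mulVec (Sum.elim w c)) =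
      X 0 * formOf 3 w + ∑ k, C (c k) * quartic a k := by
  have hh : (X 0 * formOf 3 w + ∑ k, C (c k) * quartic a k).IsHomogeneous 4 := by
    refine IsHomogeneous.add ?_ (IsHomogeneous.sum _ _ _ fun k _ => ?_)
    · simpa using! (isHomogeneous_X R (0 : Fin 3)).mul (isHomogeneous_formOf w)
    · simpa using (isHomogeneous_C (Fin 3) (c k)).mul (isHomogeneous_quartic a k)
  rw [← formOf_coeff hh]
  congr 1
  funext r
  simp only [spanMatrix, Matrix.mulVec, dotProduct, Fintype.sum_sum_type, Matrix.of_apply,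
    Sum.elim_inl, Sum.elim_inr, coeff_add, coeff_sum, coeff_C_mul]
  congr 1
  · rw [formOf, Finset.mul_sum, coeff_sum]
    refine Finset.sum_congr rfl fun m _ => ?_
    rw [show monomial m.1 (w m) = C (w m) * monomial m.1 1 by rw [C_mul_monomial, mul_one],
      mul_left_comm, coeff_C_mul, mul_comm]
  · exact Finset.sum_congr rfl fun k _ => mul_comm _ _

theorem spanSolve_spec (a : Fin 3 × Fin 4 × Fin 5 → R) (v : Exps 4 → R) :
    C (spanDet a) * formOf 4 v = X 0 * formOf 3 (fun m => spanSolve a v (Sum.inl m)) +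
      ∑ k, C (spanSolve a v (Sum.inr k)) * quartic a k := by
  have h2 : (Sum.elim (fun m => spanSolve a v (Sum.inl m)) fun k => spanSolve a v (Sum.inr k)) =
      spanSolve a v := by
    ext (x | x) <;> rfl
  rw [← spanMatrix_mulVec, h2]
  have h1 : (spanMatrix a).mulVec (spanSolve a v) = spanDet a • v := by
    have : (spanMatrix a).mulVec (spanSolve a v) =
        (spanMatrixSq a).mulVec ((spanMatrixSq a).adjugate.mulVec v) := by
      rw [spanMatrixSq, Matrix.submatrix_mulVec_equiv]
      rfl
    rw [this, Matrix.mulVec_mulVec, Matrix.mul_adjugate, Matrix.smul_mulVec, Matrix.one_mulVec,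
      spanDet]
  rw [h1, formOf, formOf, Finset.mul_sum]
  simp [C_mul_monomial]

/-- The matrix of multiplication by `X i / X 0` on cubics modulo the quartics, times `spanDet`. -/
noncomputable def mulMatrix (i : Fin 3) (a : Fin 3 × Fin 4 × Fin 5 → R) :
    Matrix (Exps 3) (Exps 3) R :=
  Matrix.of fun m' m => spanSolve a (fun r => coeff r.1 (X i * monomial m.1 1)) (Sum.inl m')

noncomputable def relMatrix (i : Fin 3) (a : Fin 3 × Fin 4 × Fin 5 → R) :
    Matrix (Fin 5) (Exps 3) R :=
  Matrix.of fun k m => spanSolve a (fun r => coeff r.1 (X i * monomial m.1 1)) (Sum.inr k)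

theorem mulMatrix_spec_monomial (i : Fin 3) (a : Fin 3 × Fin 4 × Fin 5 → R) (m : Exps 3) :
    C (spanDet a) * (X i * monomial m.1 1) =
      X 0 * formOf 3 (fun m' => mulMatrix i a m' m) + ∑ k, C (relMatrix i a k m) * quartic a k := by
  have hh : (X i * monomial m.1 (1 : R)).IsHomogeneous 4 := by
    simpa using! (isHomogeneous_X R i).mul (isHomogeneous_monomial (1 : R) (m.2))
  have := spanSolve_spec a (fun r => coeff r.1 (X i * monomial m.1 1))
  rw [formOf_coeff hh] at this
  exact this

theorem formOf_mulVec {d : ℕ} {κ : Type*} [Fintype κ] (A : Matrix (Exps d) κ R) (w : κ → R) :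
    formOf d (A.mulVec w) = ∑ m, C (w m) * formOf d (fun m' => A m' m) := by
  simp only [formOf, Matrix.mulVec, dotProduct, Finset.mul_sum, C_mul_monomial]
  rw [Finset.sum_comm]
  refine Finset.sum_congr rfl fun m _ => ?_
  rw [map_sum]
  exact Finset.sum_congr rfl fun m' _ => by rw [mul_comm]

theorem mulMatrix_spec (i : Fin 3) (a : Fin 3 × Fin 4 × Fin 5 → R) (w : Exps 3 → R) :
    C (spanDet a) * (X i * formOf 3 w) =
      X 0 * formOf 3 ((mulMatrix i a).mulVec w) +
        ∑ k, C ((relMatrix i a).mulVec w k) * quartic a k := by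
  have e1 : formOf 3 w = ∑ m, C (w m) * monomial m.1 1 := by simp [formOf, C_mul_monomial]
  have e3 : ∑ k, C ((relMatrix i a).mulVec w k) * quartic a k =
      ∑ m, C (w m) * ∑ k, C (relMatrix i a k m) * quartic a k := by
    simp only [Matrix.mulVec, dotProduct, map_sum, Finset.sum_mul, Finset.mul_sum, C_mul]
    rw [Finset.sum_comm]
    exact Finset.sum_congr rfl fun m _ => Finset.sum_congr rfl fun k _ => by ring
  rw [formOf_mulVec, e3, e1, Finset.mul_sum, Finset.mul_sum, Finset.mul_sum,
    ← Finset.sum_add_distrib]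
  refine Finset.sum_congr rfl fun m _ => ?_
  rw [mul_left_comm (X i), mul_left_comm, mulMatrix_spec_monomial, mul_add, mul_left_comm]

end Ring

end Determinantal

namespace Determinantal

section Ring

variable {R : Type*} [CommRing R]

/-! ### Eigenvectors and Krylov vectors -/

theorem vecMul_pow_of_eigen {ι : Type*} [Fintype ι] [DecidableEq ι] {A : Matrix ι ι R}
    {φ : ι → R} {r : R} (h : Matrix.vecMul φ A = r • φ) (k : ℕ) :
    Matrix.vecMul φ (A ^ k) = r ^ k • φ := by
  induction k with
  | zero => simp
  | succ k ih => rw [pow_succ, ← Matrix.vecMul_vecMul, ih, Matrix.smul_vecMul, h, smul_smul, pow_succ]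

/-- Multiplication by the adjugate of r − A works over any commutative ring; it is needed over the
dual numbers. -/
theorem eval_charpoly_smul_of_eigen {ι : Type*} [Fintype ι] [DecidableEq ι] {A : Matrix ι ι R}
    {φ : ι → R} {r : R} (h : Matrix.vecMul φ A = r • φ) : A.charpoly.eval r • φ = 0 := by
  have h0 : Matrix.vecMul φ (Matrix.scalar ι r - A) = 0 := by
    rw [Matrix.vecMul_sub, h]
    simp [Matrix.scalar_apply, ← Matrix.smul_one_eq_diagonal, Matrix.vecMul_smul]
  rw [Matrix.eval_charpoly, ← Matrix.vecMul_one φ, ← Matrix.vecMul_smul, ← Matrix.mul_adjugate,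
    ← Matrix.vecMul_vecMul, h0, Matrix.zero_vecMul]

/-- The exponent of `X₀³`. -/
noncomputable def cubeExp : Exps 3 := ⟨Finsupp.single 0 3, (by simp)⟩

/-- The exponent of `X₀² X₂`. -/
noncomputable def sqExp : Exps 3 :=
  ⟨Finsupp.single 0 2 + Finsupp.single 2 1, (by simp [map_add])⟩

noncomputable def exps3Equiv : Exps 3 ≃ Fin 10 :=
  Fintype.equivOfCardEq (by rw [card_exps, Fintype.card_fin]; rfl)

/-- The vectors `Aᵏ X₀³`. -/
noncomputable def krylov (a : Fin 3 × Fin 4 × Fin 5 → R) : Matrix (Exps 3) (Fin 10) R :=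
  Matrix.of fun m k => ((mulMatrix 1 a) ^ (k : ℕ)) m cubeExp

noncomputable def krylovSq (a : Fin 3 × Fin 4 × Fin 5 → R) : Matrix (Exps 3) (Exps 3) R :=
  (krylov a).submatrix id exps3Equiv

noncomputable def krylovDet (a : Fin 3 × Fin 4 × Fin 5 → R) : R := (krylovSq a).det

/-- Cramer coefficients, scaled by `krylovDet`, of X₀²X₂ in the vectors AᵏX₀³. At a degenerate point
they express the third coordinate through the eigenvalue. -/
noncomputable def krylovSolve (a : Fin 3 × Fin 4 × Fin 5 → R) (k : Fin 10) : R :=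
  (krylovSq a).adjugate (exps3Equiv.symm k) sqExp

/-- The polynomial expressing `krylovDet` times the third coordinate in terms of the eigenvalue. -/
noncomputable def coordPoly (a : Fin 3 × Fin 4 × Fin 5 → R) : Polynomial R :=
  ∑ k : Fin 10, Polynomial.C (krylovSolve a k) * Polynomial.X ^ (k : ℕ)

theorem krylov_mulVec_krylovSolve (a : Fin 3 × Fin 4 × Fin 5 → R) (m : Exps 3) :
    ∑ k, krylov a m k * krylovSolve a k = if m = sqExp then krylovDet a else 0 := by
  have h : (krylovSq a * (krylovSq a).adjugate) m sqExp = krylovDet a • (1 : Matrix _ _ R) m sqExp := by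
    rw [Matrix.mul_adjugate]; rfl
  rw [Matrix.mul_apply] at h
  rw [← exps3Equiv.sum_comp]
  simpa [krylovSq, krylovSolve, Matrix.one_apply] using h

theorem vecMul_krylov {a : Fin 3 × Fin 4 × Fin 5 → R} {φ : Exps 3 → R} {r : R}
    (h : Matrix.vecMul φ (mulMatrix 1 a) = r • φ) (k : Fin 10) :
    ∑ m, φ m * krylov a m k = r ^ (k : ℕ) * φ cubeExp := by
  exact congrFun (vecMul_pow_of_eigen h (k : ℕ)) cubeExp

theorem eval_coordPoly_mul {a : Fin 3 × Fin 4 × Fin 5 → R} {φ : Exps 3 → R} {r : R}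
    (h : Matrix.vecMul φ (mulMatrix 1 a) = r • φ) :
    (coordPoly a).eval r * φ cubeExp = krylovDet a * φ sqExp := by
  have h1 : ∑ m, φ m * ∑ k, krylov a m k * krylovSolve a k = krylovDet a * φ sqExp := by
    simp [krylov_mulVec_krylovSolve, mul_comm]
  rw [← h1, coordPoly, Polynomial.eval_finsetSum, Finset.sum_mul]
  simp_rw [Finset.mul_sum]
  rw [Finset.sum_comm]
  refine Finset.sum_congr rfl fun k _ => ?_
  simp_rw [← mul_assoc]
  rw [← Finset.sum_mul, vecMul_krylov h]
  simp
  ring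

/-- The values at `p` of the monomials of degree `d`. -/
noncomputable def monomialVec (d : ℕ) (p : Fin 3 → R) (m : Exps d) : R := eval p (monomial m.1 1)

theorem monomialVec_eq (d : ℕ) (p : Fin 3 → R) (m : Exps d) :
    monomialVec d p m = p 0 ^ m.1 0 * p 1 ^ m.1 1 * p 2 ^ m.1 2 := by
  simp [monomialVec, eval_monomial, Finsupp.prod_fintype, Fin.prod_univ_three]

/-- Evaluating `mulMatrix_spec_monomial` at `p` kills the quartics. Common zeros thus become left
eigenvectors whose eigenvalues are their coordinates scaled by `spanDet`. -/
theorem vecMul_mulMatrix {a : Fin 3 × Fin 4 × Fin 5 → R} {p : Fin 3 → R} (h0 : p 0 = 1)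
    (h : ∀ k, rowMinor a p k = 0) (i : Fin 3) :
    Matrix.vecMul (monomialVec 3 p) (mulMatrix i a) = (spanDet a * p i) • monomialVec 3 p := by
  funext m
  have := congrArg (eval p) (mulMatrix_spec_monomial i a m)
  simp only [map_mul, eval_C, eval_X, map_add, map_sum, eval_quartic, h, mul_zero,
    Finset.sum_const_zero, add_zero, h0, one_mul, eval_formOf] at this
  simp only [Matrix.vecMul, dotProduct, Pi.smul_apply, smul_eq_mul, monomialVec]
  rw [mul_assoc, this]
  exact Finset.sum_congr rfl fun _ _ => mul_comm _ _

theorem monomialVec_cubeExp {p : Fin 3 → R} : monomialVec 3 p cubeExp = p 0 ^ 3 := by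
  simp [monomialVec_eq, cubeExp]

theorem monomialVec_sqExp {p : Fin 3 → R} : monomialVec 3 p sqExp = p 0 ^ 2 * p 2 := by
  simp [monomialVec_eq, sqExp]

theorem eval_charpoly_of_rowMinor_eq_zero {a : Fin 3 × Fin 4 × Fin 5 → R} {p : Fin 3 → R}
    (h0 : p 0 = 1) (h : ∀ k, rowMinor a p k = 0) :
    (mulMatrix 1 a).charpoly.eval (spanDet a * p 1) = 0 := by
  simpa [monomialVec_cubeExp, h0] using
    congrFun (eval_charpoly_smul_of_eigen (vecMul_mulMatrix h0 h 1)) cubeExp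

theorem eval_coordPoly_of_rowMinor_eq_zero {a : Fin 3 × Fin 4 × Fin 5 → R} {p : Fin 3 → R}
    (h0 : p 0 = 1) (h : ∀ k, rowMinor a p k = 0) :
    (coordPoly a).eval (spanDet a * p 1) = krylovDet a * p 2 := by
  simpa [monomialVec_cubeExp, monomialVec_sqExp, h0] using
    eval_coordPoly_mul (vecMul_mulMatrix h0 h 1)

/-! ### Base change -/

section Map

variable {S : Type*} [CommRing S] (f : R →+* S) (a : Fin 3 × Fin 4 × Fin 5 → R)

theorem map_spanMatrixSq : (spanMatrixSq a).map f = spanMatrixSq (fun t => f (a t)) := by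
  ext r c
  simp only [spanMatrixSq, Matrix.map_apply, Matrix.submatrix_apply, id, spanMatrix,
    Matrix.of_apply]
  cases expsEquiv.symm c with
  | inl m => simp [← coeff_map]
  | inr k => simp [← coeff_map, map_quartic]

theorem map_spanDet : f (spanDet a) = spanDet (fun t => f (a t)) := by
  rw [spanDet, RingHom.map_det, spanDet, ← map_spanMatrixSq]
  rfl

theorem map_mulMatrix (i : Fin 3) : (mulMatrix i a).map f = mulMatrix i (fun t => f (a t)) := by
  ext m' m
  simp only [mulMatrix, Matrix.map_apply, Matrix.of_apply, spanSolve, Function.comp_apply,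
    Matrix.mulVec, dotProduct, map_sum, map_mul]
  rw [← map_spanMatrixSq, ← RingHom.mapMatrix_apply, ← RingHom.map_adjugate]
  refine Finset.sum_congr rfl fun r _ => ?_
  rw [← coeff_map]
  simp

theorem map_krylovSq : (krylovSq a).map f = krylovSq (fun t => f (a t)) := by
  ext m k
  simp only [krylovSq, krylov, Matrix.map_apply, Matrix.submatrix_apply, id, Matrix.of_apply]
  rw [← map_mulMatrix, ← RingHom.mapMatrix_apply, ← map_pow]
  rfl

theorem map_krylovDet : f (krylovDet a) = krylovDet (fun t => f (a t)) := by
  rw [krylovDet, RingHom.map_det, krylovDet, ← map_krylovSq]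
  rfl

theorem map_coordPoly : (coordPoly a).map f = coordPoly (fun t => f (a t)) := by
  simp only [coordPoly, Polynomial.map_sum, Polynomial.map_mul, Polynomial.map_C,
    Polynomial.map_pow, Polynomial.map_X, krylovSolve]
  rw [← map_krylovSq, ← RingHom.mapMatrix_apply, ← RingHom.map_adjugate]
  rfl

theorem map_charpoly_mulMatrix (i : Fin 3) :
    (mulMatrix i a).charpoly.map f = (mulMatrix i (fun t => f (a t))).charpoly := by
  rw [← Matrix.charpoly_map, map_mulMatrix]

end Map

end Ring

end Determinantal

/-! ### Forms over a field with `spanDet a ≠ 0` -/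

namespace Determinantal

noncomputable def addExp {d : ℕ} (i : Fin 3) (m : Exps d) : Exps (d + 1) :=
  ⟨m.1 + Finsupp.single i 1, (by rw [map_add, m.2]; simp)⟩

theorem exists_addExp {d : ℕ} (m : Exps (d + 1)) {i : Fin 3} (hi : m.1 i ≠ 0) :
    ∃ m' : Exps d, m = addExp i m' := by
  have hle : Finsupp.single i 1 ≤ m.1 := by
    rw [Finsupp.single_le_iff]; omega
  have h1 : m.1 - Finsupp.single i 1 + Finsupp.single i 1 = m.1 := tsub_add_cancel_of_le hle
  refine ⟨⟨m.1 - Finsupp.single i 1, ?_⟩, Exps.ext' h1.symm⟩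
  have h2 := congrArg Finsupp.degree h1
  rw [map_add, m.2] at h2
  simpa using h2

theorem exists_addExp' {d : ℕ} (m : Exps (d + 1)) : ∃ i, ∃ m' : Exps d, m = addExp i m' := by
  by_contra! h
  have h0 : m.1 = 0 := by
    ext i
    by_contra hi
    obtain ⟨m', hm'⟩ := exists_addExp m (i := i) (by simpa using hi)
    exact h i m' hm'
  have := m.2
  simp [h0] at this

theorem X_mul_monomial_exps {R : Type*} [CommRing R] {d : ℕ} (i : Fin 3) (m : Exps d) (c : R) :
    X i * monomial m.1 c = monomial (addExp i m).1 c := by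
  rw [X, monomial_mul, one_mul, add_comm]; rfl

theorem monomialVec_addExp {R : Type*} [CommRing R] {d : ℕ} (i : Fin 3) (m : Exps d)
    (p : Fin 3 → R) : monomialVec (d + 1) p (addExp i m) = p i * monomialVec d p m := by
  rw [monomialVec, ← X_mul_monomial_exps, map_mul, eval_X, monomialVec]

theorem coeff_monomial_exps {R : Type*} [CommRing R] {d : ℕ} (m : Exps d) (c : R) :
    (fun r : Exps d => coeff r.1 (monomial m.1 c)) = Pi.single m c := by
  funext r
  rw [coeff_monomial, Pi.single_apply]
  simp only [Exps.ext'_iff, eq_comm]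

section Field

variable {F : Type*} [Field F] {a : Fin 3 × Fin 4 × Fin 5 → F}

theorem span_unique (ha : spanDet a ≠ 0) {w w' : Exps 3 → F} {c c' : Fin 5 → F}
    (h : X 0 * formOf 3 w + ∑ k, C (c k) * quartic a k =
      X 0 * formOf 3 w' + ∑ k, C (c' k) * quartic a k) : w = w' ∧ c = c' := by
  rw [← spanMatrix_mulVec, ← spanMatrix_mulVec] at h
  have h1 : (spanMatrix a).mulVec (Sum.elim w c) = (spanMatrix a).mulVec (Sum.elim w' c') := by
    funext m
    rw [← coeff_formOf ((spanMatrix a).mulVec (Sum.elim w c)), h, coeff_formOf]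
  have h2 : (spanMatrixSq a).mulVec (Sum.elim w c ∘ expsEquiv.symm) =
      (spanMatrixSq a).mulVec (Sum.elim w' c' ∘ expsEquiv.symm) := by
    rw [spanMatrixSq, Matrix.submatrix_mulVec_equiv, Matrix.submatrix_mulVec_equiv]
    simpa [Function.comp_assoc] using h1
  have h3 := Matrix.mulVec_injective_of_isUnit
    ((Matrix.isUnit_iff_isUnit_det _).2 (isUnit_iff_ne_zero.2 ha)) h2
  have h4 : Sum.elim w c = Sum.elim w' c' := by
    funext x
    simpa using congrFun h3 (expsEquiv x)
  exact ⟨funext fun m => congrFun h4 (Sum.inl m), funext fun m => congrFun h4 (Sum.inr m)⟩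

theorem exists_span (ha : spanDet a ≠ 0) {f : MvPolynomial (Fin 3) F} (hf : f.IsHomogeneous 4) :
    ∃ (w : Exps 3 → F) (c : Fin 5 → F), f = X 0 * formOf 3 w + ∑ k, C (c k) * quartic a k := by
  have h := spanSolve_spec a (fun m => coeff m.1 ((C (spanDet a)⁻¹) * f))
  have hh : (C (spanDet a)⁻¹ * f).IsHomogeneous 4 := by
    simpa using (isHomogeneous_C (Fin 3) (spanDet a)⁻¹).mul hf
  rw [formOf_coeff hh, ← mul_assoc, ← C_mul, mul_inv_cancel₀ ha, C_1, one_mul] at h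
  exact ⟨_, _, h⟩

theorem quartic_ne_zero (ha : spanDet a ≠ 0) (k : Fin 5) : quartic a k ≠ 0 := by
  intro h
  have := (span_unique ha (w := 0) (w' := 0) (c := Pi.single k 1) (c' := 0) (by
    simp [Pi.single_apply, ite_mul, h])).2
  simpa using congrFun this k

/-- Each Xᵢ⁴ lies in the ideal generated by X₀ and the quartics, so a common zero with X₀ = 0 is the
origin. -/
theorem X_zero_ne_zero_of_rowMinor (ha : spanDet a ≠ 0) {p : Fin 3 → F} (hp : p ≠ 0)
    (h : ∀ k, rowMinor a p k = 0) : p 0 ≠ 0 := by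
  intro h0
  apply hp
  funext i
  obtain ⟨w, c, hw⟩ := exists_span ha (f := X i ^ 4) (by
    simpa using (isHomogeneous_X F i).pow 4)
  have := congrArg (eval p) hw
  simpa [eval_quartic, h, h0] using this

/-! ### The multiplication matrices commute -/

noncomputable def formLinear (F : Type*) [Field F] (d : ℕ) :
    (Exps d → F) →ₗ[F] MvPolynomial (Fin 3) F where
  toFun := formOf d
  map_add' x y := by simp [formOf, Finset.sum_add_distrib]
  map_smul' r x := by simp [formOf, Finset.smul_sum, smul_monomial]

noncomputable def linearForm (F : Type*) [Field F] : (Fin 3 → F) →ₗ[F] MvPolynomial (Fin 3) F where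
  toFun l := ∑ i, C (l i) * X i
  map_add' x y := by simp [add_mul, Finset.sum_add_distrib]
  map_smul' r x := by simp [Finset.smul_sum, mul_assoc, smul_eq_C_mul]

/-- The map `(ℓ, w) ↦ ∑ ℓₖ Δₖ + X₀² w` from linear forms and a cubic to quintics. -/
noncomputable def quinticMap (a : Fin 3 × Fin 4 × Fin 5 → F) :
    ((Fin 5 → Fin 3 → F) × (Exps 3 → F)) →ₗ[F] MvPolynomial (Fin 3) F :=
  (∑ k, LinearMap.mulRight F (quartic a k) ∘ₗ linearForm F ∘ₗ LinearMap.proj k) ∘ₗ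
    LinearMap.fst F _ _ +
  LinearMap.mulLeft F (X 0 ^ 2) ∘ₗ formLinear F 3 ∘ₗ LinearMap.snd F _ _

theorem quinticMap_apply (l : Fin 5 → Fin 3 → F) (w : Exps 3 → F) :
    quinticMap a (l, w) =
      ∑ k, (∑ i, C (l k i) * X i) * quartic a k + X 0 ^ 2 * formOf 3 w := by
  simp only [quinticMap, LinearMap.add_apply, LinearMap.comp_apply, LinearMap.fst_apply,
    LinearMap.snd_apply, LinearMap.sum_apply, LinearMap.mulRight_apply, LinearMap.mulLeft_apply]
  rfl

/-- The four Hilbert–Burch relations, with Laplace signs and no cubic part. -/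
noncomputable def syzygyMap (a : Fin 3 × Fin 4 × Fin 5 → F) :
    (Fin 4 → F) →ₗ[F] ((Fin 5 → Fin 3 → F) × (Exps 3 → F)) where
  toFun y := (fun k i => ∑ j, y j * ((-1) ^ (k : ℕ) * a (i, j, k)), 0)
  map_add' x y := by
    ext <;> simp [add_mul, Finset.sum_add_distrib]
  map_smul' r x := by
    ext <;> simp [Finset.mul_sum, mul_assoc]

theorem formLinear_injective (d : ℕ) : Function.Injective (formLinear F d) := by
  intro v w h
  funext m
  rw [← coeff_formOf v, ← coeff_formOf w]
  exact congrArg (coeff m.1) h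

theorem quinticMap_syzygyMap (y : Fin 4 → F) : quinticMap a (syzygyMap a y) = 0 := by
  have h := fun j => sum_contractRows_mul_rowMinor
    (fun t => C (a t) : _ → MvPolynomial (Fin 3) F) X j
  have h1 : ∀ k : Fin 5, ∑ i, C (∑ j, y j * ((-1) ^ (k : ℕ) * a (i, j, k))) * X i =
      ∑ j, C (y j) * ((-1) ^ (k : ℕ) * contractRows (fun t => C (a t))
        (X : Fin 3 → MvPolynomial (Fin 3) F) j k) := by
    intro k
    simp only [contractRows, Matrix.of_apply, map_sum, Finset.sum_mul, Finset.mul_sum, map_mul,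
      map_pow, map_neg, C_1]
    rw [Finset.sum_comm]
    exact Finset.sum_congr rfl fun _ _ => Finset.sum_congr rfl fun _ _ => by ring
  refine (quinticMap_apply (fun (k : Fin 5) i => ∑ j, y j * ((-1) ^ (k : ℕ) * a (i, j, k)))
    0).trans ?_
  simp only [h1, Finset.sum_mul]
  rw [Finset.sum_comm]
  simp only [mul_assoc, ← Finset.mul_sum]
  simp only [mul_assoc] at h
  simp only [quartic, h]
  simp [formOf]

theorem syzygyMap_injective (ha : spanDet a ≠ 0) : Function.Injective (syzygyMap a) := by
  rw [injective_iff_map_eq_zero]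
  intro y hy
  by_contra hne
  apply quartic_ne_zero ha 0
  rw [quartic, rowMinor, ← Matrix.exists_vecMul_eq_zero_iff]
  refine ⟨fun j => C (y j), fun h => hne (funext fun j => C_injective (Fin 3) F (by
    simpa using congrFun h j)), ?_⟩
  funext k
  have h1 : ∀ i, ∑ j, y j * a (i, j, Fin.succAbove 0 k) = 0 := by
    intro i
    have := congrFun (congrFun (congrArg Prod.fst hy) (Fin.succAbove 0 k)) i
    simp only [syzygyMap, LinearMap.coe_mk, AddHom.coe_mk, Prod.fst_zero, Pi.zero_apply] at this
    rw [Finset.sum_congr rfl fun j _ => mul_left_comm _ _ _, ← Finset.mul_sum] at this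
    exact (mul_eq_zero.1 this).resolve_left (by simp)
  simp only [Matrix.vecMul, dotProduct, Matrix.submatrix_apply, id, contractRows, Matrix.of_apply,
    Pi.zero_apply, Finset.mul_sum]
  rw [Finset.sum_comm]
  refine Finset.sum_eq_zero fun i _ => ?_
  simp_rw [← mul_assoc, ← C_mul]
  rw [← Finset.sum_mul, ← map_sum, h1, C_0, zero_mul]

theorem isHomogeneous_X_mul_formOf (i : Fin 3) (w : Exps 3 → F) :
    (X i * formOf 3 w).IsHomogeneous 4 := by
  simpa using! (isHomogeneous_X F i).mul (isHomogeneous_formOf w)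

/-- Two reductions modulo the quartics: q becomes X₀w, and Xᵢw becomes X₀w', so Xᵢq becomes X₀²w'.
-/
theorem X_mul_mem_range_quinticMap (ha : spanDet a ≠ 0) (i : Fin 3) {q : MvPolynomial (Fin 3) F}
    (hq : q.IsHomogeneous 4) : X i * q ∈ LinearMap.range (quinticMap a) := by
  obtain ⟨w, c, h⟩ := exists_span ha hq
  obtain ⟨w', c', h'⟩ := exists_span ha (isHomogeneous_X_mul_formOf i w)
  refine ⟨(fun k => c' k • Pi.single 0 1 + c k • Pi.single i 1, w'), ?_⟩
  have hl : ∀ k, ∑ l, C ((c' k • Pi.single 0 1 + c k • Pi.single i 1 : Fin 3 → F) l) *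
      (X l : MvPolynomial (Fin 3) F) = C (c' k) * X 0 + C (c k) * X i := by
    intro k
    simp [Pi.single_apply, add_mul, Finset.sum_add_distrib, apply_ite C]
  have h1 : ∑ k, (C (c' k) * X 0 + C (c k) * X i) * quartic a k =
      X 0 * (∑ k, C (c' k) * quartic a k) + X i * ∑ k, C (c k) * quartic a k := by
    rw [Finset.mul_sum, Finset.mul_sum, ← Finset.sum_add_distrib]
    exact Finset.sum_congr rfl fun k _ => by ring
  rw [quinticMap_apply]
  simp only [hl]
  rw [h1, h, mul_add, mul_left_comm, h']
  ring

theorem range_formLinear_le (ha : spanDet a ≠ 0) :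
    LinearMap.range (formLinear F 5) ≤ LinearMap.range (quinticMap a) := by
  rintro _ ⟨v, rfl⟩
  change formOf 5 v ∈ _
  rw [formOf]
  refine Submodule.sum_mem _ fun m _ => ?_
  obtain ⟨i, m', hm⟩ := exists_addExp' m
  rw [show m.1 = (addExp i m').1 by rw [hm], ← X_mul_monomial_exps]
  exact X_mul_mem_range_quinticMap ha i (isHomogeneous_monomial _ m'.2)

/-- Dimension count: the source has dimension 15 + 10 = 25 and the image contains all 21 dimensions
of quintics, so the kernel has dimension at most 4. The four independent syzygies fill it, and their
cubic component is zero. -/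
theorem eq_zero_of_quinticMap (ha : spanDet a ≠ 0) {l : Fin 5 → Fin 3 → F} {w : Exps 3 → F}
    (h : quinticMap a (l, w) = 0) : w = 0 := by
  have hle : LinearMap.range (syzygyMap a) ≤ LinearMap.ker (quinticMap a) := by
    rintro _ ⟨y, rfl⟩
    exact quinticMap_syzygyMap y
  have h1 := LinearMap.finrank_range_of_inj (syzygyMap_injective ha)
  have h2 := LinearMap.finrank_range_of_inj (formLinear_injective (F := F) 5)
  have h3 := LinearMap.finrank_range_add_finrank_ker (quinticMap a)
  have h4 := Submodule.finrank_mono (range_formLinear_le ha)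
  have h5 : Module.finrank F ((Fin 5 → Fin 3 → F) × (Exps 3 → F)) = 25 := by
    have h3 : (3 + 2).choose 2 = 10 := rfl
    rw [Module.finrank_prod, Module.finrank_fintype_fun_eq_card F (η := Exps 3), card_exps, h3,
      Module.finrank_pi_fintype, Module.finrank_fintype_fun_eq_card]
    rfl
  rw [Module.finrank_fintype_fun_eq_card, card_exps] at h2
  rw [Module.finrank_fintype_fun_eq_card, Fintype.card_fin] at h1
  have h6 : (5 + 2).choose 2 = 21 := rfl
  have h7 := Submodule.eq_of_le_of_finrank_le hle (by omega)
  have h8 : (l, w) ∈ LinearMap.range (syzygyMap a) := by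
    rw [h7]; exact h
  obtain ⟨y, hy⟩ := h8
  exact (congrArg Prod.snd hy).symm

/-- Modulo linear multiples of the quartics, X₀² times either product applied to w equals `spanDet`²
X₁X₂w. Hence X₀² times the commutator is such a combination, and `eq_zero_of_quinticMap` applies. -/
theorem mulMatrix_comm (ha : spanDet a ≠ 0) :
    mulMatrix 1 a * mulMatrix 2 a = mulMatrix 2 a * mulMatrix 1 a := by
  refine Matrix.ext_of_mulVec_single fun m => ?_
  rw [← Matrix.mulVec_mulVec, ← Matrix.mulVec_mulVec, ← sub_eq_zero]
  generalize (Pi.single m 1 : Exps 3 → F) = w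
  refine eq_zero_of_quinticMap ha (l := fun k => ![(relMatrix 1 a).mulVec ((mulMatrix 2 a).mulVec w) k -
    (relMatrix 2 a).mulVec ((mulMatrix 1 a).mulVec w) k,
    spanDet a * (relMatrix 2 a).mulVec w k, - (spanDet a * (relMatrix 1 a).mulVec w k)]) ?_
  have h1 := mulMatrix_spec 1 a ((mulMatrix 2 a).mulVec w)
  have h2 := mulMatrix_spec 2 a ((mulMatrix 1 a).mulVec w)
  have h3 := mulMatrix_spec 2 a w
  have h4 := mulMatrix_spec 1 a w
  have hsub : formOf 3 ((mulMatrix 1 a).mulVec ((mulMatrix 2 a).mulVec w) -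
      (mulMatrix 2 a).mulVec ((mulMatrix 1 a).mulVec w)) =
      formOf 3 ((mulMatrix 1 a).mulVec ((mulMatrix 2 a).mulVec w)) -
      formOf 3 ((mulMatrix 2 a).mulVec ((mulMatrix 1 a).mulVec w)) :=
    map_sub (formLinear F 3) _ _
  have h5 : ∀ c d e f : Fin 5 → F, ∑ k, (∑ i, C ((![c k - d k, spanDet a * e k,
      -(spanDet a * f k)] : Fin 3 → F) i) * X i) * quartic a k =
      X 0 * ∑ k, C (c k) * quartic a k - X 0 * ∑ k, C (d k) * quartic a k +
      C (spanDet a) * X 1 * ∑ k, C (e k) * quartic a k -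
      C (spanDet a) * X 2 * ∑ k, C (f k) * quartic a k := by
    intro c d e f
    simp only [Finset.mul_sum, ← Finset.sum_sub_distrib, ← Finset.sum_add_distrib]
    refine Finset.sum_congr rfl fun k _ => ?_
    simp [Fin.sum_univ_three]
    ring
  rw [quinticMap_apply, h5, hsub]
  linear_combination (- X 0) * h1 + X 0 * h2 - C (spanDet a) * X 1 * h3 + C (spanDet a) * X 2 * h4

end Field

end Determinantal

namespace Determinantal

section Field

variable {F : Type*} [Field F] {a : Fin 3 × Fin 4 × Fin 5 → F}

/-! ### Roots of the characteristic polynomial give points -/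

/-- X₀³ is a cyclic vector: φ takes the value rᵏφ(X₀³) on the k-th Krylov vector, and these vectors
form a basis. Eigenspaces are therefore at most lines. -/
theorem eq_zero_of_eigen (hk : krylovDet a ≠ 0) {φ : Exps 3 → F} {r : F}
    (h : Matrix.vecMul φ (mulMatrix 1 a) = r • φ) (h0 : φ cubeExp = 0) : φ = 0 := by
  by_contra hne
  apply hk
  rw [krylovDet, ← Matrix.exists_vecMul_eq_zero_iff]
  refine ⟨φ, hne, funext fun m => ?_⟩
  have := vecMul_krylov h (exps3Equiv m)
  rw [h0, mul_zero] at this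
  exact this

theorem exists_eigen {r : F} (hr : (mulMatrix 1 a).charpoly.eval r = 0) :
    ∃ φ : Exps 3 → F, φ ≠ 0 ∧ Matrix.vecMul φ (mulMatrix 1 a) = r • φ := by
  rw [Matrix.eval_charpoly, ← Matrix.exists_vecMul_eq_zero_iff] at hr
  obtain ⟨φ, hφ, h⟩ := hr
  refine ⟨φ, hφ, ?_⟩
  rw [Matrix.vecMul_sub, sub_eq_zero] at h
  rw [← h]
  simp [Matrix.scalar_apply, ← Matrix.smul_one_eq_diagonal, Matrix.vecMul_smul]

theorem mulMatrix_addExp_zero (ha : spanDet a ≠ 0) (i : Fin 3) (g : Exps 2) :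
    (fun m' => mulMatrix i a m' (addExp 0 g)) = Pi.single (addExp i g) (spanDet a) := by
  refine (span_unique ha (c := fun k => relMatrix i a k (addExp 0 g)) (c' := 0) ?_).1
  rw [← mulMatrix_spec_monomial, formOf_single, ← X_mul_monomial_exps, ← X_mul_monomial_exps,
    show (monomial g.1 (spanDet a)) = C (spanDet a) * monomial g.1 1 by
      rw [C_mul_monomial, mul_one]]
  simp only [Pi.zero_apply, C_0, zero_mul, Finset.sum_const_zero]
  ring

theorem mulMatrix_zero (ha : spanDet a ≠ 0) (m : Exps 3) :
    (fun m' => mulMatrix 0 a m' m) = Pi.single m (spanDet a) := by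
  refine (span_unique ha (c := fun k => relMatrix 0 a k m) (c' := 0) ?_).1
  rw [← mulMatrix_spec_monomial, formOf_single,
    show (monomial m.1 (spanDet a)) = C (spanDet a) * monomial m.1 1 by
      rw [C_mul_monomial, mul_one]]
  simp only [Pi.zero_apply, C_0, zero_mul, Finset.sum_const_zero]
  ring

/-- The matrix of Xᵢ sends X₀g to `spanDet` times Xᵢg, so φ(Xᵢg) = pᵢφ(X₀g). Trading factors X₁ and
X₂ for X₀ reduces every monomial to X₀³. -/
theorem eq_monomialVec (ha : spanDet a ≠ 0) {φ : Exps 3 → F} {p : Fin 3 → F}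
    (h : ∀ i, Matrix.vecMul φ (mulMatrix i a) = (spanDet a * p i) • φ) (h1 : φ cubeExp = 1)
    (h0 : p 0 = 1) : φ = monomialVec 3 p := by
  have hs : ∀ i g, φ (addExp i g) = p i * φ (addExp 0 g) := by
    intro i g
    have h2 : ∑ m', φ m' * mulMatrix i a m' (addExp 0 g) =
      spanDet a * p i * φ (addExp 0 g) := congrFun (h i) (addExp 0 g)
    have h3 : ∀ m', mulMatrix i a m' (addExp 0 g) =
      (Pi.single (addExp i g) (spanDet a) : Exps 3 → F) m' := congrFun (mulMatrix_addExp_zero ha i g)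
    simp only [h3, Pi.single_apply, mul_ite, mul_zero, Finset.sum_ite_eq', Finset.mem_univ,
      if_true] at h2
    exact mul_left_cancel₀ ha (by rw [← mul_assoc, ← h2, mul_comm])
  suffices H : ∀ n, ∀ m : Exps 3, m.1 1 + m.1 2 = n → φ m = monomialVec 3 p m from
    funext fun m => H _ m rfl
  intro n
  induction n with
  | zero =>
    intro m hm
    have hdeg := m.2
    rw [Finsupp.degree_eq_sum, Fin.sum_univ_three] at hdeg
    have : m = cubeExp := Exps.ext' (by
      ext i; fin_cases i <;> simp [cubeExp] <;> omega)
    rw [this, h1, monomialVec_cubeExp, h0, one_pow]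
  | succ n ih =>
    intro m hm
    obtain ⟨i, hi0, hi⟩ : ∃ i, i ≠ 0 ∧ m.1 i ≠ 0 := by
      by_cases h : m.1 1 = 0
      · exact ⟨2, by decide, by omega⟩
      · exact ⟨1, by decide, h⟩
    obtain ⟨g, rfl⟩ := exists_addExp m hi
    rw [hs, monomialVec_addExp, ih (addExp 0 g), monomialVec_addExp, h0, one_mul]
    simp only [addExp, Finsupp.add_apply] at hm ⊢
    have : i = 1 ∨ i = 2 := by omega
    rcases this with rfl | rfl <;> simp at hm ⊢ <;> omega

/-- On products Xᵢm, hence on all quartics, evaluating the cubic part of `spanSolve` at `p` gives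
`spanDet` times the value at `p`. A maximal minor has zero cubic part by uniqueness. -/
theorem rowMinor_eq_zero_of_eigen (ha : spanDet a ≠ 0) {p : Fin 3 → F}
    (h : ∀ i, Matrix.vecMul (monomialVec 3 p) (mulMatrix i a) =
      (spanDet a * p i) • monomialVec 3 p) (k : Fin 5) : rowMinor a p k = 0 := by
  have key : ∀ v : Exps 4 → F,
      ∑ m', monomialVec 3 p m' * spanSolve a v (Sum.inl m') = spanDet a * eval p (formOf 4 v) := by
    have hlin : ∀ v m', spanSolve a v m' = ∑ r, (spanMatrixSq a).adjugate (expsEquiv m') r * v r :=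
      fun v m' => rfl
    have hm : ∀ r : Exps 4, ∑ m', monomialVec 3 p m' *
        (spanMatrixSq a).adjugate (expsEquiv (Sum.inl m')) r = spanDet a * monomialVec 4 p r := by
      intro r
      obtain ⟨i, m, rfl⟩ := exists_addExp' r
      have h2 : ∑ m', monomialVec 3 p m' * mulMatrix i a m' m =
        spanDet a * p i * monomialVec 3 p m := congrFun (h i) m
      rw [monomialVec_addExp, ← mul_assoc, ← h2]
      refine Finset.sum_congr rfl fun m' _ => ?_
      have h3 : ∀ r : Exps 4, coeff r.1 (monomial (addExp i m).1 (1 : F)) =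
        (Pi.single (addExp i m) 1 : Exps 4 → F) r := congrFun (coeff_monomial_exps (addExp i m) 1)
      rw [mulMatrix, Matrix.of_apply, hlin, X_mul_monomial_exps]
      simp [h3, Pi.single_apply]
    intro v
    simp only [hlin, Finset.mul_sum, eval_formOf]
    rw [Finset.sum_comm]
    refine Finset.sum_congr rfl fun r _ => ?_
    simp_rw [← mul_assoc]
    rw [← Finset.sum_mul, hm, monomialVec]
    ring
  have h1 := key (fun m => coeff m.1 (quartic a k))
  rw [formOf_coeff (isHomogeneous_quartic a k), eval_quartic] at h1
  have h2 := (span_unique ha (w := fun m => spanSolve a (fun m => coeff m.1 (quartic a k)) (Sum.inl m))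
    (w' := 0) (c := fun j => spanSolve a (fun m => coeff m.1 (quartic a k)) (Sum.inr j))
    (c' := Pi.single k (spanDet a)) (by
      rw [← spanSolve_spec, formOf_coeff (isHomogeneous_quartic a k)]
      simp [formOf, Pi.single_apply, apply_ite C, ite_mul])).1
  simp only [congrFun h2, Pi.zero_apply, mul_zero, Finset.sum_const_zero] at h1
  exact (mul_eq_zero.1 h1.symm).resolve_left ha

theorem exists_rowMinor_eq_zero_of_root (ha : spanDet a ≠ 0) (hk : krylovDet a ≠ 0) {r : F}
    (hr : (mulMatrix 1 a).charpoly.eval r = 0) :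
    ∃ p : Fin 3 → F, p 0 = 1 ∧ spanDet a * p 1 = r ∧ ∀ k, rowMinor a p k = 0 := by
  obtain ⟨ψ, hψ, hψA⟩ := exists_eigen hr
  have hc : ψ cubeExp ≠ 0 := fun h => hψ (eq_zero_of_eigen hk hψA h)
  set φ : Exps 3 → F := (ψ cubeExp)⁻¹ • ψ with hφ
  have h1 : φ cubeExp = 1 := by simp [hφ, hc]
  have hA : Matrix.vecMul φ (mulMatrix 1 a) = r • φ := by
    rw [hφ, Matrix.smul_vecMul, hψA, smul_comm]
  clear_value φ
  -- The matrices commute, so φA₂ − sφ is again an eigenvector of A₁; `s` is chosen to make it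
  -- vanish on X₀³, hence vanish altogether.
  set s := Matrix.vecMul φ (mulMatrix 2 a) cubeExp with hs
  have hB : Matrix.vecMul φ (mulMatrix 2 a) = s • φ := by
    rw [← sub_eq_zero]
    refine eq_zero_of_eigen (r := r) hk ?_ (by simp [h1, hs])
    rw [Matrix.sub_vecMul, Matrix.vecMul_vecMul, ← mulMatrix_comm ha, ← Matrix.vecMul_vecMul, hA,
      Matrix.smul_vecMul, Matrix.smul_vecMul, hA, smul_sub, smul_comm r s]
  have hp : ∀ i, Matrix.vecMul φ (mulMatrix i a) =
      (spanDet a * (![1, r / spanDet a, s / spanDet a] : Fin 3 → F) i) • φ := by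
    intro i
    fin_cases i
    · funext m
      have h3 : ∀ m', mulMatrix 0 a m' m = (Pi.single m (spanDet a) : Exps 3 → F) m' :=
        congrFun (mulMatrix_zero ha m)
      simp [Matrix.vecMul, dotProduct, h3, Pi.single_apply, mul_comm]
    · simpa [mul_div_cancel₀ _ ha] using hA
    · simpa [mul_div_cancel₀ _ ha] using hB
  have hE := eq_monomialVec ha hp h1 rfl
  refine ⟨![1, r / spanDet a, s / spanDet a], rfl, by simp [mul_div_cancel₀ _ ha],
    rowMinor_eq_zero_of_eigen ha ?_⟩
  rw [← hE]
  exact hp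

end Field

end Determinantal

/-! ### Degenerate points, their tangent vectors, and general forms -/

namespace Determinantal

theorem rowMinor_eq_zero_of_vecMul {R : Type*} [CommRing R] {a : Fin 3 × Fin 4 × Fin 5 → R}
    {s : Fin 3 → R} {y : Fin 4 → R} (h : Matrix.vecMul y (contractRows a s) = 0)
    (hy : ∃ j, IsUnit (y j)) (k : Fin 5) : rowMinor a s k = 0 := by
  obtain ⟨j, hj⟩ := hy
  have h1 : Matrix.vecMul y ((contractRows a s).submatrix id k.succAbove) = 0 :=
    funext fun l => congrFun h (k.succAbove l)
  have h2 := congrArg (fun v => Matrix.vecMul v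
    ((contractRows a s).submatrix id k.succAbove).adjugate) h1
  simp only [Matrix.vecMul_vecMul, Matrix.mul_adjugate, Matrix.zero_vecMul, Matrix.vecMul_smul,
    Matrix.vecMul_one] at h2
  have h3 := congrFun h2 j
  simp only [Pi.smul_apply, smul_eq_mul, Pi.zero_apply] at h3
  exact (hj.mul_left_eq_zero).1 h3

/-- A kernel vector of a 4×5 matrix is proportional to its signed minors. Bordering by the row e_l
gives a square matrix with the l-th signed minor as determinant and all signed minors in the first
column of its adjugate. -/
theorem mul_rowMinor_comm {R : Type*} [CommRing R] {a : Fin 3 × Fin 4 × Fin 5 → R}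
    {s : Fin 3 → R} {x : Fin 5 → R} (h : (contractRows a s).mulVec x = 0) (k l : Fin 5) :
    x l * ((-1) ^ (k : ℕ) * rowMinor a s k) = x k * ((-1) ^ (l : ℕ) * rowMinor a s l) := by
  set N : Matrix (Fin 5) (Fin 5) R :=
    Matrix.of (Fin.cons (Pi.single l 1 : Fin 5 → R) (contractRows a s)) with hN
  have hN0 : ∀ i, N 0 i = (Pi.single l 1 : Fin 5 → R) i := fun i => rfl
  have hNs : ∀ j i, N (Fin.succ j) i = contractRows a s j i := fun j i => rfl
  have hx : N.mulVec x = Pi.single 0 (x l) := by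
    funext r
    refine Fin.cases ?_ (fun j => ?_) r
    · simp [hN0, Matrix.mulVec, dotProduct, Pi.single_apply]
    · have := congrFun h j
      simpa [hNs, Matrix.mulVec, dotProduct] using this
  have h1 := congrArg N.adjugate.mulVec hx
  rw [Matrix.mulVec_mulVec, Matrix.adjugate_mul, Matrix.smul_mulVec, Matrix.one_mulVec] at h1
  have hadj : ∀ k, N.adjugate k 0 = (-1) ^ (k : ℕ) * rowMinor a s k := by
    intro k
    rw [Matrix.adjugate_fin_succ_eq_det_submatrix]
    simp only [Fin.val_zero, zero_add]
    rfl
  have hdet : N.det = (-1) ^ (l : ℕ) * rowMinor a s l := by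
    rw [Matrix.det_succ_row_zero, Finset.sum_eq_single l]
    · rw [hN0, Pi.single_eq_same, mul_one]
      rfl
    · intro b _ hb
      simp [hN0, hb]
    · simp
  have h2 := congrFun h1 k
  rw [Matrix.mulVec_single, hdet] at h2
  simp only [Pi.smul_apply, smul_eq_mul, Matrix.col_apply, MulOpposite.smul_eq_mul_unop,
    MulOpposite.unop_op, hadj] at h2
  rw [mul_comm (x k), h2, mul_comm]

section Field

variable {F : Type*} [Field F]

/-- The tangent vector `v` at `q`, as a point over the dual numbers. -/
def dualPoint {ι : Type*} (q v : ι → F) (i : ι) : DualNumber F :=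
  TrivSqZeroExt.inl (q i) + TrivSqZeroExt.inr (v i)

theorem vecMul_dual (a : Fin 3 × Fin 4 × Fin 5 → F) (q v : Fin 3 → F) (y w : Fin 4 → F)
    (h : Matrix.vecMul y (contractRows a q) = 0)
    (h' : Matrix.vecMul y (contractRows a v) + Matrix.vecMul w (contractRows a q) = 0) :
    Matrix.vecMul (dualPoint y w)
      (contractRows (fun t => TrivSqZeroExt.inlHom F F (a t)) (dualPoint q v)) = 0 := by
  funext k
  have h1 := congrFun h k
  have h2 := congrFun h' k
  simp only [Matrix.vecMul, dotProduct, contractRows, Matrix.of_apply, Pi.zero_apply,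
    Pi.add_apply] at h1 h2
  simp only [Matrix.vecMul, dotProduct, contractRows, Matrix.of_apply, Pi.zero_apply, dualPoint,
    TrivSqZeroExt.inlHom_apply]
  ext
  · simpa only [TrivSqZeroExt.fst_sum, TrivSqZeroExt.fst_mul, TrivSqZeroExt.fst_add,
      TrivSqZeroExt.fst_inl, TrivSqZeroExt.fst_inr, add_zero, TrivSqZeroExt.fst_zero] using h1
  · simp only [TrivSqZeroExt.snd_sum, TrivSqZeroExt.snd_mul, TrivSqZeroExt.fst_sum,
      TrivSqZeroExt.fst_add, TrivSqZeroExt.snd_add, TrivSqZeroExt.fst_inl, TrivSqZeroExt.fst_inr,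
      TrivSqZeroExt.snd_inl, TrivSqZeroExt.snd_inr, TrivSqZeroExt.fst_mul, add_zero, zero_add,
      smul_eq_mul, MulOpposite.smul_eq_mul_unop, MulOpposite.unop_op, zero_mul,
      Finset.sum_add_distrib, TrivSqZeroExt.snd_zero]
    rw [← h2]

/-- The ten points of the degeneracy locus of a general trilinear form. -/
structure IsGeneral (a : Fin 3 × Fin 4 × Fin 5 → F) (p : Fin 10 → Fin 3 → F) : Prop where
  coord_zero_ne_zero : ∀ q : Fin 3 → F, q ≠ 0 → (∀ k, rowMinor a q k = 0) → q 0 ≠ 0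
  normalized : ∀ i, p i 0 = 1
  injective : Function.Injective p
  rowMinor_eq_zero : ∀ i k, rowMinor a (p i) k = 0
  complete : ∀ q : Fin 3 → F, q 0 = 1 → (∀ k, rowMinor a q k = 0) → ∃ i, q = p i
  -- The degeneracy scheme has no nonzero tangent vector in the chart X₀ = 1.
  reduced : ∀ q v : Fin 3 → F, q 0 = 1 → v 0 = 0 →
    (∀ k, rowMinor (fun t => TrivSqZeroExt.inlHom F F (a t)) (dualPoint q v) k = 0) → v = 0
  -- Degrees 1, 2, 3 suffice: a quartic condition would already involve 15 points.
  position : ∀ d : ℕ, 1 ≤ d → d ≤ 3 → ∀ e : Exps d ↪ Fin 10,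
    (Matrix.of fun m m' => monomialVec d (p (e m)) m').det ≠ 0

variable {a : Fin 3 × Fin 4 × Fin 5 → F}

/-- The eigenvalue relations hold over the dual numbers. Because the roots are distinct, only one
factor of the characteristic polynomial is a nonunit at `spanDet` (q₁ + εv₁). That factor must
vanish, giving v₁ = 0, and `coordPoly` then gives v₂ = 0. -/
theorem tangent_eq_zero (ha : spanDet a ≠ 0) (hk : krylovDet a ≠ 0) {t : Fin 10 → F}
    (ht : Function.Injective t)
    (hχ : (mulMatrix 1 a).charpoly = ∏ i, (Polynomial.X - Polynomial.C (t i)))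
    {q v : Fin 3 → F} (hq : q 0 = 1) (hv : v 0 = 0)
    (h : ∀ k, rowMinor (fun t => TrivSqZeroExt.inlHom F F (a t)) (dualPoint q v) k = 0) :
    v = 0 := by
  have h0 : dualPoint q v 0 = 1 := by simp [dualPoint, hq, hv]
  have h1 := eval_charpoly_of_rowMinor_eq_zero h0 h
  rw [← map_charpoly_mulMatrix, hχ, ← map_spanDet] at h1
  simp only [Polynomial.map_prod, Polynomial.map_sub, Polynomial.map_X, Polynomial.map_C,
    Polynomial.eval_prod, Polynomial.eval_sub, Polynomial.eval_X, Polynomial.eval_C,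
    TrivSqZeroExt.inlHom_apply] at h1
  have h2 := congrArg TrivSqZeroExt.fst h1
  have hfst : ∀ x : Fin 10 → DualNumber F, (∏ i, x i).fst = ∏ i, (x i).fst := fun x =>
    map_prod (TrivSqZeroExt.fstHom F F F) x Finset.univ
  rw [hfst] at h2
  simp only [TrivSqZeroExt.fst_zero] at h2
  obtain ⟨j, -, hj⟩ := Finset.prod_eq_zero_iff.1 h2
  rw [← Finset.mul_prod_erase _ _ (Finset.mem_univ j)] at h1
  have hu : IsUnit (∏ i ∈ Finset.univ.erase j, (TrivSqZeroExt.inl (spanDet a) * dualPoint q v 1 -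
      TrivSqZeroExt.inl (t i) : DualNumber F)) := by
    rw [IsUnit.prod_iff]
    intro i hi
    rw [TrivSqZeroExt.isUnit_iff_isUnit_fst, isUnit_iff_ne_zero]
    intro hi0
    simp only [TrivSqZeroExt.fst_sub, TrivSqZeroExt.fst_inl] at hi0 hj
    exact (Finset.mem_erase.1 hi).1 (ht ((sub_eq_zero.1 hi0).symm.trans (sub_eq_zero.1 hj)))
  have h3 := (hu.mul_left_eq_zero).1 h1
  have h4 : v 1 = 0 := by
    have := congrArg TrivSqZeroExt.snd h3
    simpa [dualPoint, ha] using this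
  have h5 := eval_coordPoly_of_rowMinor_eq_zero h0 h
  rw [← map_coordPoly, ← map_spanDet, ← map_krylovDet] at h5
  have h6 : TrivSqZeroExt.inlHom F F (spanDet a) * dualPoint q v 1 =
      TrivSqZeroExt.inlHom F F (spanDet a * q 1) := by
    simp [dualPoint, h4]
  rw [h6, Polynomial.eval_map_apply] at h5
  have h7 : v 2 = 0 := by
    have := congrArg TrivSqZeroExt.snd h5
    simpa [dualPoint, hk] using this
  funext i
  fin_cases i <;> simp [hv, h4, h7]

namespace IsGeneral

variable {p : Fin 10 → Fin 3 → F}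

theorem eq_zero_of_vanishing (hp : IsGeneral a p) {d : ℕ} (hd : 1 ≤ d) (hd' : d ≤ 3)
    (e : Exps d ↪ Fin 10) {f : MvPolynomial (Fin 3) F} (hf : f.IsHomogeneous d)
    (h : ∀ m, eval (p (e m)) f = 0) : f = 0 := by
  have h1 : (Matrix.of fun m m' => monomialVec d (p (e m)) m').mulVec
      (fun m => coeff m.1 f) = 0 := by
    funext m
    have := h m
    rw [← formOf_coeff hf, eval_formOf] at this
    simp only [Matrix.mulVec, dotProduct, Matrix.of_apply, Pi.zero_apply]
    rw [← this]
    exact Finset.sum_congr rfl fun _ _ => mul_comm _ _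
  have h2 := Matrix.eq_zero_of_mulVec_eq_zero (hp.position d hd hd' e) h1
  rw [← formOf_coeff hf, h2]
  simp [formOf]

end IsGeneral

end Field

end Determinantal

/-! ### Nondegeneracy of general trilinear forms -/

namespace Determinantal

section Field

variable {F : Type*} [Field F] {a : Fin 3 × Fin 4 × Fin 5 → F}

theorem contractRows_add (s s' : Fin 3 → F) :
    contractRows a (s + s') = contractRows a s + contractRows a s' := by
  ext j k
  simp [contractRows, mul_add, Finset.sum_add_distrib]

theorem contractRows_smul (c : F) (s : Fin 3 → F) :
    contractRows a (c • s) = c • contractRows a s := by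
  ext j k
  simp [contractRows, Finset.mul_sum, mul_left_comm]

theorem rowMinor_smul (c : F) (s : Fin 3 → F) (k : Fin 5) :
    rowMinor a (c • s) k = c ^ 4 * rowMinor a s k := by
  rw [rowMinor, contractRows_smul, rowMinor, Matrix.submatrix_smul, Pi.smul_apply, Pi.smul_apply,
    Matrix.det_smul, Fintype.card_fin]

theorem contractRows_dual (q v : Fin 3 → F) (j : Fin 4) (k : Fin 5) :
    contractRows (fun t => TrivSqZeroExt.inlHom F F (a t)) (dualPoint q v) j k =
      TrivSqZeroExt.inl (contractRows a q j k) + TrivSqZeroExt.inr (contractRows a v j k) := by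
  have : contractRows (fun t => TrivSqZeroExt.inlHom F F (a t)) (dualPoint q v) j k =
      ∑ i, TrivSqZeroExt.inl (a (i, j, k)) *
        (TrivSqZeroExt.inl (q i) + TrivSqZeroExt.inr (v i)) := rfl
  rw [this]
  ext
  · simp only [TrivSqZeroExt.fst_sum, TrivSqZeroExt.fst_mul, TrivSqZeroExt.fst_add,
      TrivSqZeroExt.fst_inl, TrivSqZeroExt.fst_inr, add_zero]
    rfl
  · simp only [TrivSqZeroExt.snd_sum, TrivSqZeroExt.snd_mul,
      TrivSqZeroExt.fst_add, TrivSqZeroExt.snd_add, TrivSqZeroExt.fst_inl, TrivSqZeroExt.fst_inr,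
      TrivSqZeroExt.snd_inl, TrivSqZeroExt.snd_inr, add_zero, zero_add,
      smul_eq_mul, MulOpposite.smul_eq_mul_unop, MulOpposite.unop_op, zero_mul]
    rfl

/-- A two-dimensional left kernel contains a nonzero vector with zero j-th entry, which still kills
the matrix after row j has been replaced. -/
theorem adjugate_eq_zero_of_vecMul {n : ℕ} {D : Matrix (Fin n) (Fin n) F} {y w : Fin n → F}
    (hy : Matrix.vecMul y D = 0) (hw : Matrix.vecMul w D = 0) (hli : LinearIndependent F ![y, w]) :
    D.adjugate = 0 := by
  ext i j
  rw [Matrix.adjugate_apply, Matrix.zero_apply, ← Matrix.exists_vecMul_eq_zero_iff]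
  obtain ⟨z, hz0, hzj, hzD⟩ : ∃ z : Fin n → F, z ≠ 0 ∧ z j = 0 ∧ Matrix.vecMul z D = 0 := by
    rw [LinearIndependent.pair_iff] at hli
    by_cases h : y j = 0
    · exact ⟨y, fun h0 => one_ne_zero (hli 1 0 (by simp [h0])).1, h, hy⟩
    · refine ⟨w j • y + (- y j) • w, fun h0 => h (by simpa using (hli _ _ h0).2), ?_, ?_⟩
      · simp [mul_comm]
      · rw [Matrix.add_vecMul, Matrix.smul_vecMul, Matrix.smul_vecMul, hy, hw]
        simp
  refine ⟨z, hz0, ?_⟩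
  rw [← hzD]
  funext k
  simp only [Matrix.vecMul, dotProduct]
  refine Finset.sum_congr rfl fun l _ => ?_
  by_cases hl : l = j
  · simp [hl, hzj]
  · rw [Matrix.updateRow_ne hl]

/-- At corank two the minors vanish to second order: yD and adj D both have zero constant part, so
their product, yⱼ det D in one entry, vanishes since ε² = 0. -/
theorem rowMinor_dual_eq_zero_of_corank {q : Fin 3 → F} {y w : Fin 4 → F}
    (hy : Matrix.vecMul y (contractRows a q) = 0) (hw : Matrix.vecMul w (contractRows a q) = 0)
    (hli : LinearIndependent F ![y, w]) (v : Fin 3 → F) (k : Fin 5) :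
    rowMinor (fun t => TrivSqZeroExt.inlHom F F (a t)) (dualPoint q v) k = 0 := by
  set D := (contractRows (fun t => TrivSqZeroExt.inlHom F F (a t)) (dualPoint q v)).submatrix id
    k.succAbove with hD
  set D0 := (contractRows a q).submatrix id k.succAbove with hD0
  have hfst : D.map (TrivSqZeroExt.fstHom F F F) = D0 := by
    ext i j
    simp [hD, hD0, contractRows, dualPoint]
  have hy0 : Matrix.vecMul y D0 = 0 := funext fun l => congrFun hy (k.succAbove l)
  have hw0 : Matrix.vecMul w D0 = 0 := funext fun l => congrFun hw (k.succAbove l)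
  have hadj : D0.adjugate = 0 := adjugate_eq_zero_of_vecMul hy0 hw0 hli
  have hadjD : ∀ i j, (D.adjugate i j).fst = 0 := by
    intro i j
    have h := RingHom.map_adjugate (TrivSqZeroExt.fstHom F F F : DualNumber F →+* F) D
    rw [RingHom.mapMatrix_apply, RingHom.mapMatrix_apply] at h
    have h1 := congrFun (congrFun h i) j
    have h2 : D.map (TrivSqZeroExt.fstHom F F F : DualNumber F →+* F) = D0 := hfst
    rw [h2, hadj] at h1
    exact h1
  obtain ⟨j, hj⟩ : ∃ j, y j ≠ 0 := by
    by_contra! h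
    have h0 : y = 0 := funext h
    rw [LinearIndependent.pair_iff] at hli
    exact one_ne_zero (hli 1 0 (by simp [h0])).1
  have hyD : ∀ l, (Matrix.vecMul (fun i => (TrivSqZeroExt.inl (y i) : DualNumber F)) D l).fst = 0 := by
    intro l
    have h3 : ∑ i, y i * (D i l).fst = 0 := by
      have := congrFun hy0 l
      rw [← hfst] at this
      exact this
    simpa only [Matrix.vecMul, dotProduct, TrivSqZeroExt.fst_sum, TrivSqZeroExt.fst_mul,
      TrivSqZeroExt.fst_inl] using h3
  have h4 : (TrivSqZeroExt.inl (y j) : DualNumber F) * D.det =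
      ∑ l, Matrix.vecMul (fun i => (TrivSqZeroExt.inl (y i) : DualNumber F)) D l *
        D.adjugate l j := by
    have h5 : Matrix.vecMul (Matrix.vecMul (fun i => (TrivSqZeroExt.inl (y i) : DualNumber F)) D)
      D.adjugate j = (D.det • fun i => (TrivSqZeroExt.inl (y i) : DualNumber F)) j := by
      rw [Matrix.vecMul_vecMul, Matrix.mul_adjugate, Matrix.vecMul_smul, Matrix.vecMul_one]
    rw [mul_comm]
    exact h5.symm
  have h6 : ∀ x z : DualNumber F, x.fst = 0 → z.fst = 0 → x * z = 0 := by
    intro x z hx hz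
    ext <;> simp [hx, hz]
  rw [Finset.sum_eq_zero fun l _ => h6 _ _ (hyD l) (hadjD l j)] at h4
  refine (IsUnit.mul_right_eq_zero ?_).1 h4
  rw [TrivSqZeroExt.isUnit_iff_isUnit_fst]
  simpa using hj

namespace IsGeneral

variable {p : Fin 10 → Fin 3 → F}

theorem eq_smul (hp : IsGeneral a p) {q : Fin 3 → F} (hq : q ≠ 0)
    (h : ∀ k, rowMinor a q k = 0) : ∃ i, q = q 0 • p i := by
  have h0 := hp.coord_zero_ne_zero q hq h
  obtain ⟨i, hi⟩ := hp.complete ((q 0)⁻¹ • q) (by simp [h0]) fun k => by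
    rw [rowMinor_smul, h, mul_zero]
  exact ⟨i, by rw [← hi, smul_smul, mul_inv_cancel₀ h0, one_smul]⟩

/-- A general trilinear form is nondegenerate. -/
theorem nondegenerate (hp : IsGeneral a p) {s : Fin 3 → F} {y : Fin 4 → F} {x : Fin 5 → F}
    (hs : s ≠ 0) (hy : y ≠ 0) (hx : x ≠ 0) (h1 : Matrix.vecMul y (contractRows a s) = 0)
    (h2 : (contractRows a s).mulVec x = 0)
    (h3 : ∀ v, y ⬝ᵥ (contractRows a v).mulVec x = 0) : False := by
  obtain ⟨j0, hj0⟩ : ∃ j, y j ≠ 0 := Function.ne_iff.1 hy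
  have hs0 := hp.coord_zero_ne_zero s hs
    (rowMinor_eq_zero_of_vecMul h1 ⟨j0, isUnit_iff_ne_zero.2 hj0⟩)
  wlog hn : s 0 = 1 generalizing s
  · refine this (s := (s 0)⁻¹ • s) (by simp [hs, hs0]) ?_ ?_ (by simp [hs0]) (by simp [hs0])
    · rw [contractRows_smul, Matrix.vecMul_smul, h1, smul_zero]
    · rw [contractRows_smul, Matrix.smul_mulVec, h2, smul_zero]
  -- Θ(v,w) is the ε-part of (y + εw)ᵀN(s + εv), with v tangent to the chart s₀ = 1. A critical
  -- point forces its image into the hyperplane orthogonal to x.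
  let Θ : ((Fin 2 → F) × (Fin 4 → F)) →ₗ[F] (Fin 5 → F) :=
    { toFun := fun u => Matrix.vecMul y (contractRows a ![0, u.1 0, u.1 1]) +
        Matrix.vecMul u.2 (contractRows a s)
      map_add' := by
        intro u u'
        have : (![0, (u + u').1 0, (u + u').1 1] : Fin 3 → F) =
            ![0, u.1 0, u.1 1] + ![0, u'.1 0, u'.1 1] := by
          funext i; fin_cases i <;> simp
        rw [this, contractRows_add, Matrix.vecMul_add, Prod.snd_add, Matrix.add_vecMul]
        abel
      map_smul' := by
        intro c u
        have : (![0, (c • u).1 0, (c • u).1 1] : Fin 3 → F) = c • ![0, u.1 0, u.1 1] := by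
          funext i; fin_cases i <;> simp
        rw [this, contractRows_smul, Matrix.vecMul_smul, Prod.smul_snd, Matrix.smul_vecMul,
          RingHom.id_apply, smul_add] }
  have hΘ : ∀ u, Θ u = Matrix.vecMul y (contractRows a ![0, u.1 0, u.1 1]) +
    Matrix.vecMul u.2 (contractRows a s) := fun u => rfl
  have hlt : LinearMap.range Θ ≠ ⊤ := by
    intro htop
    obtain ⟨k, hk⟩ : ∃ k, x k ≠ 0 := Function.ne_iff.1 hx
    obtain ⟨u, hu⟩ : (Pi.single k 1 : Fin 5 → F) ∈ LinearMap.range Θ := htop ▸ trivial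
    have h5 : Θ u ⬝ᵥ x = 0 := by
      rw [hΘ, add_dotProduct, ← Matrix.dotProduct_mulVec, ← Matrix.dotProduct_mulVec, h3, h2]
      simp
    rw [hu] at h5
    exact hk (by simpa using h5)
  have hr : Module.finrank F (LinearMap.range Θ) < 5 := by
    have := Submodule.finrank_lt (lt_top_iff_ne_top.2 hlt).ne
    simpa using this
  have hk := LinearMap.finrank_range_add_finrank_ker Θ
  have hdim : Module.finrank F ((Fin 2 → F) × (Fin 4 → F)) = 6 := by simp
  -- The rank is at most 4 on a six-dimensional space, so the kernel is larger than the line through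
  -- (0,y). A further kernel vector gives a tangent vector if v ≠ 0, and corank two if v = 0.
  obtain ⟨u, hu, hns⟩ : ∃ u ∈ LinearMap.ker Θ, u ∉ Submodule.span F {((0 : Fin 2 → F), y)} := by
    by_contra! h
    have h6 := Submodule.finrank_mono (show LinearMap.ker Θ ≤ _ from h)
    have h7 := finrank_span_singleton (K := F) (v := ((0 : Fin 2 → F), y)) (by simpa using hy)
    omega
  rw [LinearMap.mem_ker, hΘ] at hu
  by_cases hv : u.1 = 0
  · have hw : Matrix.vecMul u.2 (contractRows a s) = 0 := by
      have h8 : contractRows a (![0, u.1 0, u.1 1] : Fin 3 → F) = 0 := by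
        ext j k; simp [contractRows, hv, Fin.sum_univ_three]
      simpa [h8] using hu
    have hli : LinearIndependent F ![y, u.2] := by
      rw [LinearIndependent.pair_iff' hy]
      intro c hc
      exact hns (Submodule.mem_span_singleton.2 ⟨c, by ext <;> simp [hv, ← hc]⟩)
    have := hp.reduced s ![0, 1, 0] hn rfl (rowMinor_dual_eq_zero_of_corank h1 hw hli _)
    exact one_ne_zero (congrFun this 1)
  · have := hp.reduced s ![0, u.1 0, u.1 1] hn rfl (rowMinor_eq_zero_of_vecMul
      (vecMul_dual a s _ y u.2 h1 hu) ⟨j0, by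
        rw [TrivSqZeroExt.isUnit_iff_isUnit_fst]; simpa [dualPoint] using hj0⟩)
    refine hv (funext fun i => ?_)
    fin_cases i
    · exact congrFun this 1
    · exact congrFun this 2

/-- With a kernel vector having a unit l-th entry, all minors are multiples of the l-th one.
Degeneracy becomes a single equation. -/
theorem rowMinor_eq_zero_of_mulVec {R : Type*} [CommRing R] {b : Fin 3 × Fin 4 × Fin 5 → R}
    {s : Fin 3 → R} {x : Fin 5 → R} (h : (contractRows b s).mulVec x = 0) {l : Fin 5}
    (hl : IsUnit (x l)) (h0 : rowMinor b s l = 0) (k : Fin 5) : rowMinor b s k = 0 := by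
  have := mul_rowMinor_comm h k l
  rw [h0, mul_zero, mul_zero] at this
  have h2 := (hl.mul_right_eq_zero).1 this
  exact (IsUnit.mul_right_eq_zero (IsUnit.pow _ (isUnit_one.neg))).1 h2

/-- The minor of `contractRows` along the line through `s` and `s'`. -/
noncomputable def lineMinor (a : Fin 3 × Fin 4 × Fin 5 → F) (s s' : Fin 3 → F) (l : Fin 5) :
    Polynomial F :=
  ((Polynomial.X : Polynomial F) • ((contractRows a s').submatrix id l.succAbove).map Polynomial.C +
    ((contractRows a s).submatrix id l.succAbove).map Polynomial.C).det

theorem eval_lineMinor (s s' : Fin 3 → F) (l : Fin 5) (z : F) :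
    (lineMinor a s s' l).eval z = rowMinor a (s + z • s') l := by
  rw [lineMinor, ← Polynomial.coe_evalRingHom, RingHom.map_det, rowMinor, contractRows_add,
    contractRows_smul]
  congr 1
  ext i j
  simp
  ring

theorem natDegree_lineMinor {s s' : Fin 3 → F} {l : Fin 5} (h : rowMinor a s' l ≠ 0) :
    (lineMinor a s s' l).natDegree = 4 := by
  refine le_antisymm (Polynomial.natDegree_det_X_add_C_le _ _)
    (Polynomial.le_natDegree_of_ne_zero ?_)
  have := Polynomial.coeff_det_X_add_C_card ((contractRows a s').submatrix id l.succAbove)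
    ((contractRows a s).submatrix id l.succAbove)
  rw [Fintype.card_fin] at this
  rw [lineMinor, this]
  exact h

/-- Otherwise the whole line lies in X₀ = 0, and a root of its quartic minor is a degenerate point
there. -/
theorem coord_zero_ne_zero_of_line [IsAlgClosed F] (hp : IsGeneral a p) {s s' : Fin 3 → F}
    {x : Fin 5 → F} (hx : x ≠ 0) (hli : LinearIndependent F ![s', s]) (hs'0 : s' 0 = 0)
    (h : (contractRows a s).mulVec x = 0) (h' : (contractRows a s').mulVec x = 0) : s 0 ≠ 0 := by
  obtain ⟨l, hl⟩ : ∃ k, x k ≠ 0 := Function.ne_iff.1 hx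
  have hs' : s' ≠ 0 := hli.ne_zero 0
  have hdeg := natDegree_lineMinor (a := a) (s := s) (s' := s') (l := l) fun h0 =>
    hp.coord_zero_ne_zero s' hs' (rowMinor_eq_zero_of_mulVec h' (isUnit_iff_ne_zero.2 hl) h0) hs'0
  obtain ⟨z, hz⟩ := IsAlgClosed.exists_root (lineMinor a s s' l) (fun h0 => by
    have := Polynomial.natDegree_eq_zero_iff_degree_le_zero.2 h0.le
    omega)
  rw [Polynomial.IsRoot, eval_lineMinor] at hz
  have hne : s + z • s' ≠ 0 := by
    intro h0
    rw [LinearIndependent.pair_iff] at hli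
    exact one_ne_zero (hli z 1 (by rw [one_smul, add_comm, h0])).2
  have hN : (contractRows a (s + z • s')).mulVec x = 0 := by
    rw [contractRows_add, contractRows_smul, Matrix.add_mulVec, Matrix.smul_mulVec, h, h']
    simp
  have := hp.coord_zero_ne_zero _ hne
    (rowMinor_eq_zero_of_mulVec hN (isUnit_iff_ne_zero.2 hl) hz)
  simpa [hs'0] using this

/-- For a general trilinear form, no contraction with `x ≠ 0` vanishes on a line. -/
theorem not_mulVec_eq_zero_of_normalized [IsAlgClosed F] (hp : IsGeneral a p) {s s' : Fin 3 → F}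
    {x : Fin 5 → F} (hx : x ≠ 0) (hs : s 0 = 1) (hs' : s' ≠ 0) (hs'0 : s' 0 = 0)
    (h : (contractRows a s).mulVec x = 0) (h' : (contractRows a s').mulVec x = 0) : False := by
  classical
  obtain ⟨l, hl⟩ : ∃ k, x k ≠ 0 := Function.ne_iff.1 hx
  -- Along the line all minors are controlled by this one quartic polynomial. Its leading
  -- coefficient is the minor at s', nonzero because s'₀ = 0. Its four roots, simple by reducedness,
  -- are four collinear points of Σ.
  set D := lineMinor a s s' l with hD
  have hdeg : D.natDegree = 4 := natDegree_lineMinor fun h0 =>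
    hp.coord_zero_ne_zero s' hs' (rowMinor_eq_zero_of_mulVec h' (isUnit_iff_ne_zero.2 hl) h0) hs'0
  have hD0 : D ≠ 0 := fun h0 => by simp [h0] at hdeg
  have heval : ∀ z : F, D.eval z = rowMinor a (s + z • s') l := eval_lineMinor s s' l
  have hN : ∀ z : F, (contractRows a (s + z • s')).mulVec x = 0 := by
    intro z
    rw [contractRows_add, contractRows_smul, Matrix.add_mulVec, Matrix.smul_mulVec, h, h']
    simp
  have hdual : ∀ z : F, D.eval₂ (TrivSqZeroExt.inlHom F F)
      (TrivSqZeroExt.inl z + TrivSqZeroExt.inr 1) =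
      rowMinor (fun t => TrivSqZeroExt.inlHom F F (a t)) (dualPoint (s + z • s') s') l := by
    intro z
    rw [hD, lineMinor, ← Polynomial.coe_eval₂RingHom, RingHom.map_det, rowMinor]
    congr 1
    refine Matrix.ext fun i j => ?_
    rw [Matrix.submatrix_apply, contractRows_dual, contractRows_add, contractRows_smul]
    simp only [RingHom.mapMatrix_apply, Matrix.map_apply, Matrix.add_apply, Matrix.smul_apply,
      smul_eq_mul, Polynomial.coe_eval₂RingHom, Polynomial.eval₂_add, Polynomial.eval₂_mul,
      Polynomial.eval₂_X, Polynomial.eval₂_C, Matrix.submatrix_apply, id,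
      TrivSqZeroExt.inlHom_apply]
    ext
    · simp only [TrivSqZeroExt.fst_add, TrivSqZeroExt.fst_mul, TrivSqZeroExt.fst_inl,
        TrivSqZeroExt.fst_inr, add_zero]
      ring
    · simp only [TrivSqZeroExt.snd_add, TrivSqZeroExt.snd_mul, TrivSqZeroExt.fst_inl,
        TrivSqZeroExt.fst_inr, TrivSqZeroExt.snd_inl, TrivSqZeroExt.snd_inr,
        TrivSqZeroExt.fst_add, add_zero, zero_add, smul_eq_mul, mul_zero,
        MulOpposite.smul_eq_mul_unop, MulOpposite.unop_op, one_mul]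
  have hNdual : ∀ z : F, (contractRows (fun t => TrivSqZeroExt.inlHom F F (a t))
      (dualPoint (s + z • s') s')).mulVec (fun k => TrivSqZeroExt.inlHom F F (x k)) = 0 := by
    intro z
    funext j
    have h1 := congrFun (hN z) j
    have h2 := congrFun h' j
    simp only [Matrix.mulVec, dotProduct, contractRows, Matrix.of_apply, Pi.zero_apply] at h1 h2
    simp only [Matrix.mulVec, dotProduct, contractRows, Matrix.of_apply, Pi.zero_apply, dualPoint,
      TrivSqZeroExt.inlHom_apply]
    ext
    · simpa only [TrivSqZeroExt.fst_sum, TrivSqZeroExt.fst_mul, TrivSqZeroExt.fst_add,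
        TrivSqZeroExt.fst_inl, TrivSqZeroExt.fst_inr, add_zero, TrivSqZeroExt.fst_zero] using h1
    · simp only [TrivSqZeroExt.snd_sum, TrivSqZeroExt.snd_mul, TrivSqZeroExt.fst_sum,
        TrivSqZeroExt.fst_add, TrivSqZeroExt.snd_add, TrivSqZeroExt.fst_inl, TrivSqZeroExt.fst_inr,
        TrivSqZeroExt.snd_inl, TrivSqZeroExt.snd_inr, TrivSqZeroExt.fst_mul, add_zero, zero_add,
        smul_eq_mul, MulOpposite.smul_eq_mul_unop, MulOpposite.unop_op, zero_mul, mul_zero,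
        TrivSqZeroExt.snd_zero]
      exact h2
  -- A double root would make s' a tangent vector of the degeneracy scheme.
  have hroot : ∀ z, D.eval z = 0 → D.derivative.eval z ≠ 0 := by
    intro z hz hz'
    have h1 := Polynomial.aeval_add_of_sq_eq_zero (S := DualNumber F) D (TrivSqZeroExt.inl z)
      (TrivSqZeroExt.inr 1) (by rw [pow_two, TrivSqZeroExt.inr_mul_inr])
    have h2 : ∀ E : Polynomial F, Polynomial.aeval (TrivSqZeroExt.inl z : DualNumber F) E =
        TrivSqZeroExt.inl (E.eval z) := fun E =>
      Polynomial.aeval_algebraMap_apply_eq_algebraMap_eval z E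
    rw [h2, h2, hz, hz', TrivSqZeroExt.inl_zero, zero_mul, add_zero] at h1
    have h3 : D.eval₂ (TrivSqZeroExt.inlHom F F)
      (TrivSqZeroExt.inl z + TrivSqZeroExt.inr 1) = 0 := h1
    rw [hdual] at h3
    refine hs' (hp.reduced (s + z • s') s' (by simp [hs, hs'0]) hs'0
      (rowMinor_eq_zero_of_mulVec (hNdual z) (l := l) ?_ h3))
    rw [TrivSqZeroExt.isUnit_iff_isUnit_fst]
    simpa using hl
  have hcard : D.roots.toFinset.card = 4 := by
    rw [Multiset.toFinset_card_of_nodup, ← hdeg]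
    · exact (IsAlgClosed.splits D).natDegree_eq_card_roots.symm
    · rw [Multiset.nodup_iff_count_le_one]
      intro z
      rw [Polynomial.count_roots]
      by_contra! hz
      obtain ⟨h1, h2⟩ := (Polynomial.one_lt_rootMultiplicity_iff_isRoot hD0).1 hz
      exact hroot z h1 h2
  have hpt : ∀ z : F, z ∈ D.roots.toFinset → ∃ i, s + z • s' = p i := by
    intro z hz
    refine hp.complete _ (by simp [hs, hs'0]) (rowMinor_eq_zero_of_mulVec (hN z)
      (isUnit_iff_ne_zero.2 hl) ?_)
    rw [← heval]
    simpa [hD0] using hz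
  choose! i hi using hpt

  obtain ⟨e⟩ : Nonempty (Exps 1 ↪ D.roots.toFinset) :=
    Function.Embedding.nonempty_of_card_le (by
      rw [card_exps, Fintype.card_coe, hcard]; decide)
  have hinj : Function.Injective fun z : D.roots.toFinset => i z.1 := by
    intro z z' hzz
    have h1 : s + z.1 • s' = s + z'.1 • s' := by rw [hi _ z.2, hi _ z'.2]; exact congrArg p hzz
    exact Subtype.ext (smul_left_injective F hs' (add_left_cancel h1))
  -- The coefficients are the cross product s × s', which is the equation of the line.
  have hf := hp.eq_zero_of_vanishing le_rfl (by norm_num) (e.trans ⟨_, hinj⟩)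
    (f := linearForm F ![s 1 * s' 2 - s 2 * s' 1, - s' 2, s' 1])
    (IsHomogeneous.sum _ _ _ fun j _ => by
      simpa using (isHomogeneous_C (Fin 3)
        ((![s 1 * s' 2 - s 2 * s' 1, - s' 2, s' 1] : Fin 3 → F) j)).mul (isHomogeneous_X F j)) (by
      intro m
      have h1 := hi _ (e m).2
      simp only [Function.Embedding.trans_apply, Function.Embedding.coeFn_mk, ← h1]
      simp [linearForm, Fin.sum_univ_three, hs, hs'0]
      ring)
  have hc : ∀ v : Fin 3 → F, linearForm F v = 0 → v = 0 := by
    intro v hv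
    funext j
    have h1 : coeff (Finsupp.single j 1) (∑ i, C (v i) * (X i : MvPolynomial (Fin 3) F)) = 0 := by
      rw [show ∑ i, C (v i) * X i = linearForm F v from rfl, hv, coeff_zero]
    simpa [coeff_sum, coeff_C_mul, coeff_X, Finsupp.single_left_inj] using h1
  have h1 := hc _ hf
  refine hs' (funext fun j => ?_)
  fin_cases j
  · exact hs'0
  · exact congrFun h1 2
  · simpa using congrFun h1 1

theorem not_mulVec_eq_zero [IsAlgClosed F] (hp : IsGeneral a p) {s s' : Fin 3 → F}
    {x : Fin 5 → F} (hx : x ≠ 0) (hli : LinearIndependent F ![s', s])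
    (h : (contractRows a s).mulVec x = 0) (h' : (contractRows a s').mulVec x = 0) : False := by
  wlog hs'0 : s' 0 = 0 generalizing s s'
  · refine this (s := s') (s' := s' 0 • s + (- s 0) • s') ?_ h' ?_ (by simp [mul_comm])
    · rw [LinearIndependent.pair_iff] at hli ⊢
      intro c d hcd
      obtain ⟨h1, h2⟩ := hli (d - c * s 0) (c * s' 0) (by rw [← hcd]; module)
      have hc : c = 0 := (mul_eq_zero.1 h2).resolve_right hs'0
      exact ⟨hc, by simpa [hc] using h1⟩
    · rw [contractRows_add, contractRows_smul, contractRows_smul, Matrix.add_mulVec,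
        Matrix.smul_mulVec, Matrix.smul_mulVec, h, h']
      simp
  have hs0 := hp.coord_zero_ne_zero_of_line hx hli hs'0 h h'
  refine hp.not_mulVec_eq_zero_of_normalized (s := (s 0)⁻¹ • s) hx (by simp [hs0])
    (hli.ne_zero 0) hs'0 ?_ h'
  rw [contractRows_smul, Matrix.smul_mulVec, h, smul_zero]

end IsGeneral

end Field

end Determinantal

/-! ### Generality is a Zariski open condition, nonempty given a base form -/

namespace Determinantal

theorem exists_eq_prod_X_sub_C {F : Type*} [Field F] [IsAlgClosed F] {χ : Polynomial F}
    (h : χ.Monic) {n : ℕ} (hn : χ.natDegree = n) :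
    ∃ t : Fin n → F, χ = ∏ i, (Polynomial.X - Polynomial.C (t i)) := by
  have hcard := (IsAlgClosed.splits χ).natDegree_eq_card_roots
  have h1 := Polynomial.prod_multiset_X_sub_C_of_monic_of_roots_card_eq h hcard.symm
  obtain ⟨l, hl⟩ : ∃ l : List F, (l : Multiset F) = χ.roots := Quot.exists_rep _
  obtain rfl : l.length = n := by rw [← hn, hcard, ← hl]; rfl
  refine ⟨l.get, ?_⟩
  rw [← h1, ← hl, Multiset.map_coe, Multiset.prod_coe, ← List.prod_ofFn]
  congr 1
  conv_lhs => rw [← List.ofFn_get l, List.map_ofFn]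
  rfl

section Field

variable {F : Type*} [Field F] {a : Fin 3 × Fin 4 × Fin 5 → F}

theorem monomialVec_smul {R : Type*} [CommRing R] (d : ℕ) (c : R) (p : Fin 3 → R) :
    monomialVec d (c • p) = c ^ d • monomialVec d p := by
  funext m
  rw [Pi.smul_apply, monomialVec_eq, monomialVec_eq, smul_eq_mul]
  have := m.2
  rw [Finsupp.degree_eq_sum, Fin.sum_univ_three] at this
  rw [show c ^ d = c ^ (m.1 0 + m.1 1 + m.1 2) by rw [this]]
  simp only [Pi.smul_apply, smul_eq_mul]
  ring

/-- A trilinear form with ten explicit points in its degeneracy locus. -/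
structure IsBase (a : Fin 3 × Fin 4 × Fin 5 → F) (p : Fin 10 → Fin 3 → F) : Prop where
  normalized : ∀ i, p i 0 = 1
  injective : Function.Injective fun i => p i 1
  rowMinor_eq_zero : ∀ i k, rowMinor a (p i) k = 0
  independent : ∀ c : Fin 5 → F, (∀ s, ∑ k, c k * rowMinor a s k = 0) → c = 0
  position : ∀ d : ℕ, 1 ≤ d → d ≤ 3 → ∀ e : Exps d ↪ Fin 10,
    (Matrix.of fun m m' => monomialVec d (p (e m)) m').det ≠ 0

namespace IsBase

variable {p : Fin 10 → Fin 3 → F}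

/-- Evaluate a relation X₀w + ∑cₖΔₖ = 0 at the ten points: w vanishes at all of them, so w = 0 since
they lie on no cubic. Independence of the quartics gives c = 0. -/
theorem spanDet_ne_zero (hp : IsBase a p) : spanDet a ≠ 0 := by
  intro h
  rw [spanDet, ← Matrix.exists_mulVec_eq_zero_iff] at h
  obtain ⟨v, hv, h⟩ := h
  set w : Exps 3 → F := fun m => v (expsEquiv (Sum.inl m)) with hw
  set c : Fin 5 → F := fun k => v (expsEquiv (Sum.inr k)) with hc
  have hwc : Sum.elim w c = v ∘ expsEquiv := by ext (x | x) <;> rfl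
  have h1 : (spanMatrix a).mulVec (Sum.elim w c) = 0 := by
    rw [← h, spanMatrixSq, Matrix.submatrix_mulVec_equiv, hwc]
    rfl
  have h2 := spanMatrix_mulVec a w c
  rw [h1] at h2
  have h3 : ∀ s, 0 = s 0 * eval s (formOf 3 w) + ∑ k, c k * rowMinor a s k := by
    intro s
    simpa [formOf, eval_quartic] using congrArg (eval s) h2
  have h4 : (Matrix.of fun m m' => monomialVec 3 (p (exps3Equiv m)) m').mulVec w = 0 := by
    funext m
    have := h3 (p (exps3Equiv m))
    simp only [hp.normalized, hp.rowMinor_eq_zero, one_mul, mul_zero, Finset.sum_const_zero,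
      add_zero, eval_formOf] at this
    simp only [Matrix.mulVec, dotProduct, Matrix.of_apply, Pi.zero_apply]
    rw [this]
    exact Finset.sum_congr rfl fun _ _ => mul_comm _ _
  have hw0 : w = 0 := Matrix.eq_zero_of_mulVec_eq_zero
    (hp.position 3 (by norm_num) le_rfl exps3Equiv.toEmbedding) h4
  have hc0 : c = 0 := hp.independent c fun s => by
    have := h3 s
    rw [hw0] at this
    simpa [formOf] using this.symm
  apply hv
  funext r
  obtain ⟨x | x, rfl⟩ := expsEquiv.surjective r
  · exact congrFun hw0 x
  · exact congrFun hc0 x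

/-- The ten points supply ten distinct roots of a monic polynomial of degree ten. -/
theorem charpoly_eq (hp : IsBase a p) : (mulMatrix 1 a).charpoly =
    ∏ i, (Polynomial.X - Polynomial.C (spanDet a * p i 1)) := by
  have hinj : Function.Injective fun i => spanDet a * p i 1 := fun i j hij =>
    hp.injective (mul_left_cancel₀ hp.spanDet_ne_zero hij)
  have hmonic := Polynomial.monic_prod_of_monic Finset.univ
    (fun i => Polynomial.X - Polynomial.C (spanDet a * p i 1))
    fun _ _ => Polynomial.monic_X_sub_C _
  refine Polynomial.eq_of_monic_of_dvd_of_natDegree_le hmonic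
    (Matrix.charpoly_monic (mulMatrix 1 a)) ?_ ?_
  · refine Finset.prod_dvd_of_coprime
      ((Polynomial.pairwise_coprime_X_sub_C hinj).set_pairwise _) fun i _ => ?_
    rw [Polynomial.dvd_iff_isRoot]
    exact eval_charpoly_of_rowMinor_eq_zero (hp.normalized i) (hp.rowMinor_eq_zero i)
  · refine (Matrix.charpoly_natDegree_eq_dim _).trans (card_exps 3) |>.le.trans ?_
    have := Polynomial.natDegree_finsetProd_X_sub_C_eq_card Finset.univ
      fun i => spanDet a * p i 1
    exact this.ge

/-- Evaluating the Krylov vectors at the ten points gives a Vandermonde matrix in the eigenvalues.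
-/
theorem krylovDet_ne_zero (hp : IsBase a p) : krylovDet a ≠ 0 := by
  have h : (Matrix.of fun m m' => monomialVec 3 (p (exps3Equiv m)) m') * krylovSq a =
      (Matrix.vandermonde fun i => spanDet a * p i 1).submatrix exps3Equiv exps3Equiv := by
    ext m k
    rw [Matrix.mul_apply]
    have := vecMul_krylov (vecMul_mulMatrix (hp.normalized (exps3Equiv m))
      (hp.rowMinor_eq_zero (exps3Equiv m)) 1) (exps3Equiv k)
    rw [monomialVec_cubeExp, hp.normalized, one_pow, mul_one] at this
    exact this
  have h1 := congrArg Matrix.det h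
  rw [Matrix.det_mul, Matrix.det_submatrix_equiv_self] at h1
  refine right_ne_zero_of_mul (a := Matrix.det _) (h1 ▸ Matrix.det_vandermonde_ne_zero_iff.2 ?_)
  exact fun i j hij => hp.injective (mul_left_cancel₀ hp.spanDet_ne_zero hij)

end IsBase

/-- The determinant of the monomials of degree `d` at the points determined by the
eigenvalues `X m`. -/
noncomputable def positionDet {R : Type*} [CommRing R] (b : Fin 3 × Fin 4 × Fin 5 → R) (d : ℕ) :
    MvPolynomial (Exps d) R :=
  (Matrix.of fun m m' => monomialVec d ![C (spanDet b * krylovDet b), C (krylovDet b) * X m,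
    C (spanDet b) * (coordPoly b).eval₂ C (X m)] m').det

/-- At eigenvalue t the point is (1, t/`spanDet`, `coordPoly`(t)/`krylovDet`). Homogeneity allows
multiplying through by `spanDet * krylovDet`, so no denominators occur. -/
theorem eval₂_positionDet {R : Type*} [CommRing R] (f : R →+* F) (b : Fin 3 × Fin 4 × Fin 5 → R)
    (hb : ∀ t, f (b t) = a t) (d : ℕ) (q : Exps d → Fin 3 → F) (h0 : ∀ m, q m 0 = 1)
    (h : ∀ m k, rowMinor a (q m) k = 0) :
    eval₂ f (fun m => spanDet a * q m 1) (positionDet b d) =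
      ((spanDet a * krylovDet a) ^ d) ^ Fintype.card (Exps d) *
        (Matrix.of fun m m' => monomialVec d (q m) m').det := by
  rw [← Matrix.det_smul, positionDet, ← coe_eval₂Hom, RingHom.map_det]
  congr 1
  ext m m'
  have hb' : (fun t => f (b t)) = a := funext hb
  have h1 : f (spanDet b) = spanDet a := by rw [map_spanDet, hb']
  have h2 : f (krylovDet b) = krylovDet a := by rw [map_krylovDet, hb']
  have h3 : eval₂ f (fun m => spanDet a * q m 1) ((coordPoly b).eval₂ C (X m)) =
      krylovDet a * q m 2 := by
    rw [← eval_coordPoly_of_rowMinor_eq_zero (h0 m) (h m), ← hb', ← map_coordPoly,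
      Polynomial.eval_map, ← coe_eval₂Hom, Polynomial.hom_eval₂]
    congr 1
    · ext; simp
    · simp
  have h4 : (spanDet a * krylovDet a) • q m = ![spanDet a * krylovDet a,
      krylovDet a * (spanDet a * q m 1), spanDet a * (krylovDet a * q m 2)] := by
    funext i
    fin_cases i
    · simp [h0]
    · simp; ring
    · simp; ring
  have h5 := congrFun (monomialVec_smul d (spanDet a * krylovDet a) (q m)) m'
  rw [h4] at h5
  simp only [RingHom.mapMatrix_apply, Matrix.map_apply, Matrix.of_apply, Matrix.smul_apply]
  rw [Pi.smul_apply] at h5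
  rw [← h5, monomialVec_eq, monomialVec_eq]
  simp [h1, h2, h3]

end Field

open Classical in
/-- General trilinear forms form a Zariski open set, nonempty if it contains a base form. -/
theorem exists_isGeneral {a₀ : Fin 3 × Fin 4 × Fin 5 → ℂ} {p₀ : Fin 10 → Fin 3 → ℂ}
    (h₀ : IsBase a₀ p₀) : ∃ g : MvPolynomial (Fin 3 × Fin 4 × Fin 5) ℂ, g ≠ 0 ∧
      ∀ a, eval a g ≠ 0 → ∃ p, IsGeneral a p := by
  -- The generic form, whose coefficients are the variables; every form is a specialisation of it.
  let b : Fin 3 × Fin 4 × Fin 5 → MvPolynomial (Fin 3 × Fin 4 × Fin 5) ℂ := X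
  have hb : ∀ a, (fun t => eval a (b t)) = a := fun a => funext fun t => eval_X t
  -- With G = X₀ − X₁ the resolvent is the discriminant up to sign: it is nonzero exactly when the
  -- eigenvalues are distinct.
  obtain ⟨c₀, hc₀⟩ := exists_resolvent (mulMatrix 1 b).charpoly 10
    (X 0 - X 1 : MvPolynomial (Fin 2) _)
  choose c hc using fun d => exists_resolvent (mulMatrix 1 b).charpoly 10 (positionDet b d)
  have hdet : ∀ (a) (p : Fin 10 → Fin 3 → ℂ), (∀ i, p i 0 = 1) → (∀ i k, rowMinor a (p i) k = 0) →
      (mulMatrix 1 a).charpoly = ∏ i, (Polynomial.X - Polynomial.C (spanDet a * p i 1)) →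
      ∀ d, eval a (c d) = ∏ e : Exps d ↪ Fin 10,
        ((spanDet a * krylovDet a) ^ d) ^ Fintype.card (Exps d) *
        (Matrix.of fun m m' => monomialVec d (p (e m)) m').det := by
    intro a p h0 h hχ d
    rw [hc d (eval a) (fun i => spanDet a * p i 1) (by rw [map_charpoly_mulMatrix, hb, hχ])]
    exact Finset.prod_congr rfl fun e _ =>
      eval₂_positionDet (eval a) b (congrFun (hb a)) d (fun m => p (e m)) (fun m => h0 _)
        fun m => h _
  refine ⟨spanDet b * krylovDet b * c₀ * (c 1 * c 2 * c 3), fun hg => ?_, fun a ha => ?_⟩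
  · have h1 := congrArg (eval a₀) hg
    rw [map_zero] at h1
    refine absurd h1 ?_
    have h2 := h₀.charpoly_eq
    have h3 := hdet a₀ p₀ h₀.normalized h₀.rowMinor_eq_zero h2
    have h4 : ∀ d, 1 ≤ d → d ≤ 3 → eval a₀ (c d) ≠ 0 := by
      intro d hd hd'
      rw [h3, Finset.prod_ne_zero_iff]
      exact fun e _ => mul_ne_zero (pow_ne_zero _ (pow_ne_zero _
        (mul_ne_zero h₀.spanDet_ne_zero h₀.krylovDet_ne_zero))) (h₀.position d hd hd' e)
    have h5 : eval a₀ c₀ ≠ 0 := by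
      rw [hc₀ (eval a₀) (fun i => spanDet a₀ * p₀ i 1) (by rw [map_charpoly_mulMatrix, hb, h2]),
        Finset.prod_ne_zero_iff]
      intro e _ he
      have h6 : spanDet a₀ * p₀ (e 0) 1 - spanDet a₀ * p₀ (e 1) 1 = 0 := by simpa using he
      have := e.injective (h₀.injective (mul_left_cancel₀ h₀.spanDet_ne_zero (sub_eq_zero.1 h6)))
      exact absurd this (by decide)
    simp only [map_mul, map_spanDet, map_krylovDet, hb]
    exact mul_ne_zero (mul_ne_zero (mul_ne_zero h₀.spanDet_ne_zero h₀.krylovDet_ne_zero) h5)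
      (mul_ne_zero (mul_ne_zero (h4 1 le_rfl (by norm_num)) (h4 2 (by norm_num) (by norm_num)))
        (h4 3 (by norm_num) le_rfl))
  · simp only [map_mul, map_spanDet, map_krylovDet, hb, mul_ne_zero_iff] at ha
    obtain ⟨⟨⟨hs, hk⟩, hc0⟩, ⟨h1, h2⟩, h3⟩ := ha
    have hmonic := Matrix.charpoly_monic (mulMatrix 1 a)
    have hdeg : (mulMatrix 1 a).charpoly.natDegree = 10 := by
      rw [Matrix.charpoly_natDegree_eq_dim, card_exps]; rfl
    obtain ⟨t, ht⟩ := exists_eq_prod_X_sub_C hmonic hdeg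
    have htinj : Function.Injective t := by
      rw [hc₀ (eval a) t (by rw [map_charpoly_mulMatrix, hb, ht]), Finset.prod_ne_zero_iff] at hc0
      intro i j hij
      by_contra hne
      have hinj : Function.Injective ![i, j] := by
        intro x y hxy
        fin_cases x <;> fin_cases y
        · rfl
        · exact absurd hxy hne
        · exact absurd hxy.symm hne
        · rfl
      exact hc0 ⟨![i, j], hinj⟩ (Finset.mem_univ _) (by simp [hij])
    have hroot : ∀ i, (mulMatrix 1 a).charpoly.eval (t i) = 0 := fun i => by
      rw [ht, Polynomial.eval_prod]
      exact Finset.prod_eq_zero (Finset.mem_univ i) (by simp)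
    choose p hp0 hp1 hp using fun i => exists_rowMinor_eq_zero_of_root hs hk (hroot i)
    have hχ : (mulMatrix 1 a).charpoly =
        ∏ i, (Polynomial.X - Polynomial.C (spanDet a * p i 1)) := by simp only [hp1, ht]
    have hpos := hdet a p hp0 hp hχ
    refine ⟨p, fun q hq h => X_zero_ne_zero_of_rowMinor hs hq h, hp0, fun i j hij =>
      htinj (by rw [← hp1 i, ← hp1 j, hij]), hp, fun q hq h => ?_,
      fun q v hq hv h => tangent_eq_zero hs hk htinj ht hq hv h, fun d hd hd' e => ?_⟩
    · have h4 := eval_charpoly_of_rowMinor_eq_zero hq h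
      rw [ht, Polynomial.eval_prod, Finset.prod_eq_zero_iff] at h4
      obtain ⟨i, -, hi⟩ := h4
      simp only [Polynomial.eval_sub, Polynomial.eval_X, Polynomial.eval_C, sub_eq_zero] at hi
      refine ⟨i, funext fun j => ?_⟩
      have h5 : q 1 = p i 1 := mul_left_cancel₀ hs (by rw [hi, hp1])
      -- The eigenvalue fixes q₁, and `coordPoly` then fixes q₂.
      have h6 : q 2 = p i 2 := mul_left_cancel₀ hk (by
        rw [← eval_coordPoly_of_rowMinor_eq_zero hq h,
          ← eval_coordPoly_of_rowMinor_eq_zero (hp0 i) (hp i), h5])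
      fin_cases j
      · exact hq.trans (hp0 i).symm
      · exact h5
      · exact h6
    · have h4 : eval a (c d) ≠ 0 := by
        interval_cases d <;> assumption
      rw [hpos, Finset.prod_ne_zero_iff] at h4
      exact right_ne_zero_of_mul (h4 e (Finset.mem_univ _))

end Determinantal

/-! ### Generalised Vandermonde determinants by Descartes' rule of signs -/

theorem Polynomial.signVariations_lt_card_support {P : Polynomial ℝ} (hP : P ≠ 0) :
    P.signVariations < P.support.card := by
  generalize h : P.support.card = n
  induction n using Nat.strong_induction_on generalizing P with
  | _ n ih =>
    have h4 := Polynomial.eraseLead_support_card_lt hP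
    by_cases h0 : P.eraseLead = 0
    · have h1 := Polynomial.eraseLead_add_monomial_natDegree_leadingCoeff P
      rw [h0, zero_add] at h1
      rw [← h1, Polynomial.signVariations_monomial]
      omega
    · have h2 := ih _ (h ▸ h4) h0 rfl
      have h3 := Polynomial.signVariations_le_eraseLead_succ (P := P)
      omega

/-- A kernel vector is the coefficient vector of a nonzero polynomial with at most |ι| terms and |ι|
distinct positive roots. Descartes' rule allows fewer positive roots than terms. -/
theorem Matrix.det_pow_ne_zero {ι : Type*} [Fintype ι] [DecidableEq ι] {x : ι → ℝ} {k : ι → ℕ}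
    (hx : Function.Injective x) (hpos : ∀ i, 0 < x i) (hk : Function.Injective k) :
    (Matrix.of fun i j => x i ^ k j).det ≠ 0 := by
  intro h
  rw [← Matrix.exists_mulVec_eq_zero_iff] at h
  obtain ⟨v, hv, h⟩ := h
  set P : Polynomial ℝ := ∑ j, Polynomial.monomial (k j) (v j) with hPdef
  have hcoeff : ∀ j, P.coeff (k j) = v j := by
    intro j
    rw [hPdef, Polynomial.finsetSum_coeff, Finset.sum_eq_single j]
    · simp
    · intro i _ hij
      rw [Polynomial.coeff_monomial, if_neg (hk.ne hij)]
    · simp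
  have hP : P ≠ 0 := fun h0 => hv (funext fun j => by rw [← hcoeff, h0]; simp)
  have hcard : P.support.card ≤ Fintype.card ι := by
    rw [← Finset.card_univ, ← Finset.card_image_of_injective _ hk]
    refine Finset.card_le_card fun n hn => ?_
    by_contra hne
    refine Polynomial.mem_support_iff.1 hn ?_
    rw [hPdef, Polynomial.finsetSum_coeff]
    refine Finset.sum_eq_zero fun j _ => ?_
    rw [Polynomial.coeff_monomial, if_neg]
    rintro rfl
    exact hne (Finset.mem_image_of_mem _ (Finset.mem_univ j))
  have hroot : ∀ i, x i ∈ P.roots := by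
    intro i
    rw [Polynomial.mem_roots hP, Polynomial.IsRoot, hPdef, Polynomial.eval_finsetSum]
    have := congrFun h i
    simp only [Matrix.mulVec, dotProduct, Matrix.of_apply, Pi.zero_apply] at this
    rw [← this]
    exact Finset.sum_congr rfl fun j _ => by rw [Polynomial.eval_monomial, mul_comm]
  have hle : Fintype.card ι ≤ P.roots.countP (0 < ·) := by
    rw [Multiset.countP_eq_card_filter, ← Finset.card_univ, ← Finset.card_image_of_injective _ hx]
    refine Multiset.card_le_card ((Multiset.le_iff_subset (Finset.nodup _)).2 fun y hy => ?_)
    obtain ⟨i, -, rfl⟩ := Finset.mem_image.1 (Finset.mem_def.2 hy)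
    exact Multiset.mem_filter.2 ⟨hroot i, hpos i⟩
  have h1 := Polynomial.roots_countP_pos_le_signVariations P
  have h2 := Polynomial.signVariations_lt_card_support hP
  omega

/-! ### An explicit base form -/

namespace Determinantal

/-- The points `(1, t, t⁴)` for `t = 1, …, 10`. -/
noncomputable def basePoint (i : Fin 10) : Fin 3 → ℂ :=
  ![1, ((i : ℕ) + 1 : ℂ), ((i : ℕ) + 1 : ℂ) ^ 4]

/-- A trilinear form degenerating at the points `basePoint i`. -/
def baseForm : Fin 3 × Fin 4 × Fin 5 → ℂ := fun t =>
  (![!![0, 0, 0, 0, 3628800; 0, 0, 23170290, 1705, -449768924; 1, 0, 0, 0, 0; 0, 1, 0, 0, 0],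
    !![-1320, 23170290, 1274365950, 93775, -24747919460; -1, 0, 0, 55, -8409500; 0, 0, 0, 1, 0;
      0, 0, 1, 0, 0],
    !![0, -1320, 0, -1, 3416930; 0, -1, 0, 0, -840477; 0, 0, -1, 0, -18150; 0, 0, 0, 0, 1]] :
      Fin 3 → Matrix (Fin 4) (Fin 5) ℂ) t.1 t.2.1 t.2.2

theorem contractRows_baseForm (s : Fin 3 → ℂ) : contractRows baseForm s =
    !![-1320 * s 1, 23170290 * s 1 - 1320 * s 2, 1274365950 * s 1, 93775 * s 1 - s 2,
        3628800 * s 0 - 24747919460 * s 1 + 3416930 * s 2;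
      -s 1, -s 2, 23170290 * s 0, 1705 * s 0 + 55 * s 1,
        -449768924 * s 0 - 8409500 * s 1 - 840477 * s 2;
      s 0, 0, -s 2, s 1, -18150 * s 2; 0, s 0, s 1, 0, s 2] := by
  ext j k
  fin_cases j <;> fin_cases k <;>
    simp [contractRows, baseForm, Fin.sum_univ_three, Matrix.of_apply] <;> ring

/-- Along the curve (1,t,t⁴) this vector kills the first four columns identically and leaves ∏(t −
i) in the last, so N(s) degenerates at t = 1,…,10. Constants such as 55, 1320, 18150 and 3628800 are
elementary symmetric functions of 1,…,10. -/
theorem vecMul_baseForm (t : ℂ) : Matrix.vecMul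
    ![1, t ^ 2 - 55 * t, t ^ 3 - 55 * t ^ 2 + 1320 * t,
      t ^ 6 - 55 * t ^ 5 + 1320 * t ^ 4 - 23170290 * t]
    (contractRows baseForm ![1, t, t ^ 4]) = ![0, 0, 0, 0, (t - 1) * (t - 2) * (t - 3) * (t - 4) *
      (t - 5) * (t - 6) * (t - 7) * (t - 8) * (t - 9) * (t - 10)] := by
  rw [contractRows_baseForm]
  ext k
  fin_cases k <;> simp [Matrix.vecMul, dotProduct, Fin.sum_univ_four] <;> ring

theorem monomialVec_basePoint (d : ℕ) (i : Fin 10) (m : Exps d) :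
    monomialVec d (basePoint i) m = (((((i : ℕ) + 1 : ℝ)) ^ (m.1 1 + 4 * m.1 2) : ℝ) : ℂ) := by
  rw [monomialVec_eq]
  simp [basePoint, pow_add, pow_mul]

theorem isBase_baseForm : IsBase baseForm basePoint where
  normalized i := rfl
  injective i j h := by
    have : ((i : ℕ) + 1 : ℂ) = (j : ℕ) + 1 := h
    exact Fin.ext (by simpa using this)
  rowMinor_eq_zero i k := by
    refine rowMinor_eq_zero_of_vecMul ((vecMul_baseForm _).trans ?_) ⟨0, isUnit_one⟩ k
    fin_cases i <;> (norm_num; exact Subsingleton.elim _ _)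
  independent c h := by
    -- The minors at these five points form an invertible 5×5 matrix; the coefficients used below
    -- invert the resulting linear system.
    have h1 := h ![0, 0, 1]
    have h2 := h ![1, 0, 0]
    have h3 := h ![0, 1, 0]
    have h4 := h ![1, 1, 0]
    have h5 := h ![1, 0, 1]
    simp [rowMinor, contractRows_baseForm, Matrix.det_succ_row_zero, Fin.sum_univ_succ,
      Fin.succAbove] at h1 h2 h3 h4 h5
    have hc : ∀ i, c i = 0 := by
      intro i
      fin_cases i
      · exact h1
      · change c 1 = 0
        linear_combination (6497054078201765/338111643893) * h1 +
          (2460092863201/165636837003453984000) * h2 +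
          (1764422/228225359627775) * h3 +
          (-2253047/91290143851110) * h4 + (-286533/16905582194650) * h5
      · change c 2 = 0
        linear_combination (-343618712009442233/338111643893) * h1 +
          (-1205566860527/2650189392055263744) * h2 +
          (-424179227/1825802877022200) * h3 +
          (54682199/73032115080888) * h4 + (8730331/16905582194650) * h5
      · change c 3 = 0
        linear_combination (819398467099439171/10956845931996558) * h1 +
          (3951463800091781/118087801478546455721088000) * h2 +
          (13149556037/769170584426158371600) * h3 +
          (-11854183/215152611028296048) * h4 + (-270640261/7121949855797762700) * h5
      · change c 4 = 0
        linear_combination (9825111469861692013030/498038451454389) * h1 +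
          (1067190744149457001/121991530453043859216000) * h2 +
          (4770302240388869/1057609553585967760950) * h3 +
          (-977374041647/67235190946342515) * h4 + (-41432767311/4150320428786575) * h5
    exact funext hc
  position d hd hd' e := by
    have h1 : Function.Injective fun m : Exps d => ((e m : ℕ) + 1 : ℝ) := fun m m' h =>
      e.injective (Fin.ext (by simpa using h))
    -- On the curve a monomial becomes a power of t with exponent m₁ + 4m₂. Since m₁ ≤ d ≤ 3, these
    -- exponents are distinct.
    have h2 : Function.Injective fun m : Exps d => m.1 1 + 4 * m.1 2 := by
      intro m m' h
      have h3 := m.2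
      have h4 := m'.2
      rw [Finsupp.degree_eq_sum, Fin.sum_univ_three] at h3 h4
      refine Exps.ext' (Finsupp.ext fun i => ?_)
      simp only at h
      fin_cases i <;> simp <;> omega
    have h3 := Matrix.det_pow_ne_zero h1 (fun m => by positivity) h2
    have h4 := (map_ne_zero Complex.ofRealHom).2 h3
    rw [RingHom.map_det] at h4
    exact fun h0 => h4 (Eq.trans (congrArg Matrix.det (Matrix.ext fun m m' =>
      (monomialVec_basePoint d (e m) m').symm)) h0)

end Determinantal

/-! ### Tangent vectors and embedding dimension -/

/-- The ε-part of ψ is linear over the residue field on the maximal ideal, as constant parts vanish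
there. The images of any generators therefore span M. -/
theorem IsLocalRing.finrank_le_spanFinrank_maximalIdeal {A k M ι : Type*} [CommRing A]
    [IsLocalRing A] [IsNoetherianRing A] [Field k] [AddCommGroup M] [Module k M] [Module kᵐᵒᵖ M]
    [IsCentralScalar k M] (ψ : A →+* TrivSqZeroExt k M)
    (hψ : Function.Surjective fun x => (ψ x).fst) {z : ι → A} {v : ι → M}
    (hz : ∀ i, ψ (z i) = TrivSqZeroExt.inr (v i)) (hv : Submodule.span k (Set.range v) = ⊤) :
    Module.finrank k M ≤ (IsLocalRing.maximalIdeal A).spanFinrank := by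
  let φ : A →+* k := (TrivSqZeroExt.fstHom k k M).toRingHom.comp ψ
  have hφ : RingHom.ker φ = IsLocalRing.maximalIdeal A :=
    IsLocalRing.eq_maximalIdeal (RingHom.ker_isMaximal_of_surjective φ hψ)
  have hfst : ∀ x ∈ IsLocalRing.maximalIdeal A, (ψ x).fst = 0 := fun x hx => by
    rw [← hφ] at hx
    exact hx
  have hfg : (IsLocalRing.maximalIdeal A).FG := IsNoetherian.noetherian _
  have hfin := Submodule.FG.finite_generators hfg
  have hspan : ∀ x ∈ IsLocalRing.maximalIdeal A, (ψ x).snd ∈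
      Submodule.span k ((fun y => (ψ y).snd) '' (IsLocalRing.maximalIdeal A).generators) := by
    intro x hx
    have hx' : x ∈ Submodule.span A (IsLocalRing.maximalIdeal A).generators := by
      rwa [Submodule.span_generators]
    induction hx' using Submodule.span_induction with
    | mem y hy => exact Submodule.subset_span ⟨y, hy, rfl⟩
    | zero => simp
    | add y z hy hz ihy ihz =>
      rw [Submodule.span_generators] at hy hz
      rw [map_add, TrivSqZeroExt.snd_add]
      exact add_mem (ihy hy) (ihz hz)
    | smul c y hy ih =>
      rw [Submodule.span_generators] at hy
      rw [smul_eq_mul, map_mul, TrivSqZeroExt.snd_mul, hfst y hy, MulOpposite.op_zero, zero_smul,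
        add_zero]
      exact Submodule.smul_mem _ _ (ih hy)
  have htop : Submodule.span k ((fun y => (ψ y).snd) '' (IsLocalRing.maximalIdeal A).generators) = ⊤ := by
    rw [← top_le_iff, ← hv, Submodule.span_le]
    rintro _ ⟨i, rfl⟩
    have h1 : z i ∈ IsLocalRing.maximalIdeal A := by
      rw [← hφ, RingHom.mem_ker]
      change (ψ (z i)).fst = 0
      rw [hz, TrivSqZeroExt.fst_inr]
    have := hspan _ h1
    rwa [hz, TrivSqZeroExt.snd_inr] at this
  have hfin' := hfin.image fun y => (ψ y).snd
  have := hfin'.fintype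
  calc Module.finrank k M = Module.finrank k (Submodule.span k
      ((fun y => (ψ y).snd) '' (IsLocalRing.maximalIdeal A).generators)) := by rw [htop, finrank_top]
    _ ≤ _ := finrank_span_le_card _
    _ = ((fun y => (ψ y).snd) '' (IsLocalRing.maximalIdeal A).generators).ncard :=
      (Set.ncard_eq_toFinset_card' _).symm
    _ ≤ (IsLocalRing.maximalIdeal A).generators.ncard := Set.ncard_image_le hfin
    _ = _ := Submodule.FG.generators_ncard hfg

namespace Determinantal

variable {σ : Type}

/-- The local ring of affine space at a point. -/
abbrev AffineLocalRing (p : σ → ℂ) : Type :=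
  Localization.AtPrime (vanishingIdeal ℂ ({p} : Set (σ → ℂ)))

theorem mem_vanishingIdeal_singleton {p : σ → ℂ} {f : MvPolynomial σ ℂ} :
    f ∈ vanishingIdeal ℂ ({p} : Set (σ → ℂ)) ↔ eval p f = 0 := by
  rw [mem_vanishingIdeal_singleton_iff, aeval_eq_eval]

theorem mem_zeroLocus_iff_le {I : Ideal (MvPolynomial σ ℂ)} {p : σ → ℂ} :
    p ∈ zeroLocus ℂ I ↔ I ≤ vanishingIdeal ℂ ({p} : Set (σ → ℂ)) := by
  rw [← le_zeroLocus_iff_le_vanishingIdeal]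
  exact Set.singleton_subset_iff.symm

/-- The gradient at a point. -/
noncomputable def gradient (p : σ → ℂ) : MvPolynomial σ ℂ →ₗ[ℂ] (σ → ℂ) :=
  LinearMap.pi fun i => (aeval p).toLinearMap ∘ₗ (pderiv i : Derivation ℂ _ _).toLinearMap

theorem gradient_apply (p : σ → ℂ) (f : MvPolynomial σ ℂ) (i : σ) :
    gradient p f i = eval p (pderiv i f) := by
  simp [gradient, aeval_eq_eval]

instance [Finite σ] (p : σ → ℂ) : IsNoetherianRing (AffineLocalRing p) :=
  IsLocalization.isNoetherianRing (vanishingIdeal ℂ ({p} : Set (σ → ℂ))).primeCompl _ inferInstance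

theorem taylor_mem_sq [Fintype σ] (p : σ → ℂ) (f : MvPolynomial σ ℂ) :
    f - C (eval p f) - ∑ i, C (gradient p f i) * (X i - C (p i)) ∈
      vanishingIdeal ℂ ({p} : Set (σ → ℂ)) ^ 2 := by
  classical
  have hX : ∀ i, (X i - C (p i) : MvPolynomial σ ℂ) ∈ vanishingIdeal ℂ ({p} : Set (σ → ℂ)) :=
    fun i => by simp
  simp only [gradient_apply]
  induction f using MvPolynomial.induction_on with
  | C a => simp
  | add f g hf hg =>
    convert add_mem hf hg using 1
    simp only [map_add, add_mul, Finset.sum_add_distrib]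
    ring
  | mul_X f n hf =>
    have h1 : ∑ i, C (eval p (pderiv i (f * X n))) * (X i - C (p i) : MvPolynomial σ ℂ) =
        C (p n) * ∑ i, C (eval p (pderiv i f)) * (X i - C (p i)) +
          C (eval p f) * (X n - C (p n)) := by
      simp only [Derivation.leibniz, smul_eq_mul, map_add, map_mul, eval_X, add_mul,
        Finset.sum_add_distrib, Finset.mul_sum]
      rw [add_comm]
      congr 1
      · exact Finset.sum_congr rfl fun i _ => by ring
      · rw [Finset.sum_eq_single n]
        · simp
        · intro i _ hi
          rw [pderiv_X_of_ne hi.symm]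
          simp
        · simp
    rw [h1]
    have h2 := (vanishingIdeal ℂ ({p} : Set (σ → ℂ)) ^ 2).mul_mem_right (X n) hf
    have h3 : (∑ i, C (eval p (pderiv i f)) * (X i - C (p i) : MvPolynomial σ ℂ)) *
        (X n - C (p n)) ∈ vanishingIdeal ℂ ({p} : Set (σ → ℂ)) ^ 2 := by
      rw [pow_two]
      exact Ideal.mul_mem_mul (Ideal.sum_mem _ fun i _ => Ideal.mul_mem_left _ _ (hX i)) (hX n)
    convert add_mem h2 h3 using 1
    simp only [map_mul, eval_X]
    ring

theorem vanishingIdeal_le_sup_sq [Fintype σ] {p : σ → ℂ} {S : Set (MvPolynomial σ ℂ)}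
    (hS : ∀ f ∈ S, eval p f = 0) (h : Submodule.span ℂ (gradient p '' S) = ⊤) :
    vanishingIdeal ℂ ({p} : Set (σ → ℂ)) ≤
      Ideal.span S ⊔ vanishingIdeal ℂ ({p} : Set (σ → ℂ)) ^ 2 := by
  intro f hf
  have h1 : gradient p f ∈ (Submodule.span ℂ S).map (gradient p) := by
    rw [Submodule.map_span, h]
    trivial
  obtain ⟨g, hg, hgf⟩ := h1
  have hg1 : g ∈ Ideal.span S :=
    (Submodule.span_le (p := (Ideal.span S).restrictScalars ℂ)).2 Ideal.subset_span hg
  have hg2 : g ∈ vanishingIdeal ℂ ({p} : Set (σ → ℂ)) :=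
    Ideal.span_le.2 (fun x hx => mem_vanishingIdeal_singleton.2 (hS x hx)) hg1
  have h2 := taylor_mem_sq p (f - g)
  rw [map_sub (gradient p), hgf, sub_self, map_sub (eval p), mem_vanishingIdeal_singleton.1 hf,
    mem_vanishingIdeal_singleton.1 hg2] at h2
  simp only [sub_self, C_0, Pi.zero_apply, zero_mul, Finset.sum_const_zero, sub_zero] at h2
  rw [← add_sub_cancel g f]
  exact add_mem (Ideal.mem_sup_left hg1) (Ideal.mem_sup_right h2)

theorem isLocalRing_localRingAt {I : Ideal (MvPolynomial σ ℂ)} {p : σ → ℂ}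
    (hp : p ∈ zeroLocus ℂ I) : IsLocalRing (LocalRingAt I p) := by
  have h1 : I.map (algebraMap (MvPolynomial σ ℂ)
      (AffineLocalRing p)) ≠ ⊤ := by
    have := (Ideal.map_mono (f := algebraMap (MvPolynomial σ ℂ)
      (AffineLocalRing p)) (mem_zeroLocus_iff_le.1 hp))
    rw [Localization.AtPrime.map_eq_maximalIdeal] at this
    exact fun h => (IsLocalRing.maximalIdeal.isMaximal _).ne_top (top_le_iff.1 (h ▸ this))
  have := Ideal.Quotient.nontrivial_iff.2 h1
  exact IsLocalRing.of_surjective' _ Ideal.Quotient.mk_surjective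

section Tangent

variable {M : Type} [AddCommGroup M] [Module ℂ M] [Module ℂᵐᵒᵖ M] [IsCentralScalar ℂ M]

/-- The first order neighbourhood of a point, as a homomorphism from the local ring of affine
space. -/
noncomputable def tangentHom (p : σ → ℂ) (v : σ → M) :
    AffineLocalRing p →+* TrivSqZeroExt ℂ M :=
  IsLocalization.lift (M := (vanishingIdeal ℂ ({p} : Set (σ → ℂ))).primeCompl)
    (g := (aeval fun i => TrivSqZeroExt.inl (p i) + TrivSqZeroExt.inr (v i) :
      MvPolynomial σ ℂ →ₐ[ℂ] TrivSqZeroExt ℂ M).toRingHom) (by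
    rintro ⟨f, hf⟩
    rw [TrivSqZeroExt.isUnit_iff_isUnit_fst, isUnit_iff_ne_zero]
    have : (TrivSqZeroExt.fstHom ℂ ℂ M).comp (aeval fun i => TrivSqZeroExt.inl (p i) +
        TrivSqZeroExt.inr (v i)) = aeval p := by
      ext i; simp
    have h2 := congrArg (fun φ : _ →ₐ[ℂ] _ => φ f) this
    refine fun h0 => hf (mem_vanishingIdeal_singleton.2 ?_)
    exact (h2.symm.trans h0))

theorem tangentHom_algebraMap (p : σ → ℂ) (v : σ → M) (f : MvPolynomial σ ℂ) :
    tangentHom p v (algebraMap (MvPolynomial σ ℂ) (AffineLocalRing p) f) =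
      aeval (fun i => TrivSqZeroExt.inl (p i) + TrivSqZeroExt.inr (v i)) f :=
  IsLocalization.lift_eq _ _

theorem finrank_le_spanFinrank_localization [Finite σ] (p : σ → ℂ) {v : σ → M}
    (hv : Submodule.span ℂ (Set.range v) = ⊤) : Module.finrank ℂ M ≤ (IsLocalRing.maximalIdeal
      (AffineLocalRing p)).spanFinrank := by
  refine IsLocalRing.finrank_le_spanFinrank_maximalIdeal (tangentHom p v)
    (fun c => ⟨algebraMap (MvPolynomial σ ℂ) (AffineLocalRing p) (C c), ?_⟩) (z := fun i => algebraMap (MvPolynomial σ ℂ) (AffineLocalRing p) (X i - C (p i))) (v := v)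
    (fun i => ?_) hv
  · simp only [tangentHom_algebraMap]
    simp [TrivSqZeroExt.algebraMap_eq_inl]
  · rw [tangentHom_algebraMap]
    simp [TrivSqZeroExt.algebraMap_eq_inl]

/-- The first order neighbourhood of a point of an affine scheme, as a homomorphism from its local
ring. -/
noncomputable def tangentHomQuotient {I : Ideal (MvPolynomial σ ℂ)} {p : σ → ℂ} {v : σ → M}
    (hI : ∀ f ∈ I, aeval (fun i => TrivSqZeroExt.inl (p i) + TrivSqZeroExt.inr (v i)) f
      = (0 : TrivSqZeroExt ℂ M)) : LocalRingAt I p →+* TrivSqZeroExt ℂ M :=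
  Ideal.Quotient.lift _ (tangentHom p v) fun x hx => by
    refine (Ideal.map_le_iff_le_comap.2 (fun f hf => ?_) : _ ≤ RingHom.ker (tangentHom p v)) hx
    exact (tangentHom_algebraMap p v f).trans (hI f hf)

theorem tangentHomQuotient_mk {I : Ideal (MvPolynomial σ ℂ)} {p : σ → ℂ} {v : σ → M}
    (hI : ∀ f ∈ I, aeval (fun i => TrivSqZeroExt.inl (p i) + TrivSqZeroExt.inr (v i)) f
      = (0 : TrivSqZeroExt ℂ M)) (x : AffineLocalRing p) :
    tangentHomQuotient hI (Ideal.Quotient.mk _ x) = tangentHom p v x := rfl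

instance [Finite σ] (I : Ideal (MvPolynomial σ ℂ)) (p : σ → ℂ) :
    IsNoetherianRing (LocalRingAt I p) :=
  Ideal.Quotient.isNoetherianRing _

theorem finrank_le_spanFinrank_localRingAt [Finite σ] {I : Ideal (MvPolynomial σ ℂ)} {p : σ → ℂ}
    {v : σ → M} (hI : ∀ f ∈ I, aeval (fun i => TrivSqZeroExt.inl (p i) + TrivSqZeroExt.inr (v i)) f
      = (0 : TrivSqZeroExt ℂ M))
    (hv : Submodule.span ℂ (Set.range v) = ⊤) [IsLocalRing (LocalRingAt I p)] :
    Module.finrank ℂ M ≤ (IsLocalRing.maximalIdeal (LocalRingAt I p)).spanFinrank := by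
  refine IsLocalRing.finrank_le_spanFinrank_maximalIdeal (A := LocalRingAt I p)
    (tangentHomQuotient hI)
    (fun c => ⟨Ideal.Quotient.mk _
      (algebraMap (MvPolynomial σ ℂ) (AffineLocalRing p) (C c)), ?_⟩)
    (z := fun i => Ideal.Quotient.mk _
      (algebraMap (MvPolynomial σ ℂ) (AffineLocalRing p) (X i - C (p i)))) (v := v)
    (fun i => ?_) hv
  · simp only [tangentHomQuotient_mk, tangentHom_algebraMap]
    simp [TrivSqZeroExt.algebraMap_eq_inl]
  · rw [tangentHomQuotient_mk, tangentHom_algebraMap]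
    simp [TrivSqZeroExt.algebraMap_eq_inl]

end Tangent

/-- The first-order thickening by M bounds the embedding dimension below by dim M; regularity would
make it equal to the Krull dimension. -/
theorem not_isRegularLocalRing [Finite σ] {M : Type} [AddCommGroup M] [Module ℂ M]
    [Module ℂᵐᵒᵖ M] [IsCentralScalar ℂ M] {I : Ideal (MvPolynomial σ ℂ)} {p : σ → ℂ}
    {v : σ → M} (hI : ∀ f ∈ I, aeval (fun i => TrivSqZeroExt.inl (p i) + TrivSqZeroExt.inr (v i)) f
      = (0 : TrivSqZeroExt ℂ M))
    (hv : Submodule.span ℂ (Set.range v) = ⊤)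
    (h : ringKrullDim (LocalRingAt I p) < (Module.finrank ℂ M : WithBot ℕ∞)) :
    ¬ IsRegularLocalRing (LocalRingAt I p) := by
  intro hreg
  have := hreg.toIsLocalRing
  have h1 := finrank_le_spanFinrank_localRingAt hI hv
  have h2 := hreg.spanFinrank_maximalIdeal
  rw [← h2] at h
  exact absurd h1 (not_le.2 (by exact_mod_cast h))

end Determinantal

/-! ### The Jacobian criterion -/

theorem WithBot.eq_natCast_of_le_of_le {x : WithBot ℕ∞} {a k m : ℕ} (h : (a : WithBot ℕ∞) ≤ x + k)
    (h' : x ≤ m) (hm : m + k ≤ a) : x = m := by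
  induction x using WithBot.recBotCoe with
  | bot => simp at h
  | coe x =>
    induction x using ENat.recTopCoe with
    | top =>
      have h'' : ((⊤ : ℕ∞) : WithBot ℕ∞) ≤ ((m : ℕ∞) : WithBot ℕ∞) := h'
      rw [WithBot.coe_le_coe] at h''
      exact absurd h'' (by simp)
    | coe x =>
      have h1 : a ≤ x + k := by exact_mod_cast h
      have h2 : x ≤ m := by exact_mod_cast h'
      have : x = m := by omega
      rw [this]
      rfl

theorem Ideal.map_span_range_union {A B ι κ : Type*} [CommRing A] [CommRing B] (φ : A →+* B)
    {f : ι → A} {g : κ → A} (hf : ∀ i, φ (f i) = 0) :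
    (Ideal.span (Set.range f ∪ Set.range g)).map φ = Ideal.span (Set.range fun j => φ (g j)) := by
  rw [Ideal.map_span, Set.image_union, Ideal.span_union, ← Set.range_comp, ← Set.range_comp]
  refine (sup_of_le_right (Ideal.span_le.2 ?_)).trans rfl
  rintro _ ⟨i, rfl⟩
  rw [Function.comp_apply, hf]
  exact zero_mem _

namespace Determinantal

variable {σ : Type}

theorem maximalIdeal_affineLocalRing (p : σ → ℂ) : IsLocalRing.maximalIdeal (AffineLocalRing p) =
    (vanishingIdeal ℂ ({p} : Set (σ → ℂ))).map
      (algebraMap (MvPolynomial σ ℂ) (AffineLocalRing p)) :=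
  (Localization.AtPrime.map_eq_maximalIdeal).symm

/-- Polynomials whose gradients span the cotangent space generate the maximal ideal modulo its
square; Nakayama does the rest. -/
theorem maximalIdeal_affineLocalRing_eq_map_span [Fintype σ] {p : σ → ℂ} {S : Set (MvPolynomial σ ℂ)}
    (hS : ∀ f ∈ S, eval p f = 0) (h : Submodule.span ℂ (gradient p '' S) = ⊤) :
    IsLocalRing.maximalIdeal (AffineLocalRing p) = (Ideal.span S).map
      (algebraMap (MvPolynomial σ ℂ) (AffineLocalRing p)) := by
  refine le_antisymm ?_ ?_
  · refine Submodule.le_of_le_smul_of_le_jacobson_bot (IsNoetherian.noetherian _)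
      (IsLocalRing.jacobson_eq_maximalIdeal _ bot_ne_top).ge ?_
    have h1 := Ideal.map_mono (f := algebraMap (MvPolynomial σ ℂ) (AffineLocalRing p))
      (vanishingIdeal_le_sup_sq hS h)
    rwa [Ideal.map_sup, Ideal.map_pow, ← maximalIdeal_affineLocalRing, pow_two] at h1
  · rw [maximalIdeal_affineLocalRing]
    exact Ideal.map_mono (Ideal.span_le.2 fun f hf => mem_vanishingIdeal_singleton.2 (hS f hf))

theorem card_le_ringKrullDim_affineLocalRing [Fintype σ] (p : σ → ℂ) :
    (Fintype.card σ : WithBot ℕ∞) ≤ ringKrullDim (AffineLocalRing p) := by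
  classical
  have h1 : IsRegularLocalRing (AffineLocalRing p) := inferInstance
  rw [← h1.spanFinrank_maximalIdeal]
  have h2 := finrank_le_spanFinrank_localization p (M := σ → ℂ) (v := fun i => Pi.single i 1) (by
    rw [← (Pi.basisFun ℂ σ).span_eq]
    congr 2)
  rw [Module.finrank_fintype_fun_eq_card] at h2
  exact_mod_cast h2

/-- The Jacobian criterion at a point. -/
theorem isRegularLocalRing_of_gradient [Fintype σ] {G : Set (MvPolynomial σ ℂ)} {p : σ → ℂ}
    (hp : p ∈ zeroLocus ℂ (Ideal.span G)) {r : ℕ} (f : Fin r → MvPolynomial σ ℂ)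
    (hf : ∀ l, f l ∈ Ideal.span G)
    (hG : ∀ g ∈ G, ∃ u, eval p u ≠ 0 ∧ u * g ∈ Ideal.span (Set.range f))
    (hli : LinearIndependent ℂ fun l => gradient p (f l)) :
    IsRegularLocalRing (LocalRingAt (Ideal.span G) p) ∧
      ringKrullDim (LocalRingAt (Ideal.span G) p) = ((Fintype.card σ - r : ℕ) : WithBot ℕ∞) := by
  classical
  have hloc := isLocalRing_localRingAt hp
  have hle := mem_zeroLocus_iff_le.1 hp
  have hf0 : ∀ l, eval p (f l) = 0 := fun l => mem_vanishingIdeal_singleton.1 (hle (hf l))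
  have hr : r ≤ Fintype.card σ := by
    simpa using hli.fintype_card_le_finrank
  -- The multipliers `u` are units in the local ring, so the `f l` alone generate the ideal locally.
  have hmap : (Ideal.span G).map (algebraMap (MvPolynomial σ ℂ) (AffineLocalRing p)) =
      Ideal.span (Set.range fun l => algebraMap (MvPolynomial σ ℂ) (AffineLocalRing p) (f l)) := by
    have h1 : Ideal.span (Set.range fun l => algebraMap (MvPolynomial σ ℂ) (AffineLocalRing p)
        (f l)) = (Ideal.span (Set.range f)).map (algebraMap _ _) := by
      rw [Ideal.map_span, ← Set.range_comp]
      rfl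
    rw [h1]
    refine le_antisymm ?_ (Ideal.map_mono (Ideal.span_le.2 ?_))
    · rw [Ideal.map_le_iff_le_comap, Ideal.span_le]
      intro g hg
      obtain ⟨u, hu, hug⟩ := hG g hg
      have hunit : IsUnit (algebraMap (MvPolynomial σ ℂ) (AffineLocalRing p) u) :=
        IsLocalization.map_units (AffineLocalRing p)
          (⟨u, fun h => hu (mem_vanishingIdeal_singleton.1 h)⟩ :
            (vanishingIdeal ℂ ({p} : Set (σ → ℂ))).primeCompl)
      have h2 := Ideal.mem_map_of_mem (algebraMap (MvPolynomial σ ℂ) (AffineLocalRing p)) hug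
      rw [map_mul] at h2
      exact (Ideal.unit_mul_mem_iff_mem _ hunit).1 h2
    · rintro _ ⟨l, rfl⟩
      exact hf l
  -- complete the gradients by coordinates
  obtain ⟨W, hW⟩ := (Submodule.span ℂ (Set.range fun l => gradient p (f l))).exists_isCompl
  have hWrank : Module.finrank ℂ W = Fintype.card σ - r := by
    have := Submodule.finrank_add_eq_of_isCompl hW
    rw [finrank_span_eq_card hli, Fintype.card_fin, Module.finrank_fintype_fun_eq_card] at this
    omega
  let b := Module.finBasisOfFinrankEq ℂ W hWrank
  let g : Fin (Fintype.card σ - r) → MvPolynomial σ ℂ := fun j =>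
    ∑ i, C ((b j : σ → ℂ) i) * (X i - C (p i))
  have hg0 : ∀ j, eval p (g j) = 0 := fun j => by simp [g]
  have hggrad : ∀ j, gradient p (g j) = b j := by
    intro j
    ext k
    rw [gradient_apply]
    simp only [g, map_sum, Derivation.leibniz, smul_eq_mul, map_sub, pderiv_C, pderiv_X]
    simp [Pi.single_apply, apply_ite (eval p)]
  have hspan : Submodule.span ℂ (gradient p '' (Set.range f ∪ Set.range g)) = ⊤ := by
    rw [Set.image_union, Submodule.span_union, ← Set.range_comp, ← Set.range_comp,
      ← hW.sup_eq_top]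
    congr 1
    have h1 : gradient p ∘ g = W.subtype ∘ b := funext hggrad
    rw [h1, Set.range_comp, ← Submodule.map_span, b.span_eq, Submodule.map_top,
      Submodule.range_subtype]
  have hmax := maximalIdeal_affineLocalRing_eq_map_span (S := Set.range f ∪ Set.range g) (by
    rintro _ (⟨l, rfl⟩ | ⟨j, rfl⟩)
    · exact hf0 l
    · exact hg0 j) hspan
  have hmaxA : IsLocalRing.maximalIdeal (LocalRingAt (Ideal.span G) p) = Ideal.span (Set.range
      fun j => Ideal.Quotient.mk _ (algebraMap (MvPolynomial σ ℂ) (AffineLocalRing p) (g j))) := by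
    rw [← IsLocalRing.map_maximalIdeal_of_surjective (Ideal.Quotient.mk _)
      Ideal.Quotient.mk_surjective, hmax, Ideal.map_map]
    exact Ideal.map_span_range_union _ fun l => Ideal.Quotient.eq_zero_iff_mem.2
      (Ideal.mem_map_of_mem (algebraMap (MvPolynomial σ ℂ) (AffineLocalRing p)) (hf l))
  have hle2 : (IsLocalRing.maximalIdeal (LocalRingAt (Ideal.span G) p)).spanFinrank ≤
      Fintype.card σ - r := by
    rw [hmaxA]
    refine (Submodule.spanFinrank_span_le_ncard_of_finite (Set.finite_range _)).trans ?_
    rw [← Set.image_univ]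
    refine (Set.ncard_image_le Set.finite_univ).trans ?_
    simp
  -- Dividing by r elements lowers the dimension by at most r, while the n − r linear forms `g`
  -- generate the maximal ideal of the quotient. The two bounds meet.
  have hdim := (card_le_ringKrullDim_affineLocalRing p).trans
    (ringKrullDim_le_ringKrullDim_quotient_add_spanFinrank
      ((Ideal.span G).map (algebraMap (MvPolynomial σ ℂ) (AffineLocalRing p))) (by
        rw [← Ideal.jacobson_bot, IsLocalRing.jacobson_eq_maximalIdeal _ bot_ne_top,
          maximalIdeal_affineLocalRing]
        exact Ideal.map_mono hle))
  have hsr : ((Ideal.span G).map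
      (algebraMap (MvPolynomial σ ℂ) (AffineLocalRing p))).spanFinrank ≤ r := by
    rw [hmap]
    refine (Submodule.spanFinrank_span_le_ncard_of_finite (Set.finite_range _)).trans ?_
    rw [← Set.image_univ]
    refine (Set.ncard_image_le Set.finite_univ).trans ?_
    simp
  have hub := ringKrullDim_le_spanFinrank_maximalIdeal (LocalRingAt (Ideal.span G) p)
  have hdimA : ringKrullDim (LocalRingAt (Ideal.span G) p) =
      ((Fintype.card σ - r : ℕ) : WithBot ℕ∞) := by
    refine WithBot.eq_natCast_of_le_of_le (hdim.trans (add_le_add_right ?_ _))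
      (hub.trans ?_) (Nat.sub_add_cancel hr).le
    · exact_mod_cast hsr
    · exact_mod_cast hle2
  refine ⟨IsRegularLocalRing.of_spanFinrank_maximalIdeal_le _ ?_, hdimA⟩
  rw [hdimA]
  exact_mod_cast hle2

end Determinantal

/-! ### Global dimension from the dimensions of local rings -/

namespace Determinantal

variable {σ : Type}

theorem isPrime_map_vanishingIdeal {I : Ideal (MvPolynomial σ ℂ)} {p : σ → ℂ}
    (hp : p ∈ zeroLocus ℂ I) :
    ((vanishingIdeal ℂ ({p} : Set (σ → ℂ))).map (Ideal.Quotient.mk I)).IsMaximal := by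
  refine (Ideal.map_eq_top_or_isMaximal_of_surjective _ Ideal.Quotient.mk_surjective
    inferInstance).resolve_left fun h => ?_
  have := (Ideal.isPrime_map_quotientMk_of_isPrime (mem_zeroLocus_iff_le.1 hp)).ne_top
  exact this h

theorem ringKrullDim_localRingAt_eq_height {I : Ideal (MvPolynomial σ ℂ)} {p : σ → ℂ}
    (hp : p ∈ zeroLocus ℂ I) : ringKrullDim (LocalRingAt I p) =
      ((vanishingIdeal ℂ ({p} : Set (σ → ℂ))).map (Ideal.Quotient.mk I)).height := by
  have := (isPrime_map_vanishingIdeal hp).isPrime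
  have h : Algebra.algebraMapSubmonoid (MvPolynomial σ ℂ ⧸ I)
      (vanishingIdeal ℂ ({p} : Set (σ → ℂ))).primeCompl =
      ((vanishingIdeal ℂ ({p} : Set (σ → ℂ))).map (Ideal.Quotient.mk I)).primeCompl := by
    ext x
    obtain ⟨r, rfl⟩ := Ideal.Quotient.mk_surjective x
    have h1 : Ideal.Quotient.mk I r ∈ (vanishingIdeal ℂ ({p} : Set (σ → ℂ))).map
        (Ideal.Quotient.mk I) ↔ r ∈ vanishingIdeal ℂ ({p} : Set (σ → ℂ)) := by
      rw [Ideal.mem_quotient_iff_mem_sup, sup_of_le_left (mem_zeroLocus_iff_le.1 hp)]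
    constructor
    · rintro ⟨r', hr', h2⟩ h3
      rw [← h2] at h3
      refine hr' ?_
      have h4 : Ideal.Quotient.mk I r' ∈ (vanishingIdeal ℂ ({p} : Set (σ → ℂ))).map
        (Ideal.Quotient.mk I) := h3
      rwa [Ideal.mem_quotient_iff_mem_sup, sup_of_le_left (mem_zeroLocus_iff_le.1 hp)] at h4
    · exact fun h2 => ⟨r, fun h3 => h2 (h1.2 h3), rfl⟩
  have h2 : IsLocalization (Algebra.algebraMapSubmonoid (MvPolynomial σ ℂ ⧸ I)
      (vanishingIdeal ℂ ({p} : Set (σ → ℂ))).primeCompl) (LocalRingAt I p) := inferInstance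
  rw [h] at h2
  exact @IsLocalization.AtPrime.ringKrullDim_eq_height _ _ _ this (LocalRingAt I p) _ _ h2

theorem ringKrullDim_localRingAt_le {I : Ideal (MvPolynomial σ ℂ)} {p : σ → ℂ}
    (hp : p ∈ zeroLocus ℂ I) :
    ringKrullDim (LocalRingAt I p) ≤ ringKrullDim (MvPolynomial σ ℂ ⧸ I) := by
  rw [ringKrullDim_localRingAt_eq_height hp]
  exact Ideal.height_le_ringKrullDim_of_ne_top (isPrime_map_vanishingIdeal hp).ne_top

/-- A prime ideal which is not maximal has zeros outside every finite set. -/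
theorem exists_mem_zeroLocus_notMem [Finite σ] {Q : Ideal (MvPolynomial σ ℂ)} (hQ : Q.IsPrime)
    (hmax : ¬ Q.IsMaximal) {F : Set (σ → ℂ)} (hF : F.Finite) : ∃ p ∈ zeroLocus ℂ Q, p ∉ F := by
  by_contra! hcon
  have h1 : Q = vanishingIdeal ℂ (zeroLocus ℂ Q) := (IsPrime.vanishingIdeal_zeroLocus Q).symm
  have hfin : (zeroLocus ℂ Q).Finite := hF.subset hcon
  -- If the zero set were finite, Q would contain a finite intersection of maximal ideals, hence one
  -- of them, and so be maximal.
  have h2 : hfin.toFinset.inf (fun p => vanishingIdeal ℂ ({p} : Set (σ → ℂ))) ≤ Q := by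
    conv_rhs => rw [h1]
    intro f hf p hp
    have h3 := (Submodule.mem_finsetInf.1 hf) p (hfin.mem_toFinset.2 hp)
    exact h3 p rfl
  obtain ⟨p, hp, hpQ⟩ := (Ideal.IsPrime.inf_le' hQ).1 h2
  have h3 : vanishingIdeal ℂ ({p} : Set (σ → ℂ)) = Q :=
    le_antisymm hpQ (mem_zeroLocus_iff_le.1 (hfin.mem_toFinset.1 hp))
  exact hmax (h3 ▸ inferInstance)

/-- A prime strictly below another is not maximal, so it has a zero outside the finite set `F`. It
lies strictly below the maximal ideal of that point, of height at most d, so its own height is less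
than d. Finitely many bad points cannot raise the dimension. -/
theorem ringKrullDim_quotient_le [Finite σ] {I : Ideal (MvPolynomial σ ℂ)} {F : Set (σ → ℂ)}
    (hF : F.Finite) {d : ℕ}
    (h : ∀ p ∈ zeroLocus ℂ I, p ∉ F → ringKrullDim (LocalRingAt I p) ≤ d) :
    ringKrullDim (MvPolynomial σ ℂ ⧸ I) ≤ d := by
  rw [ringKrullDim, Order.krullDim_eq_iSup_height]
  refine iSup_le fun x => ?_
  suffices Order.height x ≤ d by exact_mod_cast this
  rw [Order.height_le_coe_iff]
  intro y hy
  have hmax : ¬ (y.asIdeal.comap (Ideal.Quotient.mk I)).IsMaximal := by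
    intro hm
    have h1 : y.asIdeal.IsMaximal := by
      have := Ideal.map_eq_top_or_isMaximal_of_surjective _
        (Ideal.Quotient.mk_surjective (I := I)) hm
      rw [Ideal.map_comap_of_surjective _ Ideal.Quotient.mk_surjective] at this
      exact this.resolve_left y.2.ne_top
    exact hy.ne (PrimeSpectrum.ext (h1.eq_of_le x.2.ne_top hy.le))
  obtain ⟨p, hp, hpF⟩ := exists_mem_zeroLocus_notMem inferInstance hmax hF
  have hIQ : I ≤ y.asIdeal.comap (Ideal.Quotient.mk I) := fun f hf => by
    rw [Ideal.mem_comap, Ideal.Quotient.eq_zero_iff_mem.2 hf]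
    exact zero_mem _
  have hpI : p ∈ zeroLocus ℂ I := zeroLocus_anti_mono hIQ hp
  have hm := isPrime_map_vanishingIdeal hpI
  let m : PrimeSpectrum (MvPolynomial σ ℂ ⧸ I) := ⟨_, hm.isPrime⟩
  have hym : y < m := by
    refine lt_of_le_of_ne ?_ ?_
    · have h1 := Ideal.map_mono (f := Ideal.Quotient.mk I) (mem_zeroLocus_iff_le.1 hp)
      rwa [Ideal.map_comap_of_surjective _ Ideal.Quotient.mk_surjective] at h1
    · intro h1
      refine hmax ?_
      rw [h1]
      exact Ideal.comap_isMaximal_of_surjective _ Ideal.Quotient.mk_surjective (H := hm)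
  have h1 := h p hpI hpF
  rw [ringKrullDim_localRingAt_eq_height hpI] at h1
  have h2 : Order.height m ≤ d := by
    rw [← PrimeSpectrum.height_eq_orderHeight]
    exact_mod_cast h1
  exact (Order.height_strictMono hym
    (((Order.height_mono hym.le).trans h2).trans_lt (ENat.natCast_lt_top d))).trans_le h2

end Determinantal

/-! ### Equations of the Tjurina transform -/

theorem Matrix.rank_add_one_eq {K : Type*} [Field K] {m n : ℕ} (B : Matrix (Fin (m + 1)) (Fin n) K)
    {s : Fin (m + 1) → K} (hs : s ≠ 0) (h : Matrix.vecMul s B = 0) {r : Fin m → Fin (m + 1)}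
    {c : Fin m → Fin n} (hB : (B.submatrix r c).det ≠ 0) : B.rank + 1 = m + 1 := by
  have h1 : B.rank ≠ m + 1 := by
    intro h1
    rw [Matrix.rank_eq_finrank_span_row] at h1
    have h2 : LinearIndependent K B.row :=
      linearIndependent_iff_card_eq_finrank_span.2 (by rw [Fintype.card_fin]; exact h1.symm)
    refine hs (funext fun i => Fintype.linearIndependent_iff.1 h2 s ?_ i)
    rw [← h]
    ext j
    simp [Matrix.vecMul, dotProduct]
  have h2 : B.rank ≤ m + 1 := by simpa using B.rank_le_height
  have h3 : m ≤ B.rank := by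
    have h4 : (B.submatrix r c).rank = m := by
      rw [Matrix.rank_of_isUnit _ ((Matrix.isUnit_iff_isUnit_det _).2 hB.isUnit), Fintype.card_fin]
    have h5 : B.submatrix r c = (1 : Matrix (Fin (m + 1)) (Fin (m + 1)) K).submatrix r id * B *
        (1 : Matrix (Fin n) (Fin n) K).submatrix id c := by
      ext i j
      simp [Matrix.mul_apply, Matrix.one_apply]
    calc m = (B.submatrix r c).rank := h4.symm
      _ ≤ ((1 : Matrix (Fin (m + 1)) (Fin (m + 1)) K).submatrix r id * B).rank := h5 ▸ Matrix.rank_mul_le_left _ _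
      _ ≤ B.rank := Matrix.rank_mul_le_right _ _
  omega

namespace Determinantal

section Graph

variable {m n : ℕ} (i : Fin (m + 1))

/-- The equations of the closure of the graph in the chart `s i = 1`. -/
def graphEquations (n : ℕ) (i : Fin (m + 1)) :
    Set (MvPolynomial ((Fin (m + 1) × Fin n) ⊕ Fin (m + 1)) ℂ) :=
  insert (X (Sum.inr i) - 1) (Set.range fun k => ∑ j, X (Sum.inr j) * X (Sum.inl (j, k)))

/-- The parametrization of the chart by the coordinates other than `s i` and row `i`. -/
noncomputable def graphParam (R : Type*) [CommRing R] (i : Fin (m + 1))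
    (q : (Fin (m + 1) × Fin n) ⊕ Fin (m + 1) → R) : (Fin (m + 1) × Fin n) ⊕ Fin (m + 1) → R :=
  Sum.elim (fun jk => if jk.1 = i then
      -∑ j : Fin m, q (Sum.inr (i.succAbove j)) * q (Sum.inl (i.succAbove j, jk.2))
    else q (Sum.inl jk)) (fun j => if j = i then 1 else q (Sum.inr j))

theorem map_graphParam {R S : Type*} [CommRing R] [CommRing S] (f : R →+* S)
    (q : (Fin (m + 1) × Fin n) ⊕ Fin (m + 1) → R) (t) :
    f (graphParam R i q t) = graphParam S i (fun t => f (q t)) t := by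
  rcases t with jk | j
  · simp only [graphParam, Sum.elim_inl]
    split_ifs <;> simp
  · simp only [graphParam, Sum.elim_inr]
    split_ifs <;> simp

theorem graphParam_equations {R : Type*} [CommRing R]
    (q : (Fin (m + 1) × Fin n) ⊕ Fin (m + 1) → R) (k : Fin n) :
    ∑ j, graphParam R i q (Sum.inr j) * graphParam R i q (Sum.inl (j, k)) = 0 := by
  rw [Fin.sum_univ_succAbove _ i]
  simp [graphParam, Fin.succAbove_ne]

theorem graphParam_eq_self {R : Type*} [CommRing R]
    {q : (Fin (m + 1) × Fin n) ⊕ Fin (m + 1) → R} (h : q (Sum.inr i) = 1)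
    (h' : ∀ k, ∑ j, q (Sum.inr j) * q (Sum.inl (j, k)) = 0) : graphParam R i q = q := by
  ext (⟨j, k⟩ | j)
  · simp only [graphParam, Sum.elim_inl]
    split_ifs with hj
    · subst hj
      have := h' k
      rw [Fin.sum_univ_succAbove _ j, h, one_mul] at this
      exact (eq_neg_of_add_eq_zero_left this).symm
    · rfl
  · simp only [graphParam, Sum.elim_inr]
    split_ifs with hj
    · rw [hj, h]
    · rfl

theorem graphParam_mem (hmn : m ≤ n) {q : (Fin (m + 1) × Fin n) ⊕ Fin (m + 1) → ℂ}
    (hq : (Matrix.of fun j k => q (Sum.inl (i.succAbove j, Fin.castLE hmn k))).det ≠ 0) :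
    graphParam ℂ i q ∈ graphChart (m + 1) n i := by
  have h1 : graphParam ℂ i q (Sum.inr i) = 1 := by simp [graphParam]
  have h2 : Matrix.vecMul (fun j => graphParam ℂ i q (Sum.inr j))
      (Matrix.of fun j k => graphParam ℂ i q (Sum.inl (j, k))) = 0 :=
    funext fun k => graphParam_equations i q k
  refine ⟨Matrix.rank_add_one_eq _ (fun h => ?_) h2 (r := i.succAbove) (c := Fin.castLE hmn) ?_,
    h1, h2⟩
  · have := congrFun h i
    simp [h1] at this
  · have h3 : (Matrix.of fun j k => graphParam ℂ i q (Sum.inl (j, k))).submatrix i.succAbove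
        (Fin.castLE hmn) =
        Matrix.of fun j k => q (Sum.inl (i.succAbove j, Fin.castLE hmn k)) := by
      ext j k
      simp [graphParam, Fin.succAbove_ne]
    rwa [h3]

/-- The equations solve for sᵢ and row i, so they cut out an affine space parametrised by
`graphParam`. The graph contains the locus where a chosen m×m minor `g` is nonzero. If f vanishes on
the graph, then `g` times the pullback of f is zero, so the pullback is zero, and it agrees with f
modulo the equations. -/
theorem vanishingIdeal_graphChart (hmn : m ≤ n) :
    vanishingIdeal ℂ (graphChart (m + 1) n i) = Ideal.span (graphEquations n i) := by
  refine le_antisymm (fun f hf => ?_) (Ideal.span_le.2 ?_)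
  · let φ : MvPolynomial ((Fin (m + 1) × Fin n) ⊕ Fin (m + 1)) ℂ →ₐ[ℂ]
        MvPolynomial ((Fin (m + 1) × Fin n) ⊕ Fin (m + 1)) ℂ := aeval (graphParam _ i X)
    let g : MvPolynomial ((Fin (m + 1) × Fin n) ⊕ Fin (m + 1)) ℂ :=
      (Matrix.of fun j k => X (Sum.inl (i.succAbove j, Fin.castLE hmn k))).det
    have hgeval : ∀ q, eval q g =
        (Matrix.of fun j k => q (Sum.inl (i.succAbove j, Fin.castLE hmn k))).det := by
      intro q
      simp only [g]
      rw [RingHom.map_det]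
      congr 1
      ext j k
      simp
    have hg : g ≠ 0 := by
      intro h
      have h1 := hgeval (Sum.elim (fun jk => if ∃ l : Fin m, jk.1 = i.succAbove l ∧
        jk.2 = Fin.castLE hmn l then 1 else 0) 0)
      rw [h, map_zero] at h1
      have h2 : (Matrix.of fun j k => (Sum.elim (fun jk : Fin (m + 1) × Fin n =>
          if ∃ l : Fin m, jk.1 = i.succAbove l ∧ jk.2 = Fin.castLE hmn l then (1 : ℂ) else 0)
          (0 : Fin (m + 1) → ℂ)) (Sum.inl (i.succAbove j, Fin.castLE hmn k))) =
          (1 : Matrix (Fin m) (Fin m) ℂ) := by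
        ext j k
        simp only [Matrix.of_apply, Sum.elim_inl, Matrix.one_apply,
          (Fin.succAbove_right_injective).eq_iff, (Fin.castLE_injective hmn).eq_iff]
        congr 1
        simp [eq_comm]
      rw [h2, Matrix.det_one] at h1
      exact zero_ne_one h1
    have hφ : ∀ q, eval q (φ f) = eval (graphParam ℂ i q) f := by
      intro q
      have : (eval q).comp φ.toRingHom = eval (graphParam ℂ i q) := by
        refine MvPolynomial.ringHom_ext (fun r => by simp [φ]) fun t => ?_
        have := map_graphParam i (eval q) X t
        simpa [φ] using this
      exact congrArg (fun ψ : _ →+* _ => ψ f) this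
    have h0 : g * φ f = 0 := by
      refine MvPolynomial.funext fun q => ?_
      rw [map_mul, hgeval, hφ, map_zero]
      by_cases hq : (Matrix.of fun j k => q (Sum.inl (i.succAbove j, Fin.castLE hmn k))).det = 0
      · rw [hq, zero_mul]
      · have := hf _ (graphParam_mem i hmn hq)
        rw [aeval_eq_eval] at this
        exact mul_eq_zero_of_right _ this
    have h1 : φ f = 0 := (mul_eq_zero.1 h0).resolve_left hg
    have h2 : (Ideal.Quotient.mk (Ideal.span (graphEquations n i))).comp φ.toRingHom =
        Ideal.Quotient.mk _ := by
      refine MvPolynomial.ringHom_ext (fun r => by simp [φ]) fun t => ?_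
      have h3 := map_graphParam i (Ideal.Quotient.mk (Ideal.span (graphEquations n i))) X t
      have h4 := graphParam_eq_self i
        (q := fun t => Ideal.Quotient.mk (Ideal.span (graphEquations n i)) (X t))
        (by
          rw [← sub_eq_zero, ← map_one (Ideal.Quotient.mk (Ideal.span (graphEquations n i))),
            ← map_sub]
          exact Ideal.Quotient.eq_zero_iff_mem.2 (Ideal.subset_span (Set.mem_insert _ _)))
        (fun k => by
          simp only [← map_mul, ← map_sum]
          exact Ideal.Quotient.eq_zero_iff_mem.2
            (Ideal.subset_span (Set.mem_insert_of_mem _ ⟨k, rfl⟩)))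
      rw [h4] at h3
      simpa [φ] using h3
    have h3 := congrArg (fun ψ : _ →+* _ => ψ f) h2
    have h4 : Ideal.Quotient.mk (Ideal.span (graphEquations n i)) (φ f) =
        Ideal.Quotient.mk (Ideal.span (graphEquations n i)) f := h3
    rw [h1, map_zero] at h4
    exact Ideal.Quotient.eq_zero_iff_mem.1 h4.symm
  · rintro _ (rfl | ⟨k, rfl⟩) q ⟨-, hq, hq'⟩
    · simp [aeval_eq_eval, hq]
    · have := congrFun hq' k
      simpa [aeval_eq_eval, Matrix.vecMul, dotProduct] using this

end Graph

/-- The equations of the Tjurina transform of a linear matrix in the chart `s i = 1`. -/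
def tjurinaEquations (a : Fin 3 × Fin 4 × Fin 5 → ℂ) (i : Fin 3) :
    Set (MvPolynomial (Fin 5 ⊕ Fin 3) ℂ) :=
  insert (X (Sum.inr i) - 1) (Set.range fun j => ∑ k,
    contractRows (fun t => C (a t)) (fun i => X (Sum.inr i)) j k * X (Sum.inl k))

theorem tjurinaIdeal_linearMatrix (a : Fin 3 × Fin 4 × Fin 5 → ℂ) (i : Fin 3) :
    tjurinaIdeal (linearMatrix a) i = Ideal.span (tjurinaEquations a i) := by
  rw [tjurinaIdeal, vanishingIdeal_graphChart i (by norm_num), Ideal.map_span, graphEquations,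
    Set.image_insert_eq, ← Set.range_comp, tjurinaEquations]
  refine congrArg Ideal.span (congrArg₂ insert ?_ (congrArg Set.range (funext fun j => ?_)))
  · simp [pullback]
  · simp only [pullback, Function.comp_apply, map_sum, map_mul, aeval_X, Sum.elim_inr,
      Sum.elim_inl, linearMatrix, Matrix.of_apply, rename_C, rename_X, contractRows,
      Finset.mul_sum, Finset.sum_mul]
    rw [Finset.sum_comm]
    exact Finset.sum_congr rfl fun k _ => Finset.sum_congr rfl fun i _ => by ring

end Determinantal

/-! ### Maximal minors and left kernels of 3×4 matrices -/

namespace Determinantal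

theorem det_submatrix_mem_minorIdeal {R : Type} [CommRing R] {m n : ℕ}
    (B : Matrix (Fin m) (Fin n) R) (c : Fin m → Fin n) :
    (B.submatrix id c).det ∈ minorIdeal m B := by
  by_cases hc : Function.Injective c
  · have hmono : StrictMono (c ∘ Tuple.sort c) :=
      (Tuple.monotone_sort c).strictMono_of_injective (hc.comp (Tuple.sort c).injective)
    have h1 : (B.submatrix id (c ∘ Tuple.sort c)).det ∈ minorIdeal m B :=
      Ideal.subset_span ⟨RelEmbedding.refl _, OrderEmbedding.ofStrictMono _ hmono, rfl⟩
    have h2 := Matrix.det_permute' (Tuple.sort c) (B.submatrix id c)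
    rw [Matrix.submatrix_submatrix, Function.comp_id] at h2
    rw [h2] at h1
    refine (Ideal.unit_mul_mem_iff_mem _ ?_).1 h1
    exact (Units.isUnit _).map (Int.castRingHom R)
  · obtain ⟨i, j, hij, hne⟩ := Function.not_injective_iff.1 hc
    rw [Matrix.det_zero_of_column_eq hne fun k => by simp [hij]]
    exact zero_mem _

theorem orderEmbedding_eq_id {m : ℕ} (r : Fin m ↪o Fin m) : (r : Fin m → Fin m) = id :=
  (r.strictMono.range_inj strictMono_id).1 (by
    rw [(Finite.injective_iff_surjective.1 r.injective).range_eq, Set.range_id])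

section Cross

variable {R : Type*} [CommRing R]

/-- The cross product of two columns. -/
def columnCross (B : Matrix (Fin 3) (Fin 4) R) (j j' : Fin 4) : Fin 3 → R :=
  ![B 1 j * B 2 j' - B 2 j * B 1 j', B 2 j * B 0 j' - B 0 j * B 2 j',
    B 0 j * B 1 j' - B 1 j * B 0 j']

theorem vecMul_columnCross (B : Matrix (Fin 3) (Fin 4) R) (j j' c : Fin 4) :
    Matrix.vecMul (columnCross B j j') B c = (B.submatrix id ![c, j, j']).det := by
  rw [Matrix.det_fin_three]
  simp [Matrix.vecMul, dotProduct, Fin.sum_univ_three, columnCross]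
  ring

theorem vecMul_columnCross_left (B : Matrix (Fin 3) (Fin 4) R) (j j' : Fin 4) :
    Matrix.vecMul (columnCross B j j') B j = 0 := by
  rw [vecMul_columnCross]
  exact Matrix.det_zero_of_column_eq (i := 0) (j := 1) (by decide) fun _ => rfl

theorem vecMul_columnCross_right (B : Matrix (Fin 3) (Fin 4) R) (j j' : Fin 4) :
    Matrix.vecMul (columnCross B j j') B j' = 0 := by
  rw [vecMul_columnCross]
  exact Matrix.det_zero_of_column_eq (i := 0) (j := 2) (by decide) fun _ => rfl

theorem map_columnCross {S : Type*} [CommRing S] (f : R →+* S) (B : Matrix (Fin 3) (Fin 4) R)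
    (j j' : Fin 4) (i : Fin 3) : f (columnCross B j j' i) = columnCross (B.map f) j j' i := by
  fin_cases i <;> simp [columnCross]

/-- The value of a linear matrix at a point. -/
def matrixAt (a : Fin 3 × Fin 4 × Fin 5 → R) (x : Fin 5 → R) : Matrix (Fin 3) (Fin 4) R :=
  Matrix.of fun i j => ∑ k, a (i, j, k) * x k

theorem vecMul_matrixAt (a : Fin 3 × Fin 4 × Fin 5 → R) (s : Fin 3 → R) (x : Fin 5 → R) :
    Matrix.vecMul s (matrixAt a x) = (contractRows a s).mulVec x := by
  ext j
  simp only [Matrix.vecMul, Matrix.mulVec, dotProduct, matrixAt, contractRows, Matrix.of_apply,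
    Finset.mul_sum, Finset.sum_mul]
  rw [Finset.sum_comm]
  exact Finset.sum_congr rfl fun _ _ => Finset.sum_congr rfl fun _ _ => by ring

end Cross

/-- Two columns are proportional for all choices only if the left kernel has dimension two. -/
theorem exists_linearIndependent_vecMul {F : Type*} [Field F] {B : Matrix (Fin 3) (Fin 4) F}
    (h : ∀ j j', columnCross B j j' = 0) : ∃ s s' : Fin 3 → F, LinearIndependent F ![s', s] ∧
      Matrix.vecMul s B = 0 ∧ Matrix.vecMul s' B = 0 := by
  have h0 : ∀ i i' j j', B i j * B i' j' = B i' j * B i j' := by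
    intro i i' j j'
    have h1 := congrFun (h j j') 0
    have h2 := congrFun (h j j') 1
    have h3 := congrFun (h j j') 2
    simp only [columnCross, Matrix.cons_val, Pi.zero_apply, sub_eq_zero] at h1 h2 h3
    fin_cases i <;> fin_cases i' <;> simp only [Fin.zero_eta, Fin.mk_one, Fin.reduceFinMk] <;>
      first
      | rfl
      | assumption
      | exact h1.symm
      | exact h2.symm
      | exact h3.symm
  by_cases hB : B = 0
  · refine ⟨Pi.single 0 1, Pi.single 1 1, ?_, by simp [hB], by simp [hB]⟩
    rw [LinearIndependent.pair_iff]
    intro c d hcd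
    have h1 := congrFun hcd 0
    have h2 := congrFun hcd 1
    simp at h1 h2
    exact ⟨h2, h1⟩
  · obtain ⟨i₀, j₀, hb⟩ : ∃ i j, B i j ≠ 0 := by
      by_contra! hcon
      exact hB (Matrix.ext hcon)
    let t : Fin 3 → Fin 3 → F := fun i => B i₀ j₀ • Pi.single i 1 - B i j₀ • Pi.single i₀ 1
    have ht : ∀ i, Matrix.vecMul (t i) B = 0 := by
      intro i
      ext j
      simp only [t, Matrix.sub_vecMul, Matrix.smul_vecMul, Matrix.single_one_vecMul, Pi.sub_apply,
        Pi.smul_apply, smul_eq_mul, Pi.zero_apply, Matrix.row_apply]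
      rw [h0 i₀ i j₀ j, sub_self]
    refine ⟨t (i₀.succAbove 0), t (i₀.succAbove 1), ?_, ht _, ht _⟩
    rw [LinearIndependent.pair_iff]
    intro c d hcd
    have hne : i₀.succAbove 0 ≠ i₀.succAbove 1 := fun h =>
      absurd (Fin.succAbove_right_injective h) (by decide)
    have h1 := congrFun hcd (i₀.succAbove 0)
    have h2 := congrFun hcd (i₀.succAbove 1)
    simp [t, Fin.succAbove_ne, hne, hne.symm, hb] at h1 h2
    exact ⟨h2, h1⟩

theorem map_linearMatrix_eval (a : Fin 3 × Fin 4 × Fin 5 → ℂ) (x : Fin 5 → ℂ) :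
    (linearMatrix a).map (eval x) = matrixAt a x := by
  ext i j
  simp [linearMatrix, matrixAt]

theorem mem_zeroLocus_minorIdeal_iff {a : Fin 3 × Fin 4 × Fin 5 → ℂ} {x : Fin 5 → ℂ} :
    x ∈ zeroLocus ℂ (minorIdeal 3 (linearMatrix a)) ↔
      ∀ c : Fin 3 → Fin 4, ((matrixAt a x).submatrix id c).det = 0 := by
  have h1 : ∀ c : Fin 3 → Fin 4, eval x ((linearMatrix a).submatrix id c).det =
      ((matrixAt a x).submatrix id c).det := by
    intro c
    rw [RingHom.map_det, ← map_linearMatrix_eval]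
    rfl
  rw [mem_zeroLocus_iff_le]
  constructor
  · intro h c
    rw [← h1]
    exact mem_vanishingIdeal_singleton.1 (h (det_submatrix_mem_minorIdeal _ c))
  · intro h
    refine Ideal.span_le.2 ?_
    rintro _ ⟨r, c, rfl⟩
    refine mem_vanishingIdeal_singleton.2 ?_
    rw [orderEmbedding_eq_id, h1, h]

theorem mem_zeroLocus_minorIdeal_of_mulVec {a : Fin 3 × Fin 4 × Fin 5 → ℂ} {x : Fin 5 → ℂ}
    {s : Fin 3 → ℂ} (hs : s ≠ 0) (h : (contractRows a s).mulVec x = 0) :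
    x ∈ zeroLocus ℂ (minorIdeal 3 (linearMatrix a)) := by
  rw [mem_zeroLocus_minorIdeal_iff]
  intro c
  refine Matrix.exists_vecMul_eq_zero_iff.1 ⟨s, hs, ?_⟩
  rw [← vecMul_matrixAt] at h
  exact funext fun l => congrFun h (c l)

end Determinantal

/-! ### Singularities and dimension of X_a -/

namespace Determinantal

/-- Expansion of a 3×3 determinant along a duplicated or matching row. Where the minors vanish, it
gives an explicit kernel vector of `B` supported on columns `c`, `j`, `j'`. -/
theorem columnCross_mul {R : Type*} [CommRing R] (B : Matrix (Fin 3) (Fin 4) R) (j j' c : Fin 4)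
    (i₀ i : Fin 3) : columnCross B j j' i₀ * B i c - columnCross B c j' i₀ * B i j -
      columnCross B j c i₀ * B i j' = if i = i₀ then (B.submatrix id ![c, j, j']).det else 0 := by
  rw [Matrix.det_fin_three]
  fin_cases i₀ <;> fin_cases i <;> simp [columnCross] <;> ring

theorem columnCross_self {R : Type*} [CommRing R] (B : Matrix (Fin 3) (Fin 4) R) (j : Fin 4) :
    columnCross B j j = 0 := by
  ext i
  fin_cases i <;> simp [columnCross] <;> ring

/-- By the product rule, the terms differentiating `S` carry a factor M_a(x)y = 0 and disappear. -/
theorem gradient_sum_vecMul {a : Fin 3 × Fin 4 × Fin 5 → ℂ} {x : Fin 5 → ℂ}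
    (S : Fin 3 → MvPolynomial (Fin 5) ℂ) {y : Fin 4 → ℂ} (hy : (matrixAt a x).mulVec y = 0) :
    gradient x (∑ c, C (y c) * Matrix.vecMul S (linearMatrix a) c) =
      Matrix.vecMul y (contractRows a fun i => eval x (S i)) := by
  ext k
  have h1 : ∀ i c, eval x (linearMatrix a i c) = matrixAt a x i c := fun i c => by
    rw [← map_linearMatrix_eval]; rfl
  have h2 : ∀ i c, eval x (pderiv k (linearMatrix a i c)) = a (i, c, k) := fun i c => by
    simp [linearMatrix, Derivation.leibniz, pderiv_X, Pi.single_apply]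
  have h3 : ∀ i, ∑ c, y c * matrixAt a x i c = 0 := fun i => by
    have := congrFun hy i
    rw [Pi.zero_apply] at this
    rw [← this]
    exact Finset.sum_congr rfl fun _ _ => mul_comm _ _
  rw [gradient_apply]
  simp only [Matrix.vecMul, dotProduct, map_sum, Derivation.leibniz, smul_eq_mul, pderiv_C,
    mul_zero, add_zero, map_mul, map_add, eval_C, h1, h2, contractRows, Matrix.of_apply,
    Finset.sum_add_distrib, mul_add, Finset.mul_sum]
  have h4 : ∑ c, ∑ i, y c * (matrixAt a x i c * eval x (pderiv k (S i))) = 0 := by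
    rw [Finset.sum_comm]
    refine Finset.sum_eq_zero fun i _ => ?_
    rw [← zero_mul (eval x (pderiv k (S i))), ← h3 i, Finset.sum_mul]
    exact Finset.sum_congr rfl fun _ _ => by ring
  rw [h4, add_zero]
  exact Finset.sum_congr rfl fun _ _ => Finset.sum_congr rfl fun _ _ => by ring

theorem mul_det_mem_span {R : Type*} [CommRing R] {n : ℕ} (N : Matrix (Fin n) (Fin n) R)
    (S : Fin n → R) (i : Fin n) {I : Ideal R} (h : ∀ l, Matrix.vecMul S N l ∈ I) :
    S i * N.det ∈ I := by
  have h1 := congrFun (Matrix.vecMul_vecMul S N N.adjugate) i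
  rw [Matrix.mul_adjugate, Matrix.vecMul_smul, Matrix.vecMul_one, Pi.smul_apply, smul_eq_mul,
    mul_comm] at h1
  rw [← h1]
  change ∑ l, Matrix.vecMul S N l * N.adjugate l i ∈ I
  exact Ideal.sum_mem _ fun l _ => I.mul_mem_right _ (h l)

theorem exists_complement {j j' : Fin 4} : j ≠ j' → ∃ c : Fin 2 → Fin 4, c 0 ≠ c 1 ∧
    (∀ l, c l ≠ j ∧ c l ≠ j') ∧ ∀ k, k = j ∨ k = j' ∨ k ∈ Set.range c := by
  intro h
  obtain ⟨c₀, c₁, h1, h2⟩ : ∃ c₀ c₁ : Fin 4, (c₀ ≠ c₁ ∧ c₀ ≠ j ∧ c₀ ≠ j' ∧ c₁ ≠ j ∧ c₁ ≠ j') ∧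
      ∀ k, k = j ∨ k = j' ∨ k = c₀ ∨ k = c₁ := by
    revert j j'
    decide
  refine ⟨![c₀, c₁], h1.1, fun l => ?_, fun k => ?_⟩
  · fin_cases l
    exacts [⟨h1.2.1, h1.2.2.1⟩, ⟨h1.2.2.2.1, h1.2.2.2.2⟩]
  · rcases h2 k with h | h | h | h
    exacts [Or.inl h, Or.inr (Or.inl h), Or.inr (Or.inr ⟨0, h.symm⟩), Or.inr (Or.inr ⟨1, h.symm⟩)]

namespace IsGeneral

variable {a : Fin 3 × Fin 4 × Fin 5 → ℂ} {p : Fin 10 → Fin 3 → ℂ}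

/-- M_a(x) has rank exactly 2, so X_a is cut out locally by the two minors that border two
independent columns. Their gradients are multiples of yᵀN(s) with y in ker M_a(x), and a linear
relation between them would be a critical point (s,y,x) of the trilinear form. -/
theorem isRegularLocalRing_minorIdeal (hp : IsGeneral a p) {x : Fin 5 → ℂ} (hx : x ≠ 0)
    (hxI : x ∈ zeroLocus ℂ (minorIdeal 3 (linearMatrix a))) :
    IsRegularLocalRing (LocalRingAt (minorIdeal 3 (linearMatrix a)) x) ∧
      ringKrullDim (LocalRingAt (minorIdeal 3 (linearMatrix a)) x) = ((3 : ℕ) : WithBot ℕ∞) := by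
  have hdet := mem_zeroLocus_minorIdeal_iff.1 hxI
  set B := matrixAt a x with hB
  obtain ⟨j, j', hs⟩ : ∃ j j', columnCross B j j' ≠ 0 := by
    by_contra! hcon
    obtain ⟨s, s', hli, h1, h2⟩ := exists_linearIndependent_vecMul hcon
    rw [vecMul_matrixAt] at h1 h2
    exact hp.not_mulVec_eq_zero hx hli h1 h2
  obtain ⟨i₀, hi₀⟩ : ∃ i, columnCross B j j' i ≠ 0 := Function.ne_iff.1 hs
  have hjj : j ≠ j' := fun h => hs (by rw [h, columnCross_self])
  obtain ⟨c, hc01, hcj, hcov⟩ := exists_complement hjj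
  have hsx : (contractRows a (columnCross B j j')).mulVec x = 0 := by
    rw [← vecMul_matrixAt]
    ext k
    rw [vecMul_columnCross, hdet, Pi.zero_apply]
  set S := columnCross (linearMatrix a) j j' with hS
  have hSeval : (fun i => eval x (S i)) = columnCross B j j' := by
    funext i
    rw [hS, map_columnCross, map_linearMatrix_eval]
  let δ : Fin 4 → MvPolynomial (Fin 5) ℂ := fun k => Matrix.vecMul S (linearMatrix a) k
  have hδj : δ j = 0 := vecMul_columnCross_left _ _ _
  have hδj' : δ j' = 0 := vecMul_columnCross_right _ _ _
  have hδ : ∀ k, δ k = ((linearMatrix a).submatrix id ![k, j, j']).det :=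
    vecMul_columnCross _ _ _
  have hmem : ∀ k, δ k ∈ Ideal.span (Set.range fun l => δ (c l)) := by
    intro k
    rcases hcov k with rfl | rfl | ⟨l, rfl⟩
    · rw [hδj]; exact zero_mem _
    · rw [hδj']; exact zero_mem _
    · exact Ideal.subset_span ⟨l, rfl⟩
  -- The kernel vectors of M_a(x) from `columnCross_mul`, one for each column.
  let y : Fin 4 → Fin 4 → ℂ := fun k => columnCross B j j' i₀ • Pi.single k 1 -
    columnCross B k j' i₀ • Pi.single j 1 - columnCross B j k i₀ • Pi.single j' 1
  have hBy : ∀ k, B.mulVec (y k) = 0 := by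
    intro k
    ext i
    have := columnCross_mul B j j' k i₀ i
    rw [hdet, ite_self] at this
    simpa [y, Matrix.mulVec_sub, Matrix.mulVec_smul] using this
  have hgrad : ∀ k, columnCross B j j' i₀ • gradient x (δ k) =
      Matrix.vecMul (y k) (contractRows a (columnCross B j j')) := by
    intro k
    rw [← hSeval, ← gradient_sum_vecMul S (hBy k), ← map_smul, smul_eq_C_mul]
    congr 1
    have h1 : ∀ m, C (y k m) * Matrix.vecMul S (linearMatrix a) m =
        C (columnCross B j j' i₀) * (if m = k then δ k else 0) := by
      intro m
      change C (y k m) * δ m = _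
      by_cases hmj : m = j
      · rw [hmj, hδj]
        split_ifs with h
        · rw [← h, hδj, mul_zero, mul_zero]
        · simp
      · by_cases hmj' : m = j'
        · rw [hmj', hδj']
          split_ifs with h
          · rw [← h, hδj', mul_zero, mul_zero]
          · simp
        · split_ifs with h
          · subst h
            simp [y, hmj, hmj']
          · simp [y, hmj, hmj', h]
    simp only [h1, ← Finset.mul_sum, Finset.sum_ite_eq', Finset.mem_univ, if_true]
    rw [congrFun hSeval i₀]
  have hli : LinearIndependent ℂ fun l => gradient x (δ (c l)) := by
    rw [Fintype.linearIndependent_iff]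
    intro g hg
    have hY : ∑ l, g l • y (c l) = 0 := by
      by_contra hY
      refine hp.nondegenerate hs hY hx ?_ hsx fun v => ?_
      · rw [Matrix.sum_vecMul]
        simp only [Matrix.smul_vecMul, ← hgrad]
        rw [← smul_zero (columnCross B j j' i₀), ← hg, Finset.smul_sum]
        exact Finset.sum_congr rfl fun _ _ => smul_comm _ _ _
      · rw [← vecMul_matrixAt, dotProduct_comm, ← Matrix.dotProduct_mulVec, Matrix.mulVec_sum]
        simp [Matrix.mulVec_smul, ← hB, hBy]
    have h2 : ∀ l l', l ≠ l' → c l ≠ c l' := by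
      intro l l' hne
      fin_cases l <;> fin_cases l'
      exacts [absurd rfl hne, hc01, hc01.symm, absurd rfl hne]
    intro l
    have h3 := congrFun hY (c l)
    rw [Finset.sum_apply, Finset.sum_eq_single l] at h3
    · simpa [y, Pi.single_apply, (hcj l).1, (hcj l).2, hi₀] using h3
    · intro l' _ hl'
      simp [y, (hcj l).1, (hcj l).2, h2 l l' hl'.symm]
    · simp
  have hmain := isRegularLocalRing_of_gradient
    (G := {d | ∃ (r : Fin 3 ↪o Fin 3) (c : Fin 3 ↪o Fin 4),
      d = ((linearMatrix a).submatrix r c).det}) (p := x) hxI (fun l => δ (c l))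
    (fun l => by rw [hδ]; exact det_submatrix_mem_minorIdeal _ _)
    (by
      rintro _ ⟨r, d, rfl⟩
      -- By Cramer, Sᵢ₀ times any minor is a combination of the entries of SᵀM, which are the δ's;
      -- Sᵢ₀ is nonzero at x.
      refine ⟨S i₀, ?_, mul_det_mem_span _ _ _ fun l => ?_⟩
      · rw [congrFun hSeval i₀]
        exact hi₀
      · rw [orderEmbedding_eq_id]
        exact hmem (d l)) hli
  exact ⟨hmain.1, hmain.2.trans (by rw [Fintype.card_fin])⟩

theorem exists_mem_zeroLocus_minorIdeal (hp : IsGeneral a p) :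
    ∃ x ≠ 0, x ∈ zeroLocus ℂ (minorIdeal 3 (linearMatrix a)) := by
  obtain ⟨x, h, hx⟩ := Submodule.exists_mem_ne_zero_of_ne_bot
    (LinearMap.ker_ne_bot_of_finrank_lt (f := (contractRows a (p 0)).mulVecLin) (by simp))
  refine ⟨x, hx, mem_zeroLocus_minorIdeal_of_mulVec (s := p 0) (fun h0 => ?_) h⟩
  have := hp.normalized 0
  rw [h0] at this
  exact zero_ne_one this

theorem ringKrullDim_minorIdeal (hp : IsGeneral a p) :
    ringKrullDim (MvPolynomial (Fin 5) ℂ ⧸ minorIdeal 3 (linearMatrix a)) =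
      ((3 : ℕ) : WithBot ℕ∞) := by
  refine le_antisymm (ringKrullDim_quotient_le (Set.finite_singleton 0) fun x hx hx0 =>
    (hp.isRegularLocalRing_minorIdeal hx0 hx).2.le) ?_
  obtain ⟨x, hx0, hx⟩ := hp.exists_mem_zeroLocus_minorIdeal
  rw [← (hp.isRegularLocalRing_minorIdeal hx0 hx).2]
  exact ringKrullDim_localRingAt_le hx

/-- The minors are cubic in x, so the tangent space at 0 is all of ℂ⁵, whereas the dimension is 3.
-/
theorem zero_mem_singularPoints_minorIdeal (hp : IsGeneral a p) :
    0 ∈ singularPoints (minorIdeal 3 (linearMatrix a)) := by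
  have h0 : (0 : Fin 5 → ℂ) ∈ zeroLocus ℂ (minorIdeal 3 (linearMatrix a)) :=
    mem_zeroLocus_minorIdeal_of_mulVec (s := p 0) (fun h0 => by
      have := hp.normalized 0
      rw [h0] at this
      exact zero_ne_one this) (Matrix.mulVec_zero _)
  refine ⟨h0, not_isRegularLocalRing (M := Fin 5 → ℂ) (v := fun i => Pi.single i 1) ?_ ?_ ?_⟩
  · let φ : MvPolynomial (Fin 5) ℂ →ₐ[ℂ] TrivSqZeroExt ℂ (Fin 5 → ℂ) := aeval fun i =>
      TrivSqZeroExt.inl ((0 : Fin 5 → ℂ) i) + TrivSqZeroExt.inr (Pi.single i 1)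
    have h1 : ∀ i j, ∃ v, φ (linearMatrix a i j) = TrivSqZeroExt.inr v := by
      intro i j
      refine ⟨∑ k, a (i, j, k) • Pi.single k 1, ?_⟩
      simp [φ, linearMatrix, TrivSqZeroExt.algebraMap_eq_inl, TrivSqZeroExt.inl_mul_inr,
        TrivSqZeroExt.inr_sum]
    choose w hw using h1
    have h2 : minorIdeal 3 (linearMatrix a) ≤ RingHom.ker φ := by
      refine Ideal.span_le.2 ?_
      rintro _ ⟨r, c, rfl⟩
      change φ _ = 0
      rw [AlgHom.map_det, Matrix.det_fin_three]
      simp [hw]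
    exact h2
  · rw [← (Pi.basisFun ℂ (Fin 5)).span_eq]
    congr 2
    ext i : 1
    simp
  · refine lt_of_le_of_lt ((ringKrullDim_localRingAt_le h0).trans hp.ringKrullDim_minorIdeal.le) ?_
    rw [Module.finrank_fintype_fun_eq_card, Fintype.card_fin]
    exact_mod_cast (by norm_num : 3 < 5)

theorem isICMC2 (hp : IsGeneral a p) : IsICMC2 (linearMatrix a) := by
  refine ⟨⟨by norm_num, le_rfl, by norm_num, ?_⟩, hp.zero_mem_singularPoints_minorIdeal,
    Set.univ, isOpen_univ, trivial, ?_⟩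
  · rw [hp.ringKrullDim_minorIdeal]
    norm_num
  · rw [Set.univ_inter]
    refine Set.eq_singleton_iff_unique_mem.2 ⟨hp.zero_mem_singularPoints_minorIdeal, ?_⟩
    rintro x ⟨hx, hreg⟩
    by_contra hx0
    exact hreg (hp.isRegularLocalRing_minorIdeal hx0 hx).1

end IsGeneral

end Determinantal

/-! ### Singular points of the Tjurina transform in a chart -/

theorem Pi.span_range_eq_top {K ι κ : Type*} [Field K] [Fintype κ] {v : ι → κ → K}
    (h : ∀ c : κ → K, (∀ i, ∑ m, c m * v i m = 0) → c = 0) :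
    Submodule.span K (Set.range v) = ⊤ := by
  classical
  by_contra hne
  obtain ⟨f, hf, hker⟩ := Submodule.exists_le_ker_of_lt_top _ (lt_top_iff_ne_top.2 hne)
  have hsum : ∀ w : κ → K, f w = ∑ m, f (Pi.single m 1) * w m := by
    intro w
    rw [LinearMap.pi_apply_eq_sum_univ f w]
    refine Finset.sum_congr rfl fun m _ => ?_
    rw [smul_eq_mul, mul_comm]
    congr 2
    ext m'
    simp [Pi.single_apply, eq_comm]
  have h0 := h (fun m => f (Pi.single m 1)) fun i => by
    rw [← hsum]
    exact hker (Submodule.subset_span ⟨i, rfl⟩)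
  refine hf (LinearMap.ext fun w => ?_)
  rw [hsum]
  exact Finset.sum_eq_zero fun m _ => by rw [congrFun h0 m, Pi.zero_apply, zero_mul]

namespace Determinantal

/-- If the maximal minors vanish, the kernel has dimension at least two. -/
theorem exists_linearIndependent_mulVec {F : Type*} [Field F] {a : Fin 3 × Fin 4 × Fin 5 → F}
    {s : Fin 3 → F} (h : ∀ k, rowMinor a s k = 0) : ∃ w : Fin 2 → Fin 5 → F,
      LinearIndependent F w ∧ ∀ l, (contractRows a s).mulVec (w l) = 0 := by
  obtain ⟨x, hx, hx0⟩ := Submodule.exists_mem_ne_zero_of_ne_bot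
    (LinearMap.ker_ne_bot_of_finrank_lt (f := (contractRows a s).mulVecLin) (by simp))
  obtain ⟨l, hl⟩ : ∃ l, x l ≠ 0 := Function.ne_iff.1 hx0
  -- A second kernel vector comes from the vanishing minor omitting column l. It has l-th entry 0,
  -- while x_l ≠ 0.
  obtain ⟨w, hw0, hw⟩ := Matrix.exists_mulVec_eq_zero_iff.2 (h l)
  refine ⟨![x, l.insertNth 0 w], ?_, ?_⟩
  · rw [LinearIndependent.pair_iff]
    intro c d hcd
    have h1 := congrFun hcd l
    simp [hl] at h1
    refine ⟨h1, ?_⟩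
    rw [h1, zero_smul, zero_add, smul_eq_zero] at hcd
    refine hcd.resolve_right fun h2 => hw0 (funext fun m => ?_)
    simpa using congrFun h2 (l.succAbove m)
  · intro m
    fin_cases m
    · exact hx
    · funext j
      rw [← hw]
      simp [Matrix.mulVec, dotProduct, Fin.sum_univ_succAbove _ l]

variable {a : Fin 3 × Fin 4 × Fin 5 → ℂ} {i : Fin 3} {x : Fin 5 → ℂ} {s : Fin 3 → ℂ}

theorem mem_zeroLocus_tjurinaIdeal : Sum.elim x s ∈ zeroLocus ℂ (Ideal.span (tjurinaEquations a i)) ↔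
    s i = 1 ∧ (contractRows a s).mulVec x = 0 := by
  have h1 : ∀ j, eval (Sum.elim x s) (∑ k, contractRows (fun t => C (a t))
      (fun i => X (Sum.inr i)) j k * X (Sum.inl k)) = (contractRows a s).mulVec x j := by
    intro j
    simp [contractRows, Matrix.mulVec, dotProduct]
  rw [mem_zeroLocus_iff_le, Ideal.span_le]
  constructor
  · intro h
    refine ⟨?_, funext fun j => ?_⟩
    · have := mem_vanishingIdeal_singleton.1 (h (Set.mem_insert _ _))
      simpa [sub_eq_zero] using this
    · rw [← h1]
      exact mem_vanishingIdeal_singleton.1 (h (Set.mem_insert_of_mem _ ⟨j, rfl⟩))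
  · rintro ⟨hs, hx⟩ _ (rfl | ⟨j, rfl⟩)
    · exact mem_vanishingIdeal_singleton.2 (by simp [hs])
    · exact mem_vanishingIdeal_singleton.2 (by rw [h1, hx, Pi.zero_apply])

/-- Combining the four equations with weights y gives the gradient (yᵀN(s), M_a(x)y). The multiple
of sᵢ − 1 in a relation is eliminated by pairing with s, since sᵀM_a(x) = 0 and sᵢ = 1. -/
theorem isRegularLocalRing_tjurina
    (hq : Sum.elim x s ∈ zeroLocus ℂ (Ideal.span (tjurinaEquations a i)))
    (h : ∀ y : Fin 4 → ℂ, Matrix.vecMul y (contractRows a s) = 0 → (matrixAt a x).mulVec y = 0 →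
      y = 0) :
    IsRegularLocalRing (LocalRingAt (Ideal.span (tjurinaEquations a i)) (Sum.elim x s)) ∧
      ringKrullDim (LocalRingAt (Ideal.span (tjurinaEquations a i)) (Sum.elim x s)) =
        ((3 : ℕ) : WithBot ℕ∞) := by
  obtain ⟨hs, hx⟩ := mem_zeroLocus_tjurinaIdeal.1 hq
  let E : Fin 4 → MvPolynomial (Fin 5 ⊕ Fin 3) ℂ := fun j => ∑ k,
    contractRows (fun t => C (a t)) (fun i => X (Sum.inr i)) j k * X (Sum.inl k)
  let E₀ : MvPolynomial (Fin 5 ⊕ Fin 3) ℂ := X (Sum.inr i) - 1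
  have hmem : ∀ l, (Fin.cons E₀ E : Fin 5 → MvPolynomial (Fin 5 ⊕ Fin 3) ℂ) l ∈
      tjurinaEquations a i := by
    intro l
    refine Fin.cases ?_ (fun j => ?_) l
    · exact Set.mem_insert _ _
    · exact Set.mem_insert_of_mem _ ⟨j, rfl⟩
  have hg0 : gradient (Sum.elim x s) E₀ = Pi.single (Sum.inr i) 1 := by
    ext t
    rw [gradient_apply]
    simp [E₀, pderiv_X, Pi.single_apply, apply_ite, eq_comm]
  have hg1 : ∀ j k, gradient (Sum.elim x s) (E j) (Sum.inl k) = contractRows a s j k := by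
    intro j k
    rw [gradient_apply]
    simp [E, contractRows, pderiv_X, Pi.single_apply]
  have hg2 : ∀ j m, gradient (Sum.elim x s) (E j) (Sum.inr m) = matrixAt a x m j := by
    intro j m
    rw [gradient_apply]
    simp [E, contractRows, matrixAt, pderiv_X, Pi.single_apply]
    exact Finset.sum_congr rfl fun _ _ => mul_comm _ _
  have hli : LinearIndependent ℂ fun l => gradient (Sum.elim x s)
      ((Fin.cons E₀ E : Fin 5 → MvPolynomial (Fin 5 ⊕ Fin 3) ℂ) l) := by
    rw [Fintype.linearIndependent_iff]
    intro g hg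
    rw [Fin.sum_univ_succ] at hg
    simp only [Fin.cons_zero, Fin.cons_succ, hg0] at hg
    have h1 : Matrix.vecMul (fun j => g (Fin.succ j)) (contractRows a s) = 0 := by
      funext k
      have := congrFun hg (Sum.inl k)
      simpa [hg1, Matrix.vecMul, dotProduct] using this
    have h2 : ∀ m, g 0 * (if m = i then 1 else 0) +
        (matrixAt a x).mulVec (fun j => g (Fin.succ j)) m = 0 := by
      intro m
      have := congrFun hg (Sum.inr m)
      simpa [hg2, Matrix.mulVec, dotProduct, Pi.single_apply, mul_comm] using this
    have h3 : g 0 = 0 := by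
      have h4 : s ⬝ᵥ (matrixAt a x).mulVec (fun j => g (Fin.succ j)) = 0 := by
        rw [Matrix.dotProduct_mulVec, vecMul_matrixAt, hx, zero_dotProduct]
      have h5 : ∑ m, s m * (g 0 * (if m = i then 1 else 0) +
          (matrixAt a x).mulVec (fun j => g (Fin.succ j)) m) = 0 :=
        Finset.sum_eq_zero fun m _ => by rw [h2, mul_zero]
      simp only [mul_add, Finset.sum_add_distrib] at h5
      rw [dotProduct] at h4
      rw [h4, add_zero] at h5
      simpa [hs] using h5
    have h4 := h _ h1 (funext fun m => by simpa [h3] using h2 m)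
    exact fun l => Fin.cases h3 (fun j => congrFun h4 j) l
  have hmain := isRegularLocalRing_of_gradient hq _ (fun l => Ideal.subset_span (hmem l))
    (by
      rintro _ (rfl | ⟨j, rfl⟩)
      · exact ⟨1, by simp, by rw [one_mul]; exact Ideal.subset_span ⟨0, rfl⟩⟩
      · exact ⟨1, by simp, by rw [one_mul]; exact Ideal.subset_span ⟨j.succ, rfl⟩⟩) hli
  exact ⟨hmain.1, hmain.2.trans (by simp)⟩

theorem not_isRegularLocalRing_tjurina (hs : s i = 1) (h : ∀ k, rowMinor a s k = 0)
    (hdim : ringKrullDim (MvPolynomial (Fin 5 ⊕ Fin 3) ℂ ⧸ Ideal.span (tjurinaEquations a i)) ≤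
      ((3 : ℕ) : WithBot ℕ∞)) :
    ¬ IsRegularLocalRing (LocalRingAt (Ideal.span (tjurinaEquations a i)) (Sum.elim 0 s)) := by
  obtain ⟨w, hli, hw⟩ := exists_linearIndependent_mulVec h
  -- At x = 0 the equations N(s)x = 0 do not involve ds to first order. Two kernel directions in x
  -- and the two chart directions in s give a tangent space of dimension at least 4, exceeding 3.
  let v : Fin 5 ⊕ Fin 3 → Fin 2 ⊕ Fin 2 → ℂ :=
    Sum.elim (fun k => Sum.elim (fun l => w l k) 0)
      (fun j => Sum.elim 0 fun l => if j = i.succAbove l then 1 else 0)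
  have hq : Sum.elim (0 : Fin 5 → ℂ) s ∈ zeroLocus ℂ (Ideal.span (tjurinaEquations a i)) :=
    mem_zeroLocus_tjurinaIdeal.2 ⟨hs, Matrix.mulVec_zero _⟩
  refine not_isRegularLocalRing (M := Fin 2 ⊕ Fin 2 → ℂ) (v := v) ?_ ?_ ?_
  · let φ : MvPolynomial (Fin 5 ⊕ Fin 3) ℂ →ₐ[ℂ] TrivSqZeroExt ℂ (Fin 2 ⊕ Fin 2 → ℂ) :=
      aeval fun t => TrivSqZeroExt.inl ((Sum.elim 0 s : Fin 5 ⊕ Fin 3 → ℂ) t) +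
        TrivSqZeroExt.inr (v t)
    suffices Ideal.span (tjurinaEquations a i) ≤ RingHom.ker φ from this
    refine Ideal.span_le.2 ?_
    rintro _ (rfl | ⟨j, rfl⟩)
    · have hv : v (Sum.inr i) = 0 := by
        ext (l | l) <;> simp [v, (Fin.succAbove_ne _ _).symm]
      change φ _ = 0
      simp [φ, hs, hv]
    · change φ _ = 0
      have h1 : φ (∑ k, contractRows (fun t => C (a t)) (fun i => X (Sum.inr i)) j k *
          X (Sum.inl k)) = TrivSqZeroExt.inr (∑ k, contractRows a s j k • v (Sum.inl k)) := by
        rw [TrivSqZeroExt.inr_sum, map_sum]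
        refine Finset.sum_congr rfl fun k _ => ?_
        have h2 : (φ (contractRows (fun t => C (a t)) (fun i => X (Sum.inr i)) j k)).fst =
            contractRows a s j k := by
          simp [φ, contractRows, TrivSqZeroExt.algebraMap_eq_inl, TrivSqZeroExt.fst_sum]
        rw [map_mul, ← h2]
        ext <;> simp [φ]
      rw [h1]
      have h3 : ∑ k, contractRows a s j k • v (Sum.inl k) = 0 := by
        ext (l | l)
        · have := congrFun (hw l) j
          simpa [v, Matrix.mulVec, dotProduct] using this
        · simp [v]
      rw [h3, TrivSqZeroExt.inr_zero]
  · refine Pi.span_range_eq_top fun c hc => ?_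
    have h1 : ∀ l, c (Sum.inl l) = 0 := by
      refine Fintype.linearIndependent_iff.1 hli (fun l => c (Sum.inl l)) (funext fun k => ?_)
      have := hc (Sum.inl k)
      simpa [v] using this
    have h2 : ∀ l, c (Sum.inr l) = 0 := by
      intro l
      have := hc (Sum.inr (i.succAbove l))
      simpa [v, Fin.succAbove_right_injective.eq_iff] using this
    ext (l | l)
    exacts [h1 l, h2 l]
  · refine lt_of_le_of_lt ((ringKrullDim_localRingAt_le hq).trans hdim) ?_
    rw [Module.finrank_fintype_fun_eq_card]
    exact_mod_cast (by simp : 3 < Fintype.card (Fin 2 ⊕ Fin 2))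

namespace IsGeneral

variable {p : Fin 10 → Fin 3 → ℂ}

theorem isRegularLocalRing_tjurina (hp : IsGeneral a p)
    (hq : Sum.elim x s ∈ zeroLocus ℂ (Ideal.span (tjurinaEquations a i)))
    (h : ¬ (x = 0 ∧ ∀ k, rowMinor a s k = 0)) :
    IsRegularLocalRing (LocalRingAt (Ideal.span (tjurinaEquations a i)) (Sum.elim x s)) ∧
      ringKrullDim (LocalRingAt (Ideal.span (tjurinaEquations a i)) (Sum.elim x s)) =
        ((3 : ℕ) : WithBot ℕ∞) := by
  obtain ⟨hs, hx⟩ := mem_zeroLocus_tjurinaIdeal.1 hq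
  refine Determinantal.isRegularLocalRing_tjurina hq fun y hy hy' => ?_
  by_contra hy0
  refine h ⟨?_, fun k => ?_⟩
  · by_contra hx0
    refine hp.nondegenerate (fun h0 => ?_) hy0 hx0 hy hx fun v => ?_
    · rw [h0] at hs
      exact zero_ne_one hs
    · rw [← vecMul_matrixAt, dotProduct_comm, ← Matrix.dotProduct_mulVec, hy', dotProduct_zero]
  · obtain ⟨j, hj⟩ : ∃ j, y j ≠ 0 := Function.ne_iff.1 hy0
    exact rowMinor_eq_zero_of_vecMul hy ⟨j, isUnit_iff_ne_zero.2 hj⟩ k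

/-- Only finitely many points are exceptional: x = 0 over the ten points, rescaled to the chart sᵢ =
1. -/
theorem ringKrullDim_tjurina_le (hp : IsGeneral a p) (i : Fin 3) :
    ringKrullDim (MvPolynomial (Fin 5 ⊕ Fin 3) ℂ ⧸ Ideal.span (tjurinaEquations a i)) ≤
      ((3 : ℕ) : WithBot ℕ∞) := by
  refine ringKrullDim_quotient_le (F := Set.range fun l => Sum.elim 0 ((p l i)⁻¹ • p l))
    (Set.finite_range _) fun q hq hqF => ?_
  rw [← Sum.elim_comp_inl_inr q] at hq hqF ⊢
  refine (hp.isRegularLocalRing_tjurina hq fun ⟨hx, hs⟩ => hqF ?_).2.le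
  obtain ⟨hsi, -⟩ := mem_zeroLocus_tjurinaIdeal.1 hq
  obtain ⟨l, hl⟩ := hp.eq_smul (fun h0 => by rw [h0] at hsi; exact zero_ne_one hsi) hs
  refine ⟨l, ?_⟩
  rw [hx]
  have h1 : (q ∘ Sum.inr) 0 * p l i = 1 := by
    rw [← hsi]
    exact (congrFun hl i).symm
  change Sum.elim (0 : Fin 5 → ℂ) ((p l i)⁻¹ • p l) = _
  rw [hl, ← eq_inv_of_mul_eq_one_left h1]

theorem mem_singularPoints_tjurinaIdeal (hp : IsGeneral a p) (hs : s i = 1) :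
    Sum.elim x s ∈ singularPoints (tjurinaIdeal (linearMatrix a) i) ↔
      x = 0 ∧ ∀ k, rowMinor a s k = 0 := by
  rw [tjurinaIdeal_linearMatrix]
  constructor
  · rintro ⟨hq, hreg⟩
    by_contra hcon
    exact hreg (hp.isRegularLocalRing_tjurina hq hcon).1
  · rintro ⟨rfl, h⟩
    exact ⟨mem_zeroLocus_tjurinaIdeal.2 ⟨hs, Matrix.mulVec_zero _⟩,
      not_isRegularLocalRing_tjurina hs h (hp.ringKrullDim_tjurina_le i)⟩

end IsGeneral

end Determinantal

/-! ### Passage to the projective plane and conclusion -/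

theorem MvPolynomial.IsHomogeneous.eval_smul_point {R σ : Type*} [CommRing R] {d : ℕ}
    {f : MvPolynomial σ R} (hf : f.IsHomogeneous d) (c : R) (q : σ → R) :
    eval (c • q) f = c ^ d * eval q f := by
  rw [eval_eq, eval_eq, Finset.mul_sum]
  refine Finset.sum_congr rfl fun m hm => ?_
  have h1 : m.degree = d := by
    rw [Finsupp.degree_eq_weight_one]
    exact hf (mem_support_iff.1 hm)
  rw [← h1, Finsupp.degree_apply, ← Finset.prod_pow_eq_pow_sum]
  simp only [Pi.smul_apply, smul_eq_mul, mul_pow, Finset.prod_mul_distrib]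
  ring

namespace Determinantal

namespace IsGeneral

variable {a : Fin 3 × Fin 4 × Fin 5 → ℂ} {p : Fin 10 → Fin 3 → ℂ}

theorem ne_zero (hp : IsGeneral a p) (i : Fin 10) : p i ≠ 0 := fun h => by
  have := hp.normalized i
  rw [h] at this
  exact zero_ne_one this

/-- The ten points of the degeneracy locus in the projective plane. -/
noncomputable def point (hp : IsGeneral a p) (i : Fin 10) : Projectivization ℂ (Fin 3 → ℂ) :=
  Projectivization.mk ℂ (p i) (hp.ne_zero i)

theorem eq_smul_rep (hp : IsGeneral a p) (i : Fin 10) : ∃ c : ℂ, c ≠ 0 ∧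
    p i = c • (hp.point i).rep := by
  obtain ⟨c, hc⟩ := Projectivization.exists_smul_eq_mk_rep ℂ (p i) (hp.ne_zero i)
  refine ⟨((c⁻¹ : ℂˣ) : ℂ), Units.ne_zero _, ?_⟩
  rw [point, ← hc, Units.smul_def, smul_smul, Units.inv_mul, one_smul]

theorem point_injective (hp : IsGeneral a p) : Function.Injective hp.point := by
  intro i j hij
  obtain ⟨c, hc⟩ := (Projectivization.mk_eq_mk_iff ℂ _ _ (hp.ne_zero i) (hp.ne_zero j)).1 hij
  have h1 := congrFun hc 0
  rw [Pi.smul_apply, hp.normalized, hp.normalized, Units.smul_def, smul_eq_mul, mul_one] at h1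
  rw [Units.smul_def, h1, one_smul] at hc
  exact hp.injective hc.symm

theorem mk_eq_point_iff (hp : IsGeneral a p) (q : Projectivization ℂ (Fin 3 → ℂ)) :
    (∃ i, hp.point i = q) ↔ ∀ k, rowMinor a q.rep k = 0 := by
  constructor
  · rintro ⟨i, rfl⟩ k
    obtain ⟨c, hc, h⟩ := hp.eq_smul_rep i
    have h1 := hp.rowMinor_eq_zero i k
    rw [h, rowMinor_smul] at h1
    exact (mul_eq_zero.1 h1).resolve_left (pow_ne_zero _ hc)
  · intro h
    obtain ⟨i, hi⟩ := hp.eq_smul q.rep_nonzero h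
    refine ⟨i, ?_⟩
    rw [← q.mk_rep, point, Projectivization.mk_eq_mk_iff']
    refine ⟨(q.rep 0)⁻¹, ?_⟩
    have h0 := hp.coord_zero_ne_zero _ q.rep_nonzero h
    refine (congrArg ((q.rep 0)⁻¹ • ·) hi).trans ?_
    simp only [smul_smul, inv_mul_cancel₀ h0, one_smul]

open Classical in
theorem inGeneralPosition (hp : IsGeneral a p) :
    InGeneralPosition (Finset.univ.image hp.point) := by
  intro d T hT hcard f hf hfT
  have hT10 : T.card ≤ 10 := (Finset.card_le_card hT).trans
    (Finset.card_image_le.trans (by simp))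
  -- For d ≥ 4 at least C(6,2) = 15 points would be needed, but there are only ten.
  have hd : d ≤ 3 := by
    by_contra hd
    have h1 : (4 + 2).choose 2 ≤ (d + 2).choose 2 := Nat.choose_le_choose 2 (by omega)
    have h2 : (4 + 2).choose 2 = 15 := rfl
    omega
  have hpT : ∀ t : T, ∃ i, hp.point i = t := fun t => by
    simpa using hT t.2
  choose ι hι using hpT
  have hιinj : Function.Injective ι := fun t t' h => Subtype.ext (by rw [← hι, ← hι, h])
  let e₀ : Exps d ≃ T := Fintype.equivOfCardEq (by rw [card_exps, Fintype.card_coe, hcard])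
  have hvan : ∀ t : T, eval (p (ι t)) f = 0 := by
    intro t
    obtain ⟨c, -, h⟩ := hp.eq_smul_rep (ι t)
    rw [h, hf.eval_smul_point, hι, hfT t t.2, mul_zero]
  -- Degree 0 is the case of a constant vanishing at one point.
  rcases Nat.eq_zero_or_pos d with rfl | hd0
  · obtain ⟨t, ht⟩ : T.Nonempty := Finset.card_pos.1 (by rw [hcard]; norm_num)
    have h1 := totalDegree_eq_zero_iff_eq_C.1 (Nat.le_zero.1 hf.totalDegree_le)
    have h2 := hvan ⟨t, ht⟩
    rw [h1, eval_C] at h2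
    rw [h1, h2, C_0]
  · exact hp.eq_zero_of_vanishing hd0 hd ⟨fun m => ι (e₀ m), hιinj.comp e₀.injective⟩ hf
      fun m => hvan (e₀ m)

open Classical in
theorem tjurinaSingularLocus_eq (hp : IsGeneral a p) :
    tjurinaSingularLocus (linearMatrix a) =
      {q | q.1 = 0 ∧ q.2 ∈ Finset.univ.image hp.point} := by
  ext ⟨x, q⟩
  have h1 : q ∈ Finset.univ.image hp.point ↔ ∀ k, rowMinor a q.rep k = 0 := by
    rw [← hp.mk_eq_point_iff]
    simp
  simp only [tjurinaSingularLocus, Set.mem_ofPred_eq, h1]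
  constructor
  · rintro ⟨i, hi, h⟩
    obtain ⟨hx, h⟩ := (hp.mem_singularPoints_tjurinaIdeal (by simp [hi])).1 h
    refine ⟨hx, fun k => ?_⟩
    have := h k
    rw [rowMinor_smul] at this
    exact (mul_eq_zero.1 this).resolve_left (pow_ne_zero _ (inv_ne_zero hi))
  · rintro ⟨hx, h⟩
    obtain ⟨i, hi⟩ : ∃ i, q.rep i ≠ 0 := Function.ne_iff.1 q.rep_nonzero
    exact ⟨i, hi, (hp.mem_singularPoints_tjurinaIdeal (by simp [hi])).2
      ⟨hx, fun k => by rw [rowMinor_smul, h, mul_zero]⟩⟩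

end IsGeneral

end Determinantal

theorem mainTheorem6 :
    ∃ g : MvPolynomial (Fin 3 × Fin 4 × Fin 5) ℂ, g ≠ 0 ∧
      ∀ a : Fin 3 × Fin 4 × Fin 5 → ℂ, MvPolynomial.eval a g ≠ 0 →
        Determinantal.IsICMC2 (Determinantal.linearMatrix a) ∧
        ∃ S : Finset (Projectivization ℂ (Fin 3 → ℂ)),
          S.card = 10 ∧ Determinantal.InGeneralPosition S ∧
          Determinantal.tjurinaSingularLocus (Determinantal.linearMatrix a) =
            {q | q.1 = 0 ∧ q.2 ∈ S} := by
  classical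
  obtain ⟨g, hg, h⟩ := Determinantal.exists_isGeneral Determinantal.isBase_baseForm
  refine ⟨g, hg, fun a ha => ?_⟩
  obtain ⟨p, hp⟩ := h a ha
  refine ⟨hp.isICMC2, Finset.univ.image hp.point, ?_, ?_, ?_⟩
  · rw [Finset.card_image_of_injective _ hp.point_injective, Finset.card_univ, Fintype.card_fin]
  · convert hp.inGeneralPosition
  · convert hp.tjurinaSingularLocus_eq
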